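/- **Setting.** Words in two letters $X, X^*$ are written $u, v, \dots$. An *oriented Kauffman diagram* of type $(u,v)$ is an isotopy class of pairwise disjoint oriented planar strings (without closed loops) in a rectangle, whose end points are the letters of $u$ on the upper line and the letters of $v$ on the lower line, such that a string starts at each upper $X$ and lower $X^*$ and ends at each upper $X^*$ and lower $X$. For $d\in\mathbb C^\times$ let $\mathcal O_d$ be the strict $\mathbb C$-linear tensor category whose objects are the words (tensor product: concatenation of words, unit object $I$: the empty word), whose morphisms $u\to v$ are the formal complex linear combinations of oriented Kauffman diagrams of type $(u,v)$, with composition given by vertical concatenation (the first morphism on top), each closed loop being replaced by the factor $d$, and with tensor product given by horizontal juxtaposition. Let $\epsilon_X: X\otimes X^*\to I$, $\epsilon_{X^*}: X^*\otimes X\to I$, $\delta_X: I\to X^*\otimes X$, $\delta_{X^*}: I\to X\otimes X^*$ be the single arcs. For a diagram $D$ of type $(u,v)$ let $D'$, of type $(v,u)$, be the orientation reversal of the reflection of $D$ in a horizontal line, and let $$\sharp(D)=\#\{\epsilon_X\text{'s and }\epsilon_{X^*}\text{'s in }D\}-\#\{\delta_X\text{'s and }\delta_{X^*}\text{'s in }D\},\qquad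 l(D)=\#\{\epsilon_{X^*}\text{'s in }D\}-\#\{\delta_{X^*}\text{'s in }D\},$$ where an $\epsilon_X$ (resp. $\epsilon_{X^*}$) in $D$ is a string joining two upper points whose left end is $X$ (resp. $X^*$), and a $\delta_X$ (resp. $\delta_{X^*}$) in $D$ is a string joining two lower points whose left end is $X^*$ (resp. $X$). A *compatible $*$-structure* on $\mathcal O_d$ is a family of conjugate-linear maps $\operatorname{Hom}(u,v)\to\operatorname{Hom}(v,u)$, $f\mapsto f^*$, with $f^{**}=f$, $(gf)^*=f^*g^*$ and $(f\otimes g)^*=f^*\otimes g^*$. Two compatible $*$-structures $*$ and $\star$ are *equivalent* if there is a $\mathbb C$-linear monoidal self-equivalence $F$ of $\mathcal O_d$ with $F(f^*)=F(f)^\star$ for all morphisms $f$, whose structure isomorphisms $I\to F(I)$ and $F(u)\otimes F(v)\to F(u\otimes v)$ are unitary with respect to $\star$. **Proposition 4.1.** Let $d\in\mathbb C^\times$. 1. The tensor category $\mathcal O_d$ admits a compatible $*$-structure if and only if $d^2\in\mathbb R$, i.e. $d=\pm\overline d$. 2. Suppose that $d^2\in\mathbb R$. Then the compatible $*$-structures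 on $\mathcal O_d$ are parametrized bijectively by the $c\in\mathbb C^\times$ with $\overline{cd}=cd$; the $*$-structure with parameter $c$ is given by $$D^*=c^{\sharp(D)}\left(\frac{\overline d}{d}\right)^{l(D)}D'$$ for every oriented Kauffman diagram $D$. 3. Suppose that $d^2\in\mathbb R$. The $*$-structures with parameters $c$ and $c'$ are equivalent if and only if $c=\lambda c'$ or $\overline c=\lambda c'$ for some real $\lambda>0$. -/

import Mathlib

open CategoryTheory MonoidalCategory

universe v u

/-- A compatible *-structure on a complex linear monoidal category: a conjugate-linear, involutive
operation that is the identity on objects, reverses composition and respects tensor products, and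
for which the structure isomorphisms are unitary (which holds trivially in the strict case). -/
@[ext]
structure CompatibleStar (C : Type u) [Category.{v} C] [Preadditive C] [Linear ℂ C]
    [MonoidalCategory C] where
  adj : ∀ {x y : C}, (x ⟶ y) → (y ⟶ x)
  adj_add : ∀ {x y : C} (f g : x ⟶ y), adj (f + g) = adj f + adj g
  adj_smul : ∀ {x y : C} (a : ℂ) (f : x ⟶ y), adj (a • f) = starRingEnd ℂ a • adj f
  adj_comp : ∀ {x y z : C} (f : x ⟶ y) (g : y ⟶ z), adj (f ≫ g) = adj g ≫ adj f
  adj_adj : ∀ {x y : C} (f : x ⟶ y), adj (adj f) = f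
  adj_tensor : ∀ {x y x' y' : C} (f : x ⟶ y) (g : x' ⟶ y'), adj (f ⊗ₘ g) = adj f ⊗ₘ adj g
  adj_associator : ∀ x y z : C, adj (α_ x y z).hom = (α_ x y z).inv
  adj_leftUnitor : ∀ x : C, adj (λ_ x).hom = (λ_ x).inv
  adj_rightUnitor : ∀ x : C, adj (ρ_ x).hom = (ρ_ x).inv

/-- Two compatible *-structures on the same category are equivalent if some linear monoidal
self-equivalence carries the first to the second. The multiplicativity isomorphisms of the functor
have to be unitary (a void condition on strict functors). -/
def CompatibleStar.Equivalent {C : Type u} [Category.{v} C] [Preadditive C] [Linear ℂ C]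
    [MonoidalCategory C] (S T : CompatibleStar C) : Prop :=
  ∃ (F : C ⥤ C) (_ : F.Additive) (_ : F.Linear ℂ) (_ : F.Monoidal),
    F.IsEquivalence ∧
    (∀ {x y : C} (f : x ⟶ y), F.map (S.adj f) = T.adj (F.map f)) ∧
    T.adj (Functor.LaxMonoidal.ε F) = Functor.OplaxMonoidal.η F ∧
    ∀ x y : C, T.adj (Functor.LaxMonoidal.μ F x y) = Functor.OplaxMonoidal.δ F x y

namespace OrientedKauffman

section Gluing

variable {α β γ δ : Type}

/-- Two pictures are stacked: `σ` tells how strings connect the points `α` on the upper line and the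
points `β` on the middle line, and `τ` tells how strings connect the points `β` and the points `γ`
on the lower line. One step joins a point to the other end of the string of `σ` or of `τ` through
it. -/
inductive GlueStep (σ : α ⊕ β → α ⊕ β) (τ : β ⊕ γ → β ⊕ γ) :
    α ⊕ β ⊕ γ → α ⊕ β ⊕ γ → Prop
  | up (p : α ⊕ β) : GlueStep σ τ (Sum.map id Sum.inl p) (Sum.map id Sum.inl (σ p))
  | down (p : β ⊕ γ) : GlueStep σ τ (Sum.inr p) (Sum.inr (τ p))

/-- Being connected in the stacked picture: the equivalence relation generated by all strings. -/
def glue (σ : α ⊕ β → α ⊕ β) (τ : β ⊕ γ → β ⊕ γ) : Setoid (α ⊕ β ⊕ γ) :=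
  Relation.EqvGen.setoid (GlueStep σ τ)

/-- The points on the upper and lower lines, as points of the stacked picture. -/
def outer : α ⊕ γ → α ⊕ β ⊕ γ := Sum.map id Sum.inr

/-- The number of closed loops in the stacked picture: the connected components that contain no
point of the upper line and no point of the lower line. -/
noncomputable def loopCount (σ : α ⊕ β → α ⊕ β) (τ : β ⊕ γ → β ⊕ γ) : ℕ :=
  Nat.card {K : Quotient (glue σ τ) // ∀ p : α ⊕ γ, Quotient.mk _ (outer p) ≠ K}

variable {σ : α ⊕ β → α ⊕ β} {τ : β ⊕ γ → β ⊕ γ}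

theorem glue_up (p : α ⊕ β) :
    glue σ τ (Sum.map id Sum.inl p) (Sum.map id Sum.inl (σ p)) :=
  Relation.EqvGen.rel _ _ (GlueStep.up p)

theorem glue_down (p : β ⊕ γ) : glue σ τ (Sum.inr p) (Sum.inr (τ p)) :=
  Relation.EqvGen.rel _ _ (GlueStep.down p)

theorem glue_le (r : Setoid (α ⊕ β ⊕ γ))
    (h₁ : ∀ p, r (Sum.map id Sum.inl p) (Sum.map id Sum.inl (σ p)))
    (h₂ : ∀ p, r (Sum.inr p) (Sum.inr (τ p))) {x y : α ⊕ β ⊕ γ} (h : glue σ τ x y) : r x y := by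
  induction h with
  | rel x y h =>
    cases h with
    | up p => exact h₁ p
    | down p => exact h₂ p
  | refl x => exact r.refl x
  | symm x y _ ih => exact r.symm ih
  | trans x y z _ _ h1 h2 => exact r.trans h1 h2

theorem outer_injective : Function.Injective (outer : α ⊕ γ → α ⊕ β ⊕ γ) :=
  Function.injective_id.sumMap Sum.inr_injective

/-- A connected component of the stacked picture has at most two ends. -/
theorem card_outer_le [Finite α] [Finite β] [Finite γ]
    (hσ : Function.Involutive σ) (hτ : Function.Involutive τ) (t : α ⊕ β ⊕ γ)
    (S : Finset (α ⊕ γ)) (hS : ∀ p ∈ S, glue σ τ t (outer p)) : S.card ≤ 2 := by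
  classical
  have := Fintype.ofFinite α
  have := Fintype.ofFinite β
  have := Fintype.ofFinite γ
  let G : SimpleGraph (α ⊕ β ⊕ γ) := SimpleGraph.fromRel (GlueStep σ τ)
  have hreach : ∀ x y, glue σ τ x y → G.Reachable x y := by
    intro x y h
    induction h with
    | rel x y h =>
      by_cases hxy : x = y
      · exact hxy ▸ SimpleGraph.Reachable.refl _
      · exact SimpleGraph.Adj.reachable ⟨hxy, Or.inl h⟩
    | refl x => exact SimpleGraph.Reachable.refl _
    | symm x y _ ih => exact ih.symm
    | trans x y z _ _ h1 h2 => exact h1.trans h2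
  have hstep : ∀ x y, G.Adj x y → GlueStep σ τ x y := by
    rintro x y ⟨-, h | h⟩
    · exact h
    · cases h with
      | up p => simpa [hσ p] using GlueStep.up (σ := σ) (τ := τ) (σ p)
      | down p => simpa [hτ p] using GlueStep.down (σ := σ) (τ := τ) (τ p)
  let C := G.connectedComponentMk t
  let H := C.toSimpleGraph
  have hH : H.Connected := C.connected_toSimpleGraph
  have h1 := hH.card_vert_le_card_edgeSet_add_one
  have h2 := H.sum_degrees_eq_twice_card_edges
  let O : Finset C := Finset.univ.filter fun x => ∃ p : α ⊕ γ, outer p = x.1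
  have hdeg : ∀ x : C, H.degree x + (if x ∈ O then 1 else 0) ≤ 2 := by
    intro x
    have key : ∀ N : Finset (α ⊕ β ⊕ γ), (∀ y, GlueStep σ τ x.1 y → y ∈ N) →
        H.degree x ≤ N.card := by
      intro N hN
      rw [← SimpleGraph.card_neighborFinset_eq_degree]
      refine Finset.card_le_card_of_injOn Subtype.val ?_ Subtype.val_injective.injOn
      intro y hy
      have hy' : H.Adj x y := by simpa using hy
      exact hN _ (hstep _ _ hy')
    let N : α ⊕ β ⊕ γ → Finset (α ⊕ β ⊕ γ) := Sum.elim
      (fun x => {Sum.map id Sum.inl (σ (Sum.inl x))}) (Sum.elim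
      (fun x => {Sum.map id Sum.inl (σ (Sum.inr x)), Sum.inr (τ (Sum.inl x))})
      (fun x => {Sum.inr (τ (Sum.inr x))}))
    have hN : ∀ x y, GlueStep σ τ x y → y ∈ N x := by
      rintro _ _ (⟨p | p⟩ | ⟨p | p⟩) <;> simp [N]
    have h3 := key (N x.1) (hN x.1)
    obtain ⟨x | x | x, hx⟩ := x
    · have h4 : (N (Sum.inl x)).card = 1 := rfl
      have h5 := h3.trans_eq h4
      split_ifs <;> omega
    · have h4 : (⟨Sum.inr (Sum.inl x), hx⟩ : C) ∉ O := by simp [O, outer]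
      rw [if_neg h4]
      exact h3.trans Finset.card_le_two
    · have h4 : (N (Sum.inr (Sum.inr x))).card = 1 := rfl
      have h5 := h3.trans_eq h4
      split_ifs <;> omega
  have hO : S.card ≤ O.card := by
    have hmem : ∀ p ∈ S, outer p ∈ C := fun p hp =>
      (SimpleGraph.ConnectedComponent.eq.2 (hreach _ _ (hS p hp)).symm)
    rw [← Finset.card_attach]
    refine Finset.card_le_card_of_injOn (fun p => ⟨outer p.1, hmem p.1 p.2⟩) ?_ ?_
    · intro p _
      exact Finset.mem_coe.2 (Finset.mem_filter.2 ⟨Finset.mem_univ _, p.1, rfl⟩)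
    · intro p _ q _ h
      exact Subtype.ext (outer_injective (congrArg Subtype.val h))
  have h3 : ∑ x, (H.degree x + (if x ∈ O then 1 else 0)) ≤ ∑ x : C, 2 :=
    Finset.sum_le_sum fun x _ => hdeg x
  rw [Finset.sum_add_distrib, h2] at h3
  simp only [Finset.sum_ite_mem, Finset.univ_inter, Finset.sum_const, smul_eq_mul, mul_one,
    Finset.card_univ] at h3
  rw [Nat.card_eq_fintype_card, Nat.card_eq_fintype_card, ← SimpleGraph.edgeFinset_card] at h1
  omega

theorem sum_eq_zero {ι : Type} (f : ι → ι) (hf : Function.Involutive f) (o : ι → ℤ)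
    (ho : ∀ p, o (f p) = - o p) (h0 : ∀ p, o p ≠ 0) (S : Finset ι) (hS : ∀ p ∈ S, f p ∈ S) :
    ∑ p ∈ S, o p = 0 :=
  Finset.sum_involution (fun p _ => f p) (fun p _ => by rw [ho]; ring)
    (fun p _ _ h => h0 p (by have := ho p; rw [h] at this; omega))
    (fun p hp => hS p hp) (fun p _ => hf p)

/-- Each end of the glued picture is joined to exactly one other end, and the orientations at
the two ends are opposite. -/
theorem existsUnique_end [Finite α] [Finite β] [Finite γ]
    (hσ : Function.Involutive σ) (hτ : Function.Involutive τ)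
    {a : α → ℤ} {b : β → ℤ} {c : γ → ℤ} (ha : ∀ x, a x ≠ 0) (hb : ∀ x, b x ≠ 0)
    (hc : ∀ x, c x ≠ 0)
    (hoσ : ∀ p, Sum.elim a (-b) (σ p) = - Sum.elim a (-b) p)
    (hoτ : ∀ p, Sum.elim b (-c) (τ p) = - Sum.elim b (-c) p) (p : α ⊕ γ) :
    ∃ q, q ≠ p ∧ Sum.elim a (-c) q = - Sum.elim a (-c) p ∧
      ∀ q', glue σ τ (outer p) (outer q') ↔ q' = p ∨ q' = q := by
  classical
  have := Fintype.ofFinite α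
  have := Fintype.ofFinite β
  have := Fintype.ofFinite γ
  let K : α ⊕ β ⊕ γ → Prop := fun x => glue σ τ (outer p) x
  have h0c : ∀ q : α ⊕ γ, Sum.elim a (-c) q ≠ 0 := by
    rintro (q | q) <;> simp [ha, hc]
  have e1 := sum_eq_zero σ hσ (Sum.elim a (-b)) hoσ (by rintro (q | q) <;> simp [ha, hb])
    (Finset.univ.filter fun q => K (Sum.map id Sum.inl q)) (by
      intro q hq
      simp only [Finset.mem_filter, Finset.mem_univ, true_and] at hq ⊢
      exact (glue σ τ).trans hq (glue_up q))
  have e2 := sum_eq_zero τ hτ (Sum.elim b (-c)) hoτ (by rintro (q | q) <;> simp [hb, hc])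
    (Finset.univ.filter fun q => K (Sum.inr q)) (by
      intro q hq
      simp only [Finset.mem_filter, Finset.mem_univ, true_and] at hq ⊢
      exact (glue σ τ).trans hq (glue_down q))
  let S : Finset (α ⊕ γ) := Finset.univ.filter fun q => K (outer q)
  have e3 : ∑ q ∈ S, Sum.elim a (-c) q = 0 := by
    rw [Finset.sum_filter, Fintype.sum_sum_type] at e1 e2 ⊢
    simp only [Sum.map_inl, Sum.map_inr, id, outer,
      Sum.elim_inl, Sum.elim_inr, Pi.neg_apply] at e1 e2 ⊢
    have e4 : ∑ x, (if K (Sum.inr (Sum.inl x)) then -b x else 0) =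
        - ∑ x, (if K (Sum.inr (Sum.inl x)) then b x else 0) := by
      rw [← Finset.sum_neg_distrib]
      exact Finset.sum_congr rfl fun x _ => by split_ifs <;> simp
    have e5 : ∑ x, (if K (Sum.inl x) then a x else 0) +
        ∑ x, (if K (Sum.inr (Sum.inr x)) then -c x else 0) = 0 := by
      have e1' : ∑ x, (if K (Sum.inl x) then a x else 0) +
        ∑ x, (if K (Sum.inr (Sum.inl x)) then -b x else 0) = 0 := e1
      have e2' : ∑ x, (if K (Sum.inr (Sum.inl x)) then b x else 0) +
        ∑ x, (if K (Sum.inr (Sum.inr x)) then -c x else 0) = 0 := e2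
      linarith
    exact e5
  have hcard : S.card ≤ 2 := card_outer_le hσ hτ (outer p) S (by simp [S, K])
  have hp : p ∈ S := by simp [S, K]
  have hex : ∃ q ∈ S, q ≠ p := by
    by_contra hcon
    push Not at hcon
    have : S = {p} := Finset.eq_singleton_iff_unique_mem.2 ⟨hp, hcon⟩
    rw [this, Finset.sum_singleton] at e3
    exact h0c p e3
  obtain ⟨q, hq, hqp⟩ := hex
  have hSq : S = {p, q} := by
    symm
    apply Finset.eq_of_subset_of_card_le
    · intro x hx
      simp only [Finset.mem_insert, Finset.mem_singleton] at hx
      rcases hx with rfl | rfl <;> assumption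
    · rw [Finset.card_pair hqp.symm]; exact hcard
  refine ⟨q, hqp, ?_, fun q' => ?_⟩
  · rw [hSq, Finset.sum_pair hqp.symm] at e3
    linarith
  · have : q' ∈ S ↔ q' ∈ ({p, q} : Finset (α ⊕ γ)) := by rw [hSq]
    simpa [S, K] using this

end Gluing

section Pushout

variable {S U W V : Type} {o : S → U} {o' : S → W} {i : U → V} {j : W → V}
  {r : Setoid U} {E : Setoid W} {F : Setoid V}

theorem pushout_cases (hi : Function.Injective i) (hj : Function.Injective j)
    (hov : ∀ u w, i u = j w → ∃ s, u = o s ∧ w = o' s)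
    (hE1 : ∀ s t, r (o s) (o t) → E (o' s) (o' t))
    {a b : V} (h : Relation.EqvGen (fun a b => (∃ u u', a = i u ∧ b = i u' ∧ r u u') ∨
      ∃ x y, a = j x ∧ b = j y ∧ E x y) a b) :
    a = b ∨ (∃ u u', a = i u ∧ b = i u' ∧ r u u') ∨
      ∃ x y, (a = j x ∨ ∃ u s, a = i u ∧ x = o' s ∧ r u (o s)) ∧
        (b = j y ∨ ∃ u s, b = i u ∧ y = o' s ∧ r u (o s)) ∧ E x y := by
  induction h with
  | rel a b h =>
    rcases h with h | ⟨x, y, h1, h2, h3⟩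
    · exact Or.inr (Or.inl h)
    · exact Or.inr (Or.inr ⟨x, y, Or.inl h1, Or.inl h2, h3⟩)
  | refl a => exact Or.inl rfl
  | symm a b _ ih =>
    rcases ih with h | ⟨u, u', h1, h2, h3⟩ | ⟨x, y, h1, h2, h3⟩
    · exact Or.inl h.symm
    · exact Or.inr (Or.inl ⟨u', u, h2, h1, r.symm h3⟩)
    · exact Or.inr (Or.inr ⟨y, x, h2, h1, E.symm h3⟩)
  | trans a b c _ _ h1 h2 =>
    rcases h1 with rfl | ⟨u, u', rfl, rfl, h3⟩ | ⟨x, y, ha, hb, hxy⟩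
    · exact h2
    · rcases h2 with rfl | ⟨v, v', h4, rfl, h5⟩ | ⟨x', y', hb', hc, hxy'⟩
      · exact Or.inr (Or.inl ⟨u, u', rfl, rfl, h3⟩)
      · obtain rfl := hi h4
        exact Or.inr (Or.inl ⟨u, v', rfl, rfl, r.trans h3 h5⟩)
      · refine Or.inr (Or.inr ⟨x', y', Or.inr ?_, hc, hxy'⟩)
        rcases hb' with hb' | ⟨v, s, h4, rfl, h5⟩
        · obtain ⟨s, rfl, rfl⟩ := hov _ _ hb'
          exact ⟨u, s, rfl, rfl, h3⟩
        · obtain rfl := hi h4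
          exact ⟨u, s, rfl, rfl, r.trans h3 h5⟩
    · rcases h2 with rfl | ⟨v, v', rfl, rfl, h5⟩ | ⟨x', y', hb', hc, hxy'⟩
      · exact Or.inr (Or.inr ⟨x, y, ha, hb, hxy⟩)
      · refine Or.inr (Or.inr ⟨x, y, ha, Or.inr ?_, hxy⟩)
        rcases hb with hb | ⟨u, s, h4, rfl, h6⟩
        · obtain ⟨s, rfl, rfl⟩ := hov _ _ hb
          exact ⟨v', s, rfl, rfl, r.symm h5⟩
        · obtain rfl := hi h4
          exact ⟨v', s, rfl, rfl, r.trans (r.symm h5) h6⟩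
      · refine Or.inr (Or.inr ⟨x, y', ha, hc, E.trans hxy (E.trans ?_ hxy')⟩)
        rcases hb with rfl | ⟨u, s, rfl, rfl, h6⟩
        · rcases hb' with hb' | ⟨v, s, h4, rfl, h5⟩
          · obtain rfl := hj hb'
            exact E.refl _
          · obtain ⟨t, rfl, rfl⟩ := hov _ _ h4.symm
            exact hE1 _ _ h5
        · rcases hb' with hb' | ⟨v, t, h4, rfl, h5⟩
          · obtain ⟨t, rfl, rfl⟩ := hov _ _ hb'
            exact hE1 _ _ (r.symm h6)
          · obtain rfl := hi h4
            exact hE1 _ _ (r.trans (r.symm h6) h5)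

/-- Gluing a picture in two steps: `r` describes the connections on `U`, `E` the connections
on `W` once those of `U` are taken into account, and `F` the connections on the union `V` of `U`
and `W`. -/
theorem pushout_rel_iff (hi : Function.Injective i) (hj : Function.Injective j)
    (hov : ∀ u w, i u = j w → ∃ s, u = o s ∧ w = o' s)
    (hE1 : ∀ s t, r (o s) (o t) → E (o' s) (o' t))
    (hE : ∀ x y, E x y → F (j x) (j y))
    (hF : ∀ a b, F a b → Relation.EqvGen (fun a b => (∃ u u', a = i u ∧ b = i u' ∧ r u u') ∨
      ∃ x y, a = j x ∧ b = j y ∧ E x y) a b) (x y : W) : F (j x) (j y) ↔ E x y := by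
  refine ⟨fun h => ?_, hE x y⟩
  rcases pushout_cases hi hj hov hE1 (hF _ _ h) with h | ⟨u, u', h1, h2, h3⟩ | ⟨x', y', h1, h2, h3⟩
  · exact hj h ▸ E.refl _
  · obtain ⟨s, rfl, rfl⟩ := hov _ _ h1.symm
    obtain ⟨t, rfl, rfl⟩ := hov _ _ h2.symm
    exact hE1 _ _ h3
  · have aux : ∀ z z', (j z = j z' ∨ ∃ u s, j z = i u ∧ z' = o' s ∧ r u (o s)) → E z z' := by
      rintro z z' (h | ⟨u, s, h, rfl, h4⟩)
      · exact hj h ▸ E.refl _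
      · obtain ⟨t, rfl, rfl⟩ := hov _ _ h.symm
        exact hE1 _ _ h4
    exact E.trans (aux _ _ h1) (E.trans h3 (E.symm (aux _ _ h2)))

theorem pushout_card [Finite V] (hi : Function.Injective i) (hj : Function.Injective j)
    (hio : ∀ s, i (o s) = j (o' s))
    (hov : ∀ u w, i u = j w → ∃ s, u = o s ∧ w = o' s)
    (hcov : ∀ v, (∃ u, v = i u) ∨ ∃ w, v = j w)
    (hE1 : ∀ s t, r (o s) (o t) → E (o' s) (o' t))
    (hr : ∀ x y, r x y → F (i x) (i y))
    (hE : ∀ x y, E x y → F (j x) (j y))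
    (hF : ∀ a b, F a b → Relation.EqvGen (fun a b => (∃ u u', a = i u ∧ b = i u' ∧ r u u') ∨
      ∃ x y, a = j x ∧ b = j y ∧ E x y) a b)
    (P : V → Prop) (hP : ∀ u s, r u (o s) → P (i u) → ∃ w, P (j w) ∧ E w (o' s)) :
    Nat.card {K : Quotient F // ∀ v, P v → Quotient.mk _ v ≠ K} =
      Nat.card {K : Quotient r // (∀ s, Quotient.mk _ (o s) ≠ K) ∧
        ∀ u, P (i u) → Quotient.mk _ u ≠ K} +
      Nat.card {K : Quotient E // ∀ w, P (j w) → Quotient.mk _ w ≠ K} := by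
  have : Finite U := Finite.of_injective i hi
  have : Finite W := Finite.of_injective j hj
  have hcs := fun {a b} h => pushout_cases (r := r) (E := E) hi hj hov hE1 (hF a b h)
  have hjj := pushout_rel_iff hi hj hov hE1 hE hF
  -- a point of `U` that is not joined to `W` is joined only to points of `U`
  have hu : ∀ u v, (∀ s, ¬ r u (o s)) → F v (i u) → ∃ u', v = i u' ∧ r u' u := by
    intro u v hus h
    rcases hcs h with h | ⟨u1, u', h1, h2, h3⟩ | ⟨x', y', h1, h2, h3⟩
    · exact ⟨u, h, r.refl _⟩
    · obtain rfl := hi h2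
      exact ⟨u1, h1, h3⟩
    · exfalso
      rcases h2 with h2 | ⟨u1, s, h2, -, h4⟩
      · obtain ⟨s, rfl, -⟩ := hov _ _ h2
        exact hus s (r.refl _)
      · obtain rfl := hi h2
        exact hus s h4
  rw [← Nat.card_sum]
  symm
  let Φ : {K : Quotient r // (∀ s, Quotient.mk _ (o s) ≠ K) ∧
        ∀ u, P (i u) → Quotient.mk _ u ≠ K} ⊕
      {K : Quotient E // ∀ w, P (j w) → Quotient.mk _ w ≠ K} → Quotient F :=
    Sum.elim (fun K => Quotient.map i hr K.1) (fun K => Quotient.map j hE K.1)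
  have hΦ : ∀ K v, P v → Quotient.mk _ v ≠ Φ K := by
    rintro (⟨K, hK1, hK2⟩ | ⟨K, hK⟩) v hv
    · induction K using Quotient.inductionOn with | _ u
      intro h
      have h' : F v (i u) := Quotient.exact h
      obtain ⟨u', rfl, h3⟩ := hu u v (fun s hs => hK1 s (Quotient.sound (r.symm hs))) h'
      exact hK2 u' hv (Quotient.sound h3)
    · induction K using Quotient.inductionOn with | _ w
      intro h
      have h' : F v (j w) := Quotient.exact h
      rcases hcov v with ⟨u, rfl⟩ | ⟨w', rfl⟩
      · by_cases hus : ∃ s, r u (o s)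
        · obtain ⟨s, hs⟩ := hus
          obtain ⟨w', hw', hE'⟩ := hP u s hs hv
          refine hK w' hw' (Quotient.sound (E.trans hE' ?_))
          refine (hjj _ _).1 (F.trans ?_ h')
          rw [← hio]
          exact F.symm (hr _ _ hs)
        · push Not at hus
          obtain ⟨u', h1, h2⟩ := hu u _ hus (F.symm h')
          obtain ⟨s, rfl, -⟩ := hov _ _ h1.symm
          exact hus s (r.symm h2)
      · exact hK w' hv (Quotient.sound ((hjj _ _).1 h'))
  refine Nat.card_congr (Equiv.ofBijective (fun K => ⟨Φ K, hΦ K⟩) ⟨?_, ?_⟩)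
  · have hmix : ∀ K L, Φ (Sum.inl K) ≠ Φ (Sum.inr L) := by
      rintro ⟨K, hK1, hK2⟩ ⟨L, hL⟩ h
      induction K using Quotient.inductionOn with | _ u
      induction L using Quotient.inductionOn with | _ w
      have h' : F (i u) (j w) := Quotient.exact h
      obtain ⟨u', h1, h2⟩ := hu u _ (fun s hs => hK1 s (Quotient.sound (r.symm hs))) (F.symm h')
      obtain ⟨s, rfl, -⟩ := hov _ _ h1.symm
      exact hK1 s (Quotient.sound h2)
    rintro (⟨K, hK1, hK2⟩ | ⟨K, hK⟩) (⟨L, hL1, hL2⟩ | ⟨L, hL⟩) h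
    · induction K using Quotient.inductionOn with | _ u
      induction L using Quotient.inductionOn with | _ u'
      have h' : F (i u) (i u') := Quotient.exact (congrArg Subtype.val h)
      obtain ⟨u1, h1, h2⟩ := hu u' _ (fun s hs => hL1 s (Quotient.sound (r.symm hs))) h'
      obtain rfl := hi h1
      exact congrArg Sum.inl (Subtype.ext (Quotient.sound h2))
    · exact absurd (congrArg Subtype.val h) (hmix _ _)
    · exact absurd (congrArg Subtype.val h).symm (hmix _ _)
    · induction K using Quotient.inductionOn with | _ u
      induction L using Quotient.inductionOn with | _ u'
      have h' : F (j u) (j u') := Quotient.exact (congrArg Subtype.val h)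
      exact congrArg Sum.inr (Subtype.ext (Quotient.sound ((hjj _ _).1 h')))
  · rintro ⟨K, hK⟩
    induction K using Quotient.inductionOn with | _ v
    have hw : ∀ w, F v (j w) → ∃ L, (⟨Φ L, hΦ L⟩ : {K : Quotient F //
        ∀ v, P v → Quotient.mk _ v ≠ K}) = ⟨Quotient.mk _ v, hK⟩ := by
      intro w h
      refine ⟨Sum.inr ⟨Quotient.mk _ w, fun w' hw' h' => hK (j w') hw' (Quotient.sound ?_)⟩,
        Subtype.ext (Quotient.sound (F.symm h))⟩
      exact F.trans (hE _ _ (Quotient.exact h')) (F.symm h)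
    rcases hcov v with ⟨u, rfl⟩ | ⟨w, rfl⟩
    · by_cases hus : ∃ s, r u (o s)
      · obtain ⟨s, hs⟩ := hus
        exact hw (o' s) (by rw [← hio]; exact hr _ _ hs)
      · push Not at hus
        refine ⟨Sum.inl ⟨Quotient.mk _ u, fun s h => hus s (r.symm (Quotient.exact h)),
          fun u' hu' h => hK (i u') hu' (Quotient.sound (hr _ _ (Quotient.exact h)))⟩, rfl⟩
    · exact hw w (F.refl _)

end Pushout

/-- The two symbols `X` and `X*`. -/
inductive Letter : Type
  | X : Letter
  | Xstar : Letter
  deriving DecidableEq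

/-- `X` counts as `1` and `X*` as `-1`. -/
def Letter.sign : Letter → ℤ
  | X => 1
  | Xstar => -1

/-- Words in the two symbols; they are the objects of the category. -/
abbrev Word := List Letter

/-- The terminal points of a diagram of type `(u, v)`: the letters of `u`, from left to right on the
upper line (`Sum.inl`), and the letters of `v`, from left to right on the lower line (`Sum.inr`). -/
abbrev Pt (u v : Word) := Fin u.length ⊕ Fin v.length

/-- `1` if a string starts at the point, `-1` if it ends there: `X` indicates starting and `X*`
ending for points on the upper line, and the other way round for points on the lower line. -/
def orient (u v : Word) : Pt u v → ℤ :=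
  Sum.elim (fun i => (u.get i).sign) (-fun j => (v.get j).sign)

/-- The place of a terminal point in the cyclic order around the boundary of the rectangle: first
the upper line from left to right, then the lower line from right to left. -/
def pos {m n : ℕ} : Fin m ⊕ Fin n → ℕ :=
  Sum.elim (fun i => (i : ℕ)) (fun j => m + (j.rev : ℕ))

/-- Oriented Kauffman diagrams of type `(u, v)`. The isotopy class of a family of disjoint planar
strings in a rectangle is given by the pairing of its terminal points, and the pairings that occur
are those without crossings, i.e. no four points `p, q, p*, q*` occur in this cyclic order with `p`
paired to `p*` and `q` paired to `q*`. Each string has one starting point and one ending point. -/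
@[ext]
structure Diagram (u v : Word) where
  partner : Pt u v → Pt u v
  partner_partner : ∀ p, partner (partner p) = p
  orient_partner : ∀ p, orient u v (partner p) = -orient u v p
  planar : ∀ p q, ¬ (pos p < pos q ∧ pos q < pos (partner p) ∧ pos (partner p) < pos (partner q))

theorem Letter.sign_ne_zero (x : Letter) : x.sign ≠ 0 := by cases x <;> decide

theorem orient_ne_zero {u v : Word} (p : Pt u v) : orient u v p ≠ 0 := by
  rcases p with p | p <;> simp [orient, Letter.sign_ne_zero]

theorem Diagram.partner_ne {u v : Word} (D : Diagram u v) (p : Pt u v) : D.partner p ≠ p := by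
  intro h
  have h1 := D.orient_partner p
  rw [h] at h1
  exact orient_ne_zero p (by omega)

theorem pos_injective {m n : ℕ} : Function.Injective (pos : Fin m ⊕ Fin n → ℕ) := by
  rintro (p | p) (q | q) h <;>
    simp only [pos, Sum.elim_inl, Sum.elim_inr, Fin.val_rev, Sum.inl.injEq, Sum.inr.injEq,
      Fin.ext_iff, reduceCtorEq] at h ⊢ <;> omega

section Parity

open Classical in
/-- The parity of the number of points in `K`. -/
noncomputable def parity {ι : Type} [Fintype ι] (K : ι → Prop) : ZMod 2 :=
  ∑ i, if K i then 1 else 0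

/-- The parity of the number of points in `K` that precede `x`. -/
noncomputable def before {m n : ℕ} (K : Fin m ⊕ Fin n → Prop) (x : Fin m ⊕ Fin n) : ZMod 2 :=
  parity fun u => K u ∧ pos u < pos x

theorem parity_congr {ι : Type} [Fintype ι] {K L : ι → Prop} (h : ∀ i, K i ↔ L i) :
    parity K = parity L := by
  have : K = L := funext fun i => propext (h i)
  rw [this]

theorem parity_add {ι : Type} [Fintype ι] {K L M : ι → Prop} (h : ∀ i, K i ↔ L i ∨ M i)
    (hd : ∀ i, ¬ (L i ∧ M i)) : parity K = parity L + parity M := by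
  classical
  rw [parity, parity, parity, ← Finset.sum_add_distrib]
  refine Finset.sum_congr rfl fun i _ => ?_
  have h1 := h i
  have h2 := hd i
  by_cases hL : L i <;> by_cases hM : M i <;> simp_all

theorem parity_sum {α β : Type} [Fintype α] [Fintype β] (K : α ⊕ β → Prop) :
    parity K = parity (fun a => K (Sum.inl a)) + parity (fun b => K (Sum.inr b)) := by
  rw [parity, Fintype.sum_sum_type]; rfl

theorem parity_false {ι : Type} [Fintype ι] {K : ι → Prop} (h : ∀ i, ¬ K i) : parity K = 0 := by
  rw [parity]
  exact Finset.sum_eq_zero fun i _ => if_neg (h i)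

theorem before_eq {m n : ℕ} (K : Fin m ⊕ Fin n → Prop) (x : Fin m ⊕ Fin n) :
    before K x = parity fun u => K u ∧ pos u < pos x := rfl

theorem before_inl {m n : ℕ} (K : Fin m ⊕ Fin n → Prop) (a : Fin m) :
    before K (Sum.inl a) = parity fun a' => K (Sum.inl a') ∧ a' < a := by
  rw [before_eq, parity_sum, parity_false (K := fun b => K (Sum.inr b) ∧ _), add_zero]
  · rfl
  · rintro b ⟨-, hb⟩
    simp only [pos, Sum.elim_inl, Sum.elim_inr] at hb
    omega

theorem before_inr {m n : ℕ} (K : Fin m ⊕ Fin n → Prop) (b : Fin n) :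
    before K (Sum.inr b) = parity (fun a => K (Sum.inl a)) +
      parity fun b' => K (Sum.inr b') ∧ b < b' := by
  rw [before_eq, parity_sum]
  congr 1
  · refine parity_congr fun i => and_iff_left ?_
    simp only [pos, Sum.elim_inl, Sum.elim_inr]
    omega
  · refine parity_congr fun i => and_congr_right fun _ => ?_
    simp only [pos, Sum.elim_inr, Fin.val_rev, Fin.lt_def]
    omega

variable {u v : Word} (D : Diagram u v)

theorem Diagram.parity_eq_zero (K : Pt u v → Prop) (hK : ∀ p, K p → K (D.partner p)) :
    parity K = 0 := by
  classical
  rw [parity, ← Finset.sum_filter]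
  refine Finset.sum_involution (fun p _ => D.partner p) (fun _ _ => by decide)
    (fun p _ _ => D.partner_ne p) (fun p hp => ?_) (fun p _ => D.partner_partner p)
  simp only [Finset.mem_filter, Finset.mem_univ, true_and] at hp ⊢
  exact hK p hp

theorem Diagram.before_partner (K : Pt u v → Prop) (hK : ∀ p, K p → K (D.partner p)) (x : Pt u v)
    (hx : ¬ K x) : before K (D.partner x) = before K x := by
  have hx' : ¬ K (D.partner x) := fun h => hx (by simpa [D.partner_partner] using hK _ h)
  have main : ∀ y, ¬ K y → pos y < pos (D.partner y) → before K (D.partner y) = before K y := by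
    intro y hy hlt
    rw [before_eq, before_eq, parity_add (K := fun u => K u ∧ pos u < pos (D.partner y))
      (L := fun u => K u ∧ pos u < pos y)
      (M := fun u => K u ∧ pos y < pos u ∧ pos u < pos (D.partner y)), add_eq_left, D.parity_eq_zero]
    · rintro p ⟨h1, h2, h3⟩
      have hne : ∀ a b : Pt u v, a ≠ b → pos a ≠ pos b := fun a b h h' => h (pos_injective h')
      have n1 := D.planar y p
      have n2 := D.planar (D.partner p) y
      rw [D.partner_partner] at n2
      have hk := hK p h1
      have n3 := hne (D.partner p) y (fun h => hy (h ▸ hk))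
      have n4 := hne (D.partner p) (D.partner y) (fun h => hy (by
        have := congrArg D.partner h
        rw [D.partner_partner, D.partner_partner] at this
        exact this ▸ h1))
      refine ⟨hk, ?_, ?_⟩ <;> omega
    · intro p
      have : K p → pos p ≠ pos y := fun h h' => hy (pos_injective h' ▸ h)
      constructor
      · rintro ⟨h1, h2⟩
        have := this h1
        by_cases h : pos p < pos y
        · exact Or.inl ⟨h1, h⟩
        · exact Or.inr ⟨h1, by omega, h2⟩
      · rintro (⟨h1, h2⟩ | ⟨h1, h2, h3⟩)
        · exact ⟨h1, by omega⟩
        · exact ⟨h1, h3⟩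
    · rintro p ⟨⟨-, h1⟩, -, h2, -⟩
      omega
  rcases lt_trichotomy (pos x) (pos (D.partner x)) with h | h | h
  · exact main x hx h
  · exact absurd (pos_injective h).symm (D.partner_ne x)
  · have := main (D.partner x) hx' (by rwa [D.partner_partner])
    rw [D.partner_partner] at this
    exact this.symm

end Parity

variable {u v w : Word}

theorem Diagram.exists_end (D : Diagram u v) (E : Diagram v w) (p : Pt u w) :
    ∃ q, q ≠ p ∧ orient u w q = - orient u w p ∧
      ∀ q', glue D.partner E.partner (outer p) (outer q') ↔ q' = p ∨ q' = q :=
  existsUnique_end D.partner_partner E.partner_partner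
    (fun i => (u.get i).sign_ne_zero) (fun i => (v.get i).sign_ne_zero)
    (fun i => (w.get i).sign_ne_zero) D.orient_partner E.orient_partner p

/-- The other end of the string through `p` in the concatenation of `D` and `E`. -/
noncomputable def Diagram.compPartner (D : Diagram u v) (E : Diagram v w) (p : Pt u w) : Pt u w :=
  Classical.choose (D.exists_end E p)

theorem Diagram.compPartner_ne (D : Diagram u v) (E : Diagram v w) (p : Pt u w) :
    D.compPartner E p ≠ p := (Classical.choose_spec (D.exists_end E p)).1

theorem Diagram.orient_compPartner (D : Diagram u v) (E : Diagram v w) (p : Pt u w) :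
    orient u w (D.compPartner E p) = - orient u w p := (Classical.choose_spec (D.exists_end E p)).2.1

theorem Diagram.glue_outer_iff (D : Diagram u v) (E : Diagram v w) (p q : Pt u w) :
    glue D.partner E.partner (outer p) (outer q) ↔ q = p ∨ q = D.compPartner E p :=
  (Classical.choose_spec (D.exists_end E p)).2.2 q

/-- Concatenation creates no crossings. -/
theorem Diagram.comp_planar (D : Diagram u v) (E : Diagram v w) (p q : Pt u w) :
    ¬ (pos p < pos q ∧ pos q < pos (D.compPartner E p) ∧
      pos (D.compPartner E p) < pos (D.compPartner E q)) := by
  rintro ⟨h1, h2, h3⟩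
  let r := glue D.partner E.partner
  let K : Fin u.length ⊕ Fin v.length ⊕ Fin w.length → Prop := fun x => r (outer p) x
  let K₁ : Pt u v → Prop := fun x => K (Sum.map id Sum.inl x)
  let K₂ : Pt v w → Prop := fun x => K (Sum.inr x)
  let K₃ : Pt u w → Prop := fun x => K (outer x)
  have hK₁ : ∀ x, K₁ x → K₁ (D.partner x) := fun x hx => r.trans hx (glue_up x)
  have hK₂ : ∀ x, K₂ x → K₂ (E.partner x) := fun x hx => r.trans hx (glue_down x)
  have e₁ := D.parity_eq_zero K₁ hK₁
  rw [parity_sum] at e₁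
  let KA := parity fun a => K (Sum.inl a)
  let KB := parity fun b => K (Sum.inr (Sum.inl b))
  have e₂ : KA + KB = 0 := e₁
  have two : ∀ x : ZMod 2, x + x = 0 := by decide
  have e₃ : KB = KA := by
    have := two KA
    linear_combination e₂ - this
  -- a function on all points which is constant along each string outside `K`
  let S : Fin u.length ⊕ Fin v.length ⊕ Fin w.length → ZMod 2 :=
    Sum.elim (fun a => before K₁ (Sum.inl a))
      (Sum.elim (fun b => before K₁ (Sum.inr b)) (fun c => before K₂ (Sum.inr c)))
  have S₁ : ∀ x, S (Sum.map id Sum.inl x) = before K₁ x := by rintro (x | x) <;> rfl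
  have S₂ : ∀ x, ¬ K₂ x → S (Sum.inr x) = before K₂ x := by
    rintro (x | x) hx
    · change before K₁ (Sum.inr x) = _
      rw [before_inr, before_inl]
      change KA + _ = _
      have : KB = parity (fun b => K (Sum.inr (Sum.inl b)) ∧ x < b) +
          parity (fun b => K (Sum.inr (Sum.inl b)) ∧ b < x) := by
        refine parity_add (fun b => ?_) (fun b => ?_)
        · constructor
          · intro hb
            rcases lt_trichotomy x b with h | rfl | h
            · exact Or.inl ⟨hb, h⟩
            · exact absurd hb hx
            · exact Or.inr ⟨hb, h⟩
          · rintro (h | h) <;> exact h.1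
        · rintro ⟨⟨-, h⟩, -, h'⟩
          exact lt_asymm h h'
      have t := two (parity (fun b => K (Sum.inr (Sum.inl b)) ∧ x < b))
      change KA + parity (fun b => K (Sum.inr (Sum.inl b)) ∧ x < b) =
        parity (fun b => K (Sum.inr (Sum.inl b)) ∧ b < x)
      linear_combination this - e₃ + t
    · rfl
  have S₃ : ∀ x, S (outer x) = before K₃ x := by
    rintro (x | x)
    · change before K₁ (Sum.inl x) = _
      rw [before_inl, before_inl]
      rfl
    · change before K₂ (Sum.inr x) = _
      rw [before_inr, before_inr]
      change KB + _ = KA + _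
      rw [e₃]
      rfl
  have hSr : ∀ x y, r x y → (K x ↔ K y) ∧ (¬ K x → S x = S y) := by
    intro x y h
    refine ⟨⟨fun hx => r.trans hx h, fun hy => r.trans hy (r.symm h)⟩, ?_⟩
    induction h with
    | rel x y h =>
      intro hx
      cases h with
      | up x => rw [S₁, S₁, D.before_partner K₁ hK₁ x hx]
      | down x =>
        rw [S₂ x hx, S₂, E.before_partner K₂ hK₂ x hx]
        intro h
        exact hx (r.trans h (r.symm (glue_down x)))
    | refl x => exact fun _ => rfl
    | symm x y h ih => exact fun hy => (ih fun hx => hy (r.trans hx h)).symm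
    | trans x y z h h' ih ih' =>
      exact fun hx => (ih hx).trans (ih' fun hy => hx (r.trans hy (r.symm h)))
  have hK₃ : ∀ x, K₃ x ↔ x = p ∨ x = D.compPartner E p := D.glue_outer_iff E p
  have hq : ¬ K₃ q := by
    rw [hK₃]
    rintro (rfl | rfl) <;> omega
  have hqq := (hSr (outer q) (outer (D.compPartner E q))
    ((D.glue_outer_iff E _ _).2 (Or.inr rfl))).2 hq
  rw [S₃, S₃] at hqq
  have c₁ : before K₃ q = 1 := by
    classical
    rw [before, parity, Finset.sum_eq_single p]
    · rw [if_pos ⟨(hK₃ p).2 (Or.inl rfl), h1⟩]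
    · intro b _ hb
      rw [if_neg]
      rintro ⟨h, h'⟩
      rcases (hK₃ b).1 h with rfl | rfl
      · exact hb rfl
      · omega
    · simp
  have c₂ : before K₃ (D.compPartner E q) = 0 := by
    classical
    rw [before, parity, Finset.sum_eq_add p (D.compPartner E p) (D.compPartner_ne E p).symm]
    · rw [if_pos ⟨(hK₃ p).2 (Or.inl rfl), by omega⟩, if_pos ⟨(hK₃ _).2 (Or.inr rfl), h3⟩]
      decide
    · rintro b _ ⟨hb, hb'⟩
      rw [if_neg]
      rintro ⟨h, h'⟩
      rcases (hK₃ b).1 h with rfl | rfl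
      · exact hb rfl
      · exact hb' rfl
    · simp
    · simp
  rw [c₁, c₂] at hqq
  exact absurd hqq (by decide)

/-- Concatenation of planar strings, `D` on top of `E`, with the closed loops removed. -/
noncomputable def Diagram.comp (D : Diagram u v) (E : Diagram v w) : Diagram u w where
  partner := D.compPartner E
  partner_partner p := by
    have h := (D.glue_outer_iff E p _).2 (Or.inr rfl)
    have h' := (D.glue_outer_iff E _ p).1 ((glue D.partner E.partner).symm h)
    exact (h'.resolve_left fun h'' => D.compPartner_ne E p h''.symm).symm
  orient_partner := D.orient_compPartner E
  planar := D.comp_planar E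

section Assoc

variable {α β γ δ : Type} {σ : α ⊕ β → α ⊕ β} {τ : β ⊕ γ → β ⊕ γ} {υ : γ ⊕ δ → γ ⊕ δ}

/-- Being connected in a stack of three pictures. -/
def glue₃ (σ : α ⊕ β → α ⊕ β) (τ : β ⊕ γ → β ⊕ γ) (υ : γ ⊕ δ → γ ⊕ δ) :
    Setoid (α ⊕ β ⊕ γ ⊕ δ) :=
  Relation.EqvGen.setoid fun x y =>
    (∃ p, x = Sum.map id Sum.inl p ∧ y = Sum.map id Sum.inl (σ p)) ∨
    (∃ p, x = Sum.inr (Sum.map id Sum.inl p) ∧ y = Sum.inr (Sum.map id Sum.inl (τ p))) ∨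
    (∃ p, x = Sum.inr (Sum.inr p) ∧ y = Sum.inr (Sum.inr (υ p)))

theorem glue₃_first (p : α ⊕ β) :
    glue₃ σ τ υ (Sum.map id Sum.inl p) (Sum.map id Sum.inl (σ p)) :=
  Relation.EqvGen.rel _ _ (Or.inl ⟨p, rfl, rfl⟩)

theorem glue₃_second (p : β ⊕ γ) :
    glue₃ σ τ υ (Sum.inr (Sum.map id Sum.inl p)) (Sum.inr (Sum.map id Sum.inl (τ p))) :=
  Relation.EqvGen.rel _ _ (Or.inr (Or.inl ⟨p, rfl, rfl⟩))

theorem glue₃_third (p : γ ⊕ δ) :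
    glue₃ σ τ υ (Sum.inr (Sum.inr p)) (Sum.inr (Sum.inr (υ p))) :=
  Relation.EqvGen.rel _ _ (Or.inr (Or.inr ⟨p, rfl, rfl⟩))

/-- The number of closed strings in a stack of three pictures. -/
noncomputable def loopCount₃ (σ : α ⊕ β → α ⊕ β) (τ : β ⊕ γ → β ⊕ γ) (υ : γ ⊕ δ → γ ⊕ δ) : ℕ :=
  Nat.card {K : Quotient (glue₃ σ τ υ) // ∀ v,
    (∃ p : α ⊕ δ, v = Sum.map id (fun x => Sum.inr (Sum.inr x)) p) → Quotient.mk _ v ≠ K}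

theorem glue₃_left {ρ : α ⊕ γ → α ⊕ γ}
    (hρ : ∀ p q, glue σ τ (outer p) (outer q) ↔ q = p ∨ q = ρ p) [Finite α] [Finite β] [Finite γ]
    [Finite δ] :
    (∀ x y, glue₃ σ τ υ (Sum.map id Sum.inr x) (Sum.map id Sum.inr y) ↔ glue ρ υ x y) ∧
    loopCount₃ σ τ υ = loopCount σ τ + loopCount ρ υ := by
  let i : α ⊕ β ⊕ γ → α ⊕ β ⊕ γ ⊕ δ := Sum.map id (Sum.map id Sum.inl)
  let j : α ⊕ γ ⊕ δ → α ⊕ β ⊕ γ ⊕ δ := Sum.map id Sum.inr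
  let o' : α ⊕ γ → α ⊕ γ ⊕ δ := Sum.map id Sum.inl
  have hi : Function.Injective i :=
    Function.injective_id.sumMap (Function.injective_id.sumMap Sum.inl_injective)
  have hj : Function.Injective j := Function.injective_id.sumMap Sum.inr_injective
  have hio : ∀ s, i (outer s) = j (o' s) := by rintro (s | s) <;> rfl
  have hov : ∀ u w, i u = j w → ∃ s, u = outer s ∧ w = o' s := by
    rintro (u | u | u) (w | w | w) h <;> simp [i, j] at h <;> subst h
    · exact ⟨Sum.inl u, rfl, rfl⟩
    · exact ⟨Sum.inr u, rfl, rfl⟩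
  have hcov : ∀ v, (∃ u, v = i u) ∨ ∃ w, v = j w := by
    rintro (v | v | v | v)
    · exact Or.inl ⟨Sum.inl v, rfl⟩
    · exact Or.inl ⟨Sum.inr (Sum.inl v), rfl⟩
    · exact Or.inl ⟨Sum.inr (Sum.inr v), rfl⟩
    · exact Or.inr ⟨Sum.inr (Sum.inr v), rfl⟩
  have hE1 : ∀ s t, glue σ τ (outer s) (outer t) → glue ρ υ (o' s) (o' t) := by
    intro s t h
    rcases (hρ s t).1 h with rfl | rfl
    · exact (glue ρ υ).refl _
    · exact glue_up s
  have hr : ∀ x y, glue σ τ x y → glue₃ σ τ υ (i x) (i y) := by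
    intro x y h
    refine glue_le ((glue₃ σ τ υ).comap i) (fun p => ?_) (fun p => ?_) h
    · have := glue₃_first (σ := σ) (τ := τ) (υ := υ) p
      rw [Setoid.comap_rel]
      convert this using 1 <;> [rcases p with p | p; rcases σ p with p | p] <;> rfl
    · exact glue₃_second p
  have hE : ∀ x y, glue ρ υ x y → glue₃ σ τ υ (j x) (j y) := by
    intro x y h
    refine glue_le ((glue₃ σ τ υ).comap j) (fun p => ?_) (fun p => ?_) h
    · have := hr _ _ ((hρ p (ρ p)).2 (Or.inr rfl))
      rw [hio, hio] at this
      exact this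
    · exact glue₃_third p
  have hF : ∀ a b, glue₃ σ τ υ a b →
      Relation.EqvGen (fun a b => (∃ u u', a = i u ∧ b = i u' ∧ glue σ τ u u') ∨
      ∃ x y, a = j x ∧ b = j y ∧ glue ρ υ x y) a b := by
    intro a b h
    refine Relation.EqvGen.mono ?_ _ _ h
    rintro a b (⟨p, rfl, rfl⟩ | ⟨p, rfl, rfl⟩ | ⟨p, rfl, rfl⟩)
    · refine Or.inl ⟨_, _, ?_, ?_, glue_up p⟩
      · rcases p with p | p <;> rfl
      · rcases σ p with p | p <;> rfl
    · exact Or.inl ⟨_, _, rfl, rfl, glue_down p⟩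
    · exact Or.inr ⟨_, _, rfl, rfl, glue_down p⟩
  refine ⟨pushout_rel_iff hi hj hov hE1 hE hF, ?_⟩
  have hPi : ∀ u, (∃ p : α ⊕ δ, i u = Sum.map id (fun x => Sum.inr (Sum.inr x)) p) →
      ∃ s, u = outer s ∧ ∃ p : α ⊕ δ, o' s = outer p := by
    rintro (u | u | u) ⟨p | p, h⟩ <;> simp [i] at h
    exact ⟨Sum.inl u, rfl, Sum.inl u, rfl⟩
  have hPj : ∀ w, (∃ p : α ⊕ δ, j w = Sum.map id (fun x => Sum.inr (Sum.inr x)) p) ↔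
      ∃ p : α ⊕ δ, w = outer p := by
    intro w
    refine exists_congr fun p => ?_
    rcases w with w | w | w <;> rcases p with p | p <;> simp [j, outer]
  rw [loopCount₃, pushout_card hi hj hio hov hcov hE1 hr hE hF, loopCount, loopCount]
  · congr 1
    · refine Nat.card_congr (Equiv.subtypeEquivRight fun K => ⟨fun h => h.1, fun h => ⟨h, ?_⟩⟩)
      intro u hu
      obtain ⟨s, rfl, -⟩ := hPi u hu
      exact h s
    · refine Nat.card_congr (Equiv.subtypeEquivRight fun K => ⟨fun h p => ?_, fun h w hw => ?_⟩)
      · exact h _ ((hPj _).2 ⟨p, rfl⟩)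
      · obtain ⟨p, rfl⟩ := (hPj w).1 hw
        exact h p
  · intro u s h hu
    obtain ⟨t, rfl, p, hp⟩ := hPi u hu
    exact ⟨o' t, (hPj _).2 ⟨p, hp⟩, hE1 _ _ h⟩

theorem glue₃_right {ρ : β ⊕ δ → β ⊕ δ}
    (hρ : ∀ p q, glue τ υ (outer p) (outer q) ↔ q = p ∨ q = ρ p) [Finite α] [Finite β] [Finite γ]
    [Finite δ] :
    (∀ x y, glue₃ σ τ υ (Sum.map id (Sum.map id Sum.inr) x) (Sum.map id (Sum.map id Sum.inr) y) ↔
      glue σ ρ x y) ∧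
    loopCount₃ σ τ υ = loopCount τ υ + loopCount σ ρ := by
  let i : β ⊕ γ ⊕ δ → α ⊕ β ⊕ γ ⊕ δ := Sum.inr
  let j : α ⊕ β ⊕ δ → α ⊕ β ⊕ γ ⊕ δ := Sum.map id (Sum.map id Sum.inr)
  let o' : β ⊕ δ → α ⊕ β ⊕ δ := Sum.inr
  have hi : Function.Injective i := Sum.inr_injective
  have hj : Function.Injective j :=
    Function.injective_id.sumMap (Function.injective_id.sumMap Sum.inr_injective)
  have hio : ∀ s, i (outer s) = j (o' s) := by rintro (s | s) <;> rfl
  have hov : ∀ u w, i u = j w → ∃ s, u = outer s ∧ w = o' s := by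
    rintro (u | u | u) (w | w | w) h <;> simp [i, j] at h <;> subst h
    · exact ⟨Sum.inl u, rfl, rfl⟩
    · exact ⟨Sum.inr u, rfl, rfl⟩
  have hcov : ∀ v, (∃ u, v = i u) ∨ ∃ w, v = j w := by
    rintro (v | v)
    · exact Or.inr ⟨Sum.inl v, rfl⟩
    · exact Or.inl ⟨v, rfl⟩
  have hE1 : ∀ s t, glue τ υ (outer s) (outer t) → glue σ ρ (o' s) (o' t) := by
    intro s t h
    rcases (hρ s t).1 h with rfl | rfl
    · exact (glue σ ρ).refl _
    · exact glue_down s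
  have hr : ∀ x y, glue τ υ x y → glue₃ σ τ υ (i x) (i y) := by
    intro x y h
    exact glue_le ((glue₃ σ τ υ).comap i) (fun p => glue₃_second p) (fun p => glue₃_third p) h
  have hup : ∀ p : α ⊕ β, j (Sum.map id Sum.inl p) = Sum.map id Sum.inl p := by
    rintro (p | p) <;> rfl
  have hE : ∀ x y, glue σ ρ x y → glue₃ σ τ υ (j x) (j y) := by
    intro x y h
    refine glue_le ((glue₃ σ τ υ).comap j) (fun p => ?_) (fun p => ?_) h
    · rw [Setoid.comap_rel, hup, hup]
      exact glue₃_first p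
    · have := hr _ _ ((hρ p (ρ p)).2 (Or.inr rfl))
      rw [hio, hio] at this
      exact this
  have hF : ∀ a b, glue₃ σ τ υ a b →
      Relation.EqvGen (fun a b => (∃ u u', a = i u ∧ b = i u' ∧ glue τ υ u u') ∨
      ∃ x y, a = j x ∧ b = j y ∧ glue σ ρ x y) a b := by
    intro a b h
    refine Relation.EqvGen.mono ?_ _ _ h
    rintro a b (⟨p, rfl, rfl⟩ | ⟨p, rfl, rfl⟩ | ⟨p, rfl, rfl⟩)
    · exact Or.inr ⟨_, _, (hup _).symm, (hup _).symm, glue_up p⟩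
    · exact Or.inl ⟨_, _, rfl, rfl, glue_up p⟩
    · exact Or.inl ⟨_, _, rfl, rfl, glue_down p⟩
  refine ⟨pushout_rel_iff hi hj hov hE1 hE hF, ?_⟩
  have hPi : ∀ u, (∃ p : α ⊕ δ, i u = Sum.map id (fun x => Sum.inr (Sum.inr x)) p) →
      ∃ s, u = outer s ∧ ∃ p : α ⊕ δ, o' s = outer p := by
    rintro (u | u | u) ⟨p | p, h⟩ <;> simp [i] at h
    exact ⟨Sum.inr u, rfl, Sum.inr u, rfl⟩
  have hPj : ∀ w, (∃ p : α ⊕ δ, j w = Sum.map id (fun x => Sum.inr (Sum.inr x)) p) ↔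
      ∃ p : α ⊕ δ, w = outer p := by
    intro w
    refine exists_congr fun p => ?_
    rcases w with w | w | w <;> rcases p with p | p <;> simp [j, outer]
  rw [loopCount₃, pushout_card hi hj hio hov hcov hE1 hr hE hF, loopCount, loopCount]
  · congr 1
    · refine Nat.card_congr (Equiv.subtypeEquivRight fun K => ⟨fun h => h.1, fun h => ⟨h, ?_⟩⟩)
      intro u hu
      obtain ⟨s, rfl, -⟩ := hPi u hu
      exact h s
    · refine Nat.card_congr (Equiv.subtypeEquivRight fun K => ⟨fun h p => ?_, fun h w hw => ?_⟩)
      · exact h _ ((hPj _).2 ⟨p, rfl⟩)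
      · obtain ⟨p, rfl⟩ := (hPj w).1 hw
        exact h p
  · intro u s h hu
    obtain ⟨t, rfl, p, hp⟩ := hPi u hu
    exact ⟨o' t, (hPj _).2 ⟨p, hp⟩, hE1 _ _ h⟩

end Assoc

namespace Diagram

variable {u v w z : Word}

/-- The number of closed loops created by concatenating `D` and `E`. -/
noncomputable def loops (D : Diagram u v) (E : Diagram v w) : ℕ := loopCount D.partner E.partner

theorem ext_partner {D E : Diagram u v} (h : ∀ p, D.partner p = E.partner p) : D = E :=
  Diagram.ext (funext h)

theorem comp_eq (D : Diagram u v) (E : Diagram v w) (F : Diagram u w)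
    (h : ∀ p, glue D.partner E.partner (outer p) (outer (F.partner p))) : D.comp E = F :=
  ext_partner fun p => (((D.glue_outer_iff E p _).1 (h p)).resolve_left (F.partner_ne p)).symm

theorem comp_assoc (D : Diagram u v) (E : Diagram v w) (F : Diagram w z) :
    (D.comp E).comp F = D.comp (E.comp F) := by
  symm
  refine comp_eq _ _ _ fun p => ?_
  have h₁ := (glue₃_left (υ := F.partner) (D.glue_outer_iff E)).1
  have h₂ := (glue₃_right (σ := D.partner) (E.glue_outer_iff F)).1
  have h := ((D.comp E).glue_outer_iff F p _).2 (Or.inr rfl)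
  refine (h₂ _ _).1 ?_
  have h₃ := (h₁ _ _).2 h
  have e : ∀ p : Pt u z, (Sum.map id Sum.inr (outer p : _ ⊕ Fin w.length ⊕ _) :
      _ ⊕ Fin v.length ⊕ _) = Sum.map id (Sum.map id Sum.inr) (outer p) := by
    rintro (p | p) <;> rfl
  rw [e, e] at h₃
  exact h₃

theorem loops_assoc (D : Diagram u v) (E : Diagram v w) (F : Diagram w z) :
    D.loops E + (D.comp E).loops F = E.loops F + D.loops (E.comp F) :=
  (glue₃_left (υ := F.partner) (D.glue_outer_iff E)).2.symm.trans
    (glue₃_right (σ := D.partner) (E.glue_outer_iff F)).2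

theorem loops_eq_zero (D : Diagram u v) (E : Diagram v w)
    (h : ∀ x : Fin v.length, ∃ p, glue D.partner E.partner (outer p) (Sum.inr (Sum.inl x))) :
    D.loops E = 0 := by
  have : IsEmpty {K : Quotient (glue D.partner E.partner) //
      ∀ p, Quotient.mk _ (outer p) ≠ K} := by
    constructor
    rintro ⟨K, hK⟩
    induction K using Quotient.inductionOn with | _ x
    rcases x with x | x | x
    · exact hK (Sum.inl x) rfl
    · obtain ⟨p, hp⟩ := h x
      exact hK p (Quotient.sound hp)
    · exact hK (Sum.inr x) rfl
  exact Nat.card_of_isEmpty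

/-- The diagram of vertical strings. -/
def id (u : Word) : Diagram u u where
  partner := Sum.swap
  partner_partner := Sum.swap_swap
  orient_partner := by rintro (p | p) <;> simp [orient]
  planar := by
    rintro (p | p) (q | q) <;>
      simp only [pos, Sum.elim_inl, Sum.elim_inr, Sum.swap_inl, Sum.swap_inr, Fin.val_rev] <;>
      omega

theorem glue_id_left (E : Diagram u v) (p : Pt u v) :
    glue (id u).partner E.partner (outer p) (Sum.inr p) := by
  rcases p with p | p
  · exact glue_up (Sum.inl p)
  · exact Setoid.refl' _ _

theorem glue_id_right (D : Diagram u v) (p : Pt u v) :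
    glue D.partner (id v).partner (outer p) (Sum.map _root_.id Sum.inl p) := by
  rcases p with p | p
  · exact Setoid.refl' _ _
  · exact glue_down (Sum.inr p)

theorem id_comp (E : Diagram u v) : (id u).comp E = E :=
  comp_eq _ _ _ fun p => Setoid.trans' _ (glue_id_left E p)
    (Setoid.trans' _ (glue_down p) (Setoid.symm' _ (glue_id_left E _)))

theorem comp_id (D : Diagram u v) : D.comp (id v) = D :=
  comp_eq _ _ _ fun p => Setoid.trans' _ (glue_id_right D p)
    (Setoid.trans' _ (glue_up p) (Setoid.symm' _ (glue_id_right D _)))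

theorem id_loops (E : Diagram u v) : (id u).loops E = 0 :=
  loops_eq_zero _ _ fun x => ⟨Sum.inl x, glue_id_left E (Sum.inl x)⟩

theorem loops_id (D : Diagram u v) : D.loops (id v) = 0 :=
  loops_eq_zero _ _ fun x => ⟨Sum.inr x, glue_id_right D (Sum.inr x)⟩

end Diagram

section Tensor

variable {u v w u' v' w' : Word}

/-- The position in `u ++ u'` of a letter of `u`. -/
def inLeft (u u' : Word) (i : Fin u.length) : Fin (u ++ u').length :=
  ⟨i, by rw [List.length_append]; omega⟩

/-- The position in `u ++ u'` of a letter of `u'`. -/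
def inRight (u u' : Word) (i : Fin u'.length) : Fin (u ++ u').length :=
  ⟨u.length + i, by rw [List.length_append]; omega⟩

theorem inLeft_injective : Function.Injective (inLeft u u') := fun i j h => by
  simpa [inLeft, Fin.ext_iff] using h

theorem inRight_injective : Function.Injective (inRight u u') := fun i j h => by
  simpa [inRight, Fin.ext_iff] using h

theorem inLeft_ne_inRight (i : Fin u.length) (j : Fin u'.length) :
    inLeft u u' i ≠ inRight u u' j := fun h => by
  simp only [inLeft, inRight, Fin.mk.injEq] at h
  omega

/-- A letter of `u ++ u'` is a letter of `u` or of `u'`. -/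
def splitFin (u u' : Word) (i : Fin (u ++ u').length) : Fin u.length ⊕ Fin u'.length :=
  if h : (i : ℕ) < u.length then Sum.inl ⟨i, h⟩
  else Sum.inr ⟨i - u.length, by have h2 : (i : ℕ) < u.length + u'.length := List.length_append ▸ i.2; omega⟩

theorem splitFin_inLeft (i : Fin u.length) : splitFin u u' (inLeft u u' i) = Sum.inl i := by
  simp [splitFin, inLeft]

theorem splitFin_inRight (i : Fin u'.length) : splitFin u u' (inRight u u' i) = Sum.inr i := by
  simp [splitFin, inRight]

theorem exists_fin (i : Fin (u ++ u').length) :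
    (∃ x, i = inLeft u u' x) ∨ ∃ x, i = inRight u u' x := by
  by_cases h : (i : ℕ) < u.length
  · exact Or.inl ⟨⟨i, h⟩, rfl⟩
  · have h2 : (i : ℕ) < u.length + u'.length := List.length_append ▸ i.2
    refine Or.inr ⟨⟨i - u.length, by omega⟩, Fin.ext ?_⟩
    simp only [inRight]
    omega

/-- The points of `D` in the juxtaposition of `D` and `E`. -/
def leftPt (u v u' v' : Word) : Pt u v → Pt (u ++ u') (v ++ v') :=
  Sum.map (inLeft u u') (inLeft v v')

/-- The points of `E` in the juxtaposition of `D` and `E`. -/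
def rightPt (u v u' v' : Word) : Pt u' v' → Pt (u ++ u') (v ++ v') :=
  Sum.map (inRight u u') (inRight v v')

theorem exists_pt (p : Pt (u ++ u') (v ++ v')) :
    (∃ x, p = leftPt u v u' v' x) ∨ ∃ x, p = rightPt u v u' v' x := by
  rcases p with p | p <;> rcases exists_fin p with ⟨x, rfl⟩ | ⟨x, rfl⟩
  · exact Or.inl ⟨Sum.inl x, rfl⟩
  · exact Or.inr ⟨Sum.inl x, rfl⟩
  · exact Or.inl ⟨Sum.inr x, rfl⟩
  · exact Or.inr ⟨Sum.inr x, rfl⟩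

theorem orient_leftPt (p : Pt u v) :
    orient (u ++ u') (v ++ v') (leftPt u v u' v' p) = orient u v p := by
  rcases p with p | p <;> simp [orient, leftPt, inLeft]

theorem orient_rightPt (p : Pt u' v') :
    orient (u ++ u') (v ++ v') (rightPt u v u' v' p) = orient u' v' p := by
  rcases p with p | p <;> simp [orient, rightPt, inRight]

/-- The pairing of the juxtaposition of `D` (on the left) and `E` (on the right). -/
def tensorPartner (D : Diagram u v) (E : Diagram u' v') :
    Pt (u ++ u') (v ++ v') → Pt (u ++ u') (v ++ v') :=
  Sum.elim
    (fun i => Sum.elim (fun x => leftPt u v u' v' (D.partner (Sum.inl x)))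
      (fun x => rightPt u v u' v' (E.partner (Sum.inl x))) (splitFin u u' i))
    (fun j => Sum.elim (fun x => leftPt u v u' v' (D.partner (Sum.inr x)))
      (fun x => rightPt u v u' v' (E.partner (Sum.inr x))) (splitFin v v' j))

theorem tensorPartner_leftPt (D : Diagram u v) (E : Diagram u' v') (p : Pt u v) :
    tensorPartner D E (leftPt u v u' v' p) = leftPt u v u' v' (D.partner p) := by
  rcases p with p | p <;> simp [tensorPartner, leftPt, splitFin_inLeft]

theorem tensorPartner_rightPt (D : Diagram u v) (E : Diagram u' v') (p : Pt u' v') :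
    tensorPartner D E (rightPt u v u' v' p) = rightPt u v u' v' (E.partner p) := by
  rcases p with p | p <;> simp [tensorPartner, rightPt, splitFin_inRight]

theorem pos_leftPt_lt (p q : Pt u v) :
    pos (leftPt u v u' v' p) < pos (leftPt u v u' v' q) ↔ pos p < pos q := by
  rcases p with p | p <;> rcases q with q | q <;>
    simp only [pos, leftPt, inLeft, Sum.map_inl, Sum.map_inr, Sum.elim_inl, Sum.elim_inr,
      Fin.val_rev, List.length_append] <;> omega

theorem pos_rightPt_lt (p q : Pt u' v') :
    pos (rightPt u v u' v' p) < pos (rightPt u v u' v' q) ↔ pos p < pos q := by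
  rcases p with p | p <;> rcases q with q | q <;>
    simp only [pos, rightPt, inRight, Sum.map_inl, Sum.map_inr, Sum.elim_inl, Sum.elim_inr,
      Fin.val_rev, List.length_append] <;> omega

theorem not_between (p : Pt u v) (q r : Pt u' v') :
    ¬ (pos (rightPt u v u' v' q) < pos (leftPt u v u' v' p) ∧
      pos (leftPt u v u' v' p) < pos (rightPt u v u' v' r)) := by
  rcases p with p | p <;> rcases q with q | q <;> rcases r with r | r <;>
    simp only [pos, rightPt, leftPt, inRight, inLeft, Sum.map_inl, Sum.map_inr, Sum.elim_inl,
      Sum.elim_inr, Fin.val_rev, List.length_append] <;> omega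

/-- Horizontal juxtaposition of diagrams. -/
def Diagram.tensor (D : Diagram u v) (E : Diagram u' v') : Diagram (u ++ u') (v ++ v') where
  partner := tensorPartner D E
  partner_partner p := by
    rcases exists_pt p with ⟨x, rfl⟩ | ⟨x, rfl⟩
    · rw [tensorPartner_leftPt, tensorPartner_leftPt, D.partner_partner]
    · rw [tensorPartner_rightPt, tensorPartner_rightPt, E.partner_partner]
  orient_partner p := by
    rcases exists_pt p with ⟨x, rfl⟩ | ⟨x, rfl⟩
    · rw [tensorPartner_leftPt, orient_leftPt, orient_leftPt, D.orient_partner]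
    · rw [tensorPartner_rightPt, orient_rightPt, orient_rightPt, E.orient_partner]
  planar p q := by
    rcases exists_pt p with ⟨x, rfl⟩ | ⟨x, rfl⟩ <;> rcases exists_pt q with ⟨y, rfl⟩ | ⟨y, rfl⟩ <;>
      simp only [tensorPartner_leftPt, tensorPartner_rightPt]
    · simpa only [pos_leftPt_lt] using D.planar x y
    · exact fun h => not_between _ _ _ h.2
    · exact fun h => not_between _ _ _ ⟨h.1, h.2.1⟩
    · simpa only [pos_rightPt_lt] using E.planar x y

theorem Diagram.tensor_leftPt (D : Diagram u v) (E : Diagram u' v') (p : Pt u v) :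
    (D.tensor E).partner (leftPt u v u' v' p) = leftPt u v u' v' (D.partner p) :=
  tensorPartner_leftPt D E p

theorem Diagram.tensor_rightPt (D : Diagram u v) (E : Diagram u' v') (p : Pt u' v') :
    (D.tensor E).partner (rightPt u v u' v' p) = rightPt u v u' v' (E.partner p) :=
  tensorPartner_rightPt D E p

/-- The points of the left half of the concatenation of two juxtapositions. -/
def leftPt₃ (u v w u' v' w' : Word) : Fin u.length ⊕ Fin v.length ⊕ Fin w.length →
    Fin (u ++ u').length ⊕ Fin (v ++ v').length ⊕ Fin (w ++ w').length :=
  Sum.map (inLeft u u') (Sum.map (inLeft v v') (inLeft w w'))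

/-- The points of the right half of the concatenation of two juxtapositions. -/
def rightPt₃ (u v w u' v' w' : Word) : Fin u'.length ⊕ Fin v'.length ⊕ Fin w'.length →
    Fin (u ++ u').length ⊕ Fin (v ++ v').length ⊕ Fin (w ++ w').length :=
  Sum.map (inRight u u') (Sum.map (inRight v v') (inRight w w'))

variable (D : Diagram u v) (E : Diagram v w) (D' : Diagram u' v') (E' : Diagram v' w')

theorem glue_leftPt₃ {x y} (h : glue D.partner E.partner x y) :
    glue (D.tensor D').partner (E.tensor E').partner (leftPt₃ u v w u' v' w' x)
      (leftPt₃ u v w u' v' w' y) := by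
  refine glue_le ((glue (D.tensor D').partner (E.tensor E').partner).comap
    (leftPt₃ u v w u' v' w')) (fun p => ?_) (fun p => ?_) h
  · have e : ∀ p : Pt u v, leftPt₃ u v w u' v' w' (Sum.map id Sum.inl p) =
      Sum.map id Sum.inl (leftPt u v u' v' p) := by rintro (p | p) <;> rfl
    rw [Setoid.comap_rel, e, e, ← Diagram.tensor_leftPt]
    exact glue_up _
  · have := glue_down (σ := (D.tensor D').partner) (τ := (E.tensor E').partner)
      (leftPt v w v' w' p)
    rw [Diagram.tensor_leftPt] at this
    exact this

theorem glue_rightPt₃ {x y} (h : glue D'.partner E'.partner x y) :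
    glue (D.tensor D').partner (E.tensor E').partner (rightPt₃ u v w u' v' w' x)
      (rightPt₃ u v w u' v' w' y) := by
  refine glue_le ((glue (D.tensor D').partner (E.tensor E').partner).comap
    (rightPt₃ u v w u' v' w')) (fun p => ?_) (fun p => ?_) h
  · have e : ∀ p : Pt u' v', rightPt₃ u v w u' v' w' (Sum.map id Sum.inl p) =
      Sum.map id Sum.inl (rightPt u v u' v' p) := by rintro (p | p) <;> rfl
    rw [Setoid.comap_rel, e, e, ← Diagram.tensor_rightPt]
    exact glue_up _
  · have := glue_down (σ := (D.tensor D').partner) (τ := (E.tensor E').partner)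
      (rightPt v w v' w' p)
    rw [Diagram.tensor_rightPt] at this
    exact this

theorem Diagram.tensor_comp :
    (D.tensor D').comp (E.tensor E') = (D.comp E).tensor (D'.comp E') := by
  refine comp_eq _ _ _ fun p => ?_
  have e₁ : ∀ p : Pt u w, (outer (leftPt u w u' w' p) :
      _ ⊕ Fin (v ++ v').length ⊕ _) = leftPt₃ u v w u' v' w' (outer p) := by
    rintro (p | p) <;> rfl
  have e₂ : ∀ p : Pt u' w', (outer (rightPt u w u' w' p) :
      _ ⊕ Fin (v ++ v').length ⊕ _) = rightPt₃ u v w u' v' w' (outer p) := by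
    rintro (p | p) <;> rfl
  rcases exists_pt p with ⟨x, rfl⟩ | ⟨x, rfl⟩
  · rw [Diagram.tensor_leftPt, e₁, e₁]
    exact glue_leftPt₃ _ _ _ _ ((D.glue_outer_iff E _ _).2 (Or.inr rfl))
  · rw [Diagram.tensor_rightPt, e₂, e₂]
    exact glue_rightPt₃ _ _ _ _ ((D'.glue_outer_iff E' _ _).2 (Or.inr rfl))

theorem Diagram.tensor_loops :
    (D.tensor D').loops (E.tensor E') = D.loops E + D'.loops E' := by
  let i := leftPt₃ u v w u' v' w'
  let j := rightPt₃ u v w u' v' w'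
  have hi : Function.Injective i :=
    inLeft_injective.sumMap (inLeft_injective.sumMap inLeft_injective)
  have hj : Function.Injective j :=
    inRight_injective.sumMap (inRight_injective.sumMap inRight_injective)
  have hne : ∀ x y, i x ≠ j y := by
    rintro (x | x | x) (y | y | y) h <;> simp [i, j, leftPt₃, rightPt₃, inLeft_ne_inRight] at h
  have hcov : ∀ x, (∃ y, x = i y) ∨ ∃ y, x = j y := by
    rintro (x | x | x) <;> rcases exists_fin x with ⟨y, rfl⟩ | ⟨y, rfl⟩
    · exact Or.inl ⟨Sum.inl y, rfl⟩
    · exact Or.inr ⟨Sum.inl y, rfl⟩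
    · exact Or.inl ⟨Sum.inr (Sum.inl y), rfl⟩
    · exact Or.inr ⟨Sum.inr (Sum.inl y), rfl⟩
    · exact Or.inl ⟨Sum.inr (Sum.inr y), rfl⟩
    · exact Or.inr ⟨Sum.inr (Sum.inr y), rfl⟩
  have h := pushout_card (o := Empty.elim) (o' := Empty.elim) (r := glue D.partner E.partner)
    (E := glue D'.partner E'.partner)
    (F := glue (D.tensor D').partner (E.tensor E').partner) hi hj (fun s => s.elim)
    (fun x y h => (hne x y h).elim) hcov (fun s => s.elim) (fun x y => glue_leftPt₃ D E D' E')
    (fun x y => glue_rightPt₃ D E D' E')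
    (by
      intro a b h
      refine Relation.EqvGen.mono ?_ _ _ h
      rintro _ _ (p | p) <;> rcases exists_pt p with ⟨x, rfl⟩ | ⟨x, rfl⟩
      · rw [Diagram.tensor_leftPt]
        refine Or.inl ⟨_, _, ?_, ?_, glue_up x⟩
        · rcases x with x | x <;> rfl
        · rcases D.partner x with x | x <;> rfl
      · rw [Diagram.tensor_rightPt]
        refine Or.inr ⟨_, _, ?_, ?_, glue_up x⟩
        · rcases x with x | x <;> rfl
        · rcases D'.partner x with x | x <;> rfl
      · rw [Diagram.tensor_leftPt]
        exact Or.inl ⟨_, _, rfl, rfl, glue_down x⟩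
      · rw [Diagram.tensor_rightPt]
        exact Or.inr ⟨_, _, rfl, rfl, glue_down x⟩)
    (fun x => ∃ p, x = outer p) (fun u s => s.elim)
  have hPi : ∀ x, (∃ p, i x = outer p) ↔ ∃ p : Pt u w, x = outer p := by
    rintro (x | x | x)
    · exact ⟨fun _ => ⟨Sum.inl x, rfl⟩, fun _ => ⟨Sum.inl _, rfl⟩⟩
    · constructor <;> rintro ⟨p | p, h⟩ <;> simp [outer, i, leftPt₃] at h
    · exact ⟨fun _ => ⟨Sum.inr x, rfl⟩, fun _ => ⟨Sum.inr _, rfl⟩⟩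
  have hPj : ∀ x, (∃ p, j x = outer p) ↔ ∃ p : Pt u' w', x = outer p := by
    rintro (x | x | x)
    · exact ⟨fun _ => ⟨Sum.inl x, rfl⟩, fun _ => ⟨Sum.inl _, rfl⟩⟩
    · constructor <;> rintro ⟨p | p, h⟩ <;> simp [outer, j, rightPt₃] at h
    · exact ⟨fun _ => ⟨Sum.inr x, rfl⟩, fun _ => ⟨Sum.inr _, rfl⟩⟩
  simp only [hPi, hPj, forall_exists_index, forall_eq_apply_imp_iff] at h
  rw [Diagram.loops, loopCount, h]
  congr 1
  exact Nat.card_congr (Equiv.subtypeEquivRight fun K => and_iff_right fun s => s.elim)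

theorem Diagram.id_tensor_id (u v : Word) : (Diagram.id u).tensor (Diagram.id v) =
    Diagram.id (u ++ v) := by
  refine ext_partner fun p => ?_
  rcases exists_pt p with ⟨x, rfl⟩ | ⟨x, rfl⟩
  · rw [Diagram.tensor_leftPt]
    rcases x with x | x <;> rfl
  · rw [Diagram.tensor_rightPt]
    rcases x with x | x <;> rfl

end Tensor

namespace Diagram

variable {u v w : Word}

/-- The diagram `D'`: reflect `D` in a horizontal line and then reverse all orientations, so that
the words at the top and at the bottom are interchanged. -/
def mirror (D : Diagram u v) : Diagram v u where
  partner p := (D.partner p.swap).swap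
  partner_partner p := by simp [D.partner_partner]
  orient_partner p := by
    have e : ∀ p : Pt u v, orient v u p.swap = - orient u v p := by
      rintro (p | p) <;> simp [orient]
    have h := D.orient_partner p.swap
    rw [e, h, neg_neg, ← neg_neg (orient u v p.swap), ← e, Sum.swap_swap]
  planar p q := by
    have e : ∀ p q : Pt u v, pos p.swap < pos q.swap ↔ pos q < pos p := by
      rintro (p | p) (q | q) <;>
        simp only [pos, Sum.elim_inl, Sum.elim_inr, Sum.swap_inl, Sum.swap_inr, Fin.val_rev] <;>
        omega
    obtain ⟨p, rfl⟩ : ∃ p' : Pt u v, p'.swap = p := ⟨p.swap, p.swap_swap⟩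
    obtain ⟨q, rfl⟩ : ∃ q' : Pt u v, q'.swap = q := ⟨q.swap, q.swap_swap⟩
    simp only [Sum.swap_swap, e]
    have := D.planar (D.partner q) (D.partner p)
    rw [D.partner_partner, D.partner_partner] at this
    tauto

variable {u' v' u'' v'' : Word}

theorem tensor_assoc (D : Diagram u v) (D' : Diagram u' v') (D'' : Diagram u'' v'')
    (p : Pt (u ++ u' ++ u'') (v ++ v' ++ v'')) :
    Sum.map (Fin.cast (congrArg List.length (List.append_assoc u u' u'')))
      (Fin.cast (congrArg List.length (List.append_assoc v v' v'')))
      (((D.tensor D').tensor D'').partner p) =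
    (D.tensor (D'.tensor D'')).partner
      (Sum.map (Fin.cast (congrArg List.length (List.append_assoc u u' u'')))
      (Fin.cast (congrArg List.length (List.append_assoc v v' v''))) p) := by
  have e₁ : ∀ x : Pt u v, Sum.map (Fin.cast (congrArg List.length (List.append_assoc u u' u'')))
      (Fin.cast (congrArg List.length (List.append_assoc v v' v'')))
      (leftPt _ _ _ _ (leftPt u v u' v' x)) = leftPt _ _ _ _ x := by
    rintro (x | x) <;> rfl
  have e₂ : ∀ x : Pt u' v', Sum.map (Fin.cast (congrArg List.length (List.append_assoc u u' u'')))
      (Fin.cast (congrArg List.length (List.append_assoc v v' v'')))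
      (leftPt _ _ _ _ (rightPt u v u' v' x)) = rightPt _ _ _ _ (leftPt _ _ _ _ x) := by
    rintro (x | x) <;> rfl
  have e₃ : ∀ x : Pt u'' v'', Sum.map (Fin.cast (congrArg List.length (List.append_assoc u u' u'')))
      (Fin.cast (congrArg List.length (List.append_assoc v v' v'')))
      (rightPt _ _ _ _ x) = rightPt _ _ _ _ (rightPt _ _ _ _ x) := by
    rintro (x | x) <;> simp [rightPt, inRight, add_assoc]
  rcases exists_pt p with ⟨x, rfl⟩ | ⟨x, rfl⟩
  · rcases exists_pt x with ⟨x, rfl⟩ | ⟨x, rfl⟩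
    · rw [tensor_leftPt, tensor_leftPt, e₁, e₁, tensor_leftPt]
    · rw [tensor_leftPt, tensor_rightPt, e₂, e₂, tensor_rightPt, tensor_leftPt]
  · rw [tensor_rightPt, e₃, e₃, tensor_rightPt, tensor_rightPt]

theorem nil_tensor (D : Diagram u v) (p : Pt ([] ++ u) ([] ++ v)) :
    Sum.map (Fin.cast (congrArg List.length (List.nil_append u)))
      (Fin.cast (congrArg List.length (List.nil_append v)))
      (((id []).tensor D).partner p) =
    D.partner (Sum.map (Fin.cast (congrArg List.length (List.nil_append u)))
      (Fin.cast (congrArg List.length (List.nil_append v))) p) := by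
  have e : ∀ x : Pt u v, Sum.map (Fin.cast (congrArg List.length (List.nil_append u)))
      (Fin.cast (congrArg List.length (List.nil_append v))) (rightPt _ _ _ _ x) = x := by
    rintro (x | x) <;> simp [rightPt, inRight]
  rcases exists_pt p with ⟨x, rfl⟩ | ⟨x, rfl⟩
  · rcases x with x | x <;> exact x.elim0
  · rw [tensor_rightPt, e, e]

theorem tensor_nil (D : Diagram u v) (p : Pt (u ++ []) (v ++ [])) :
    Sum.map (Fin.cast (congrArg List.length (List.append_nil u)))
      (Fin.cast (congrArg List.length (List.append_nil v)))
      ((D.tensor (id [])).partner p) =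
    D.partner (Sum.map (Fin.cast (congrArg List.length (List.append_nil u)))
      (Fin.cast (congrArg List.length (List.append_nil v))) p) := by
  have e : ∀ x : Pt u v, Sum.map (Fin.cast (congrArg List.length (List.append_nil u)))
      (Fin.cast (congrArg List.length (List.append_nil v))) (leftPt _ _ _ _ x) = x := by
    rintro (x | x) <;> rfl
  rcases exists_pt p with ⟨x, rfl⟩ | ⟨x, rfl⟩
  · rw [tensor_leftPt, e, e]
  · rcases x with x | x <;> exact x.elim0

/-- The number of arcs joining two points of the upper line, with the letter `a` at the left end.
These are the `ε_X` inside `D` for `a = X`, and the `ε_{X*}` inside `D` for `a = Xstar`. -/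
def caps (D : Diagram u v) (a : Letter) : ℕ :=
  (Finset.univ.filter fun i : Fin u.length =>
    u.get i = a ∧ ∃ j, i < j ∧ D.partner (Sum.inl i) = Sum.inl j).card

/-- The number of arcs joining two points of the lower line, with the letter `a` at the left end.
These are the `δ_X : I → X* ⊗ X` inside `D` for `a = Xstar`, and the `δ_{X*} : I → X ⊗ X*`
inside `D` for `a = X`. -/
def cups (D : Diagram u v) (a : Letter) : ℕ :=
  (Finset.univ.filter fun i : Fin v.length =>
    v.get i = a ∧ ∃ j, i < j ∧ D.partner (Sum.inr i) = Sum.inr j).card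

/-- The number of `ε_X` and `ε_{X*}` minus the number of `δ_X` and `δ_{X*}` inside `D`. -/
def sharp (D : Diagram u v) : ℤ :=
  ((D.caps Letter.X + D.caps Letter.Xstar : ℕ) : ℤ) -
    ((D.cups Letter.Xstar + D.cups Letter.X : ℕ) : ℤ)

/-- The number of `ε_{X*}` minus the number of `δ_{X*}` inside `D`. -/
def ell (D : Diagram u v) : ℤ := (D.caps Letter.Xstar : ℤ) - (D.cups Letter.X : ℤ)

end Diagram

/-- Composition of linear combinations of diagrams: bilinear, and on diagrams it is concatenation
with each closed loop replaced by the scalar `d`. -/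
noncomputable def compL (d : ℂ) (u v w : Word) :
    (Diagram u v →₀ ℂ) →ₗ[ℂ] (Diagram v w →₀ ℂ) →ₗ[ℂ] (Diagram u w →₀ ℂ) :=
  Finsupp.linearCombination ℂ fun D => Finsupp.linearCombination ℂ fun E =>
    Finsupp.single (D.comp E) (d ^ D.loops E)

/-- Tensor product of linear combinations of diagrams: bilinear, and on diagrams it is horizontal
juxtaposition. -/
noncomputable def tensorL (u v u' v' : Word) :
    (Diagram u v →₀ ℂ) →ₗ[ℂ] (Diagram u' v' →₀ ℂ) →ₗ[ℂ] (Diagram (u ++ u') (v ++ v') →₀ ℂ) :=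
  Finsupp.linearCombination ℂ fun D => Finsupp.linearCombination ℂ fun E =>
    Finsupp.single (D.tensor E) 1

theorem compL_single (d : ℂ) {u v w : Word} (D : Diagram u v) (E : Diagram v w) (a b : ℂ) :
    compL d u v w (Finsupp.single D a) (Finsupp.single E b) =
      Finsupp.single (D.comp E) (a * b * d ^ D.loops E) := by
  simp only [compL, Finsupp.linearCombination_single, LinearMap.smul_apply, Finsupp.smul_single,
    smul_eq_mul, mul_assoc]

theorem tensorL_single {u v u' v' : Word} (D : Diagram u v) (E : Diagram u' v') (a b : ℂ) :
    tensorL u v u' v' (Finsupp.single D a) (Finsupp.single E b) =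
      Finsupp.single (D.tensor E) (a * b) := by
  simp only [tensorL, Finsupp.linearCombination_single, LinearMap.smul_apply, Finsupp.smul_single,
    smul_eq_mul, mul_one]

/-- The tensor category `O_d` of oriented Kauffman diagrams in which every closed loop, clockwise or
anticlockwise, has the value `d`. Its objects are the words in `X` and `X*`, and the morphisms from
`u` to `v` are the formal complex linear combinations of oriented Kauffman diagrams of type
`(u, v)`. The monoidal structure is strict: the associators and unitors are identities up to the
equality of words. -/
@[ext]
structure OKauffman (d : ℂ) : Type where
  word : Word

variable {d : ℂ}

noncomputable instance : Category (OKauffman d) where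
  Hom x y := Diagram x.word y.word →₀ ℂ
  id x := Finsupp.single (Diagram.id x.word) 1
  comp f g := compL d _ _ _ f g
  id_comp f := by
    induction f using Finsupp.induction_linear with
    | zero => exact map_zero _
    | add f g hf hg => rw [map_add, hf, hg]
    | single D a => rw [compL_single, Diagram.id_comp, Diagram.id_loops, pow_zero, one_mul, mul_one]
  comp_id f := by
    induction f using Finsupp.induction_linear with
    | zero => rw [map_zero, LinearMap.zero_apply]
    | add f g hf hg => rw [map_add, LinearMap.add_apply, hf, hg]
    | single D a => rw [compL_single, Diagram.comp_id, Diagram.loops_id, pow_zero, mul_one, mul_one]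
  assoc f g h := by
    induction f using Finsupp.induction_linear with
    | zero => simp only [map_zero, LinearMap.zero_apply]
    | add f f' hf hf' => simp only [map_add, LinearMap.add_apply, hf, hf']
    | single D a =>
      induction g using Finsupp.induction_linear with
      | zero => simp only [map_zero, LinearMap.zero_apply]
      | add f f' hf hf' => simp only [map_add, LinearMap.add_apply, hf, hf']
      | single E b =>
        induction h using Finsupp.induction_linear with
        | zero => simp only [map_zero]
        | add f f' hf hf' => simp only [map_add, hf, hf']
        | single F c =>
          simp only [compL_single, Diagram.comp_assoc]
          congr 1
          have h := congrArg (fun n => d ^ n) (Diagram.loops_assoc D E F)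
          simp only [pow_add] at h
          linear_combination a * b * c * h

noncomputable instance (x y : OKauffman d) : AddCommGroup (x ⟶ y) :=
  inferInstanceAs (AddCommGroup (Diagram x.word y.word →₀ ℂ))

noncomputable instance (x y : OKauffman d) : Module ℂ (x ⟶ y) :=
  inferInstanceAs (Module ℂ (Diagram x.word y.word →₀ ℂ))

noncomputable instance : Preadditive (OKauffman d) where
  add_comp _ _ _ f f' g := by
    change compL d _ _ _ (f + f') g = compL d _ _ _ f g + compL d _ _ _ f' g
    rw [map_add, LinearMap.add_apply]
  comp_add _ _ _ f g g' := map_add (compL d _ _ _ f) g g'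

noncomputable instance : Linear ℂ (OKauffman d) where
  smul_comp _ _ _ a f g := by
    change compL d _ _ _ (a • f) g = a • compL d _ _ _ f g
    rw [map_smul, LinearMap.smul_apply]
  comp_smul _ _ _ f a g := map_smul (compL d _ _ _ f) a g

/-- A diagram as a morphism of the category. -/
noncomputable def Diagram.hom (d : ℂ) {u v : Word} (D : Diagram u v) :
    (OKauffman.mk u : OKauffman d) ⟶ OKauffman.mk v :=
  (Finsupp.single D 1 : Diagram u v →₀ ℂ)

noncomputable instance : MonoidalCategoryStruct (OKauffman d) where
  tensorObj x y := ⟨x.word ++ y.word⟩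
  tensorUnit := ⟨[]⟩
  tensorHom f g := tensorL _ _ _ _ f g
  whiskerLeft x _ _ f := tensorL _ _ _ _ (𝟙 x : x ⟶ x) f
  whiskerRight f x := tensorL _ _ _ _ f (𝟙 x : x ⟶ x)
  associator _ _ _ := eqToIso (congrArg OKauffman.mk (List.append_assoc _ _ _))
  leftUnitor _ := eqToIso (congrArg OKauffman.mk (List.nil_append _))
  rightUnitor _ := eqToIso (congrArg OKauffman.mk (List.append_nil _))

theorem hom_induction {x y : OKauffman d} {P : (x ⟶ y) → Prop} (f : x ⟶ y)
    (zero : P 0) (add : ∀ f g, P f → P g → P (f + g))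
    (smul : ∀ (a : ℂ) (D : Diagram x.word y.word), P (a • D.hom d)) : P f := by
  induction f using Finsupp.induction_linear with
  | zero => exact zero
  | add f g hf hg => exact add f g hf hg
  | single D a =>
    have := smul a D
    have e : a • D.hom d = (Finsupp.single D a : Diagram x.word y.word →₀ ℂ) := by
      change a • (Finsupp.single D 1 : Diagram x.word y.word →₀ ℂ) = _
      rw [Finsupp.smul_single, smul_eq_mul, mul_one]
    rw [e] at this
    exact this

variable {x y z x' y' z' : OKauffman d}

theorem add_tensor (f f' : x ⟶ y) (g : x' ⟶ y') : (f + f') ⊗ₘ g = f ⊗ₘ g + f' ⊗ₘ g := by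
  change tensorL _ _ _ _ (f + f') g = tensorL _ _ _ _ f g + tensorL _ _ _ _ f' g
  rw [map_add, LinearMap.add_apply]

theorem tensor_add (f : x ⟶ y) (g g' : x' ⟶ y') : f ⊗ₘ (g + g') = f ⊗ₘ g + f ⊗ₘ g' :=
  map_add (tensorL _ _ _ _ f) g g'

theorem smul_tensor (a : ℂ) (f : x ⟶ y) (g : x' ⟶ y') : (a • f) ⊗ₘ g = a • (f ⊗ₘ g) := by
  change tensorL _ _ _ _ (a • f) g = a • tensorL _ _ _ _ f g
  rw [map_smul, LinearMap.smul_apply]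

theorem tensor_smul (a : ℂ) (f : x ⟶ y) (g : x' ⟶ y') : f ⊗ₘ (a • g) = a • (f ⊗ₘ g) :=
  map_smul (tensorL _ _ _ _ f) a g

theorem zero_tensor (g : x' ⟶ y') : (0 : x ⟶ y) ⊗ₘ g = 0 := by
  change tensorL _ _ _ _ 0 g = 0
  rw [map_zero, LinearMap.zero_apply]

theorem tensor_zero (f : x ⟶ y) : f ⊗ₘ (0 : x' ⟶ y') = 0 :=
  map_zero (tensorL _ _ _ _ f)

theorem hom_comp_hom {u v w : Word} (D : Diagram u v) (E : Diagram v w) :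
    D.hom d ≫ E.hom d = d ^ D.loops E • (D.comp E).hom d := by
  change compL d _ _ _ (Finsupp.single D 1) (Finsupp.single E 1) =
    d ^ D.loops E • (Finsupp.single (D.comp E) 1 : Diagram u w →₀ ℂ)
  rw [compL_single, Finsupp.smul_single]
  simp

theorem hom_tensor_hom {u v u' v' : Word} (D : Diagram u v) (E : Diagram u' v') :
    D.hom d ⊗ₘ E.hom d = (D.tensor E).hom d := by
  change tensorL _ _ _ _ (Finsupp.single D 1) (Finsupp.single E 1) = Finsupp.single _ _
  rw [tensorL_single, mul_one]

theorem id_eq_hom (x : OKauffman d) : 𝟙 x = (Diagram.id x.word).hom d := rfl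

theorem id_tensor_id (x y : OKauffman d) : 𝟙 x ⊗ₘ 𝟙 y = 𝟙 (x ⊗ y) := by
  rw [id_eq_hom, id_eq_hom, hom_tensor_hom, Diagram.id_tensor_id]
  rfl

theorem associator_eq (x y z : OKauffman d) : (α_ x y z).hom =
    eqToHom (congrArg OKauffman.mk (List.append_assoc x.word y.word z.word)) := rfl

theorem leftUnitor_eq (x : OKauffman d) : (λ_ x).hom =
    eqToHom (congrArg OKauffman.mk (List.nil_append x.word)) := rfl

theorem rightUnitor_eq (x : OKauffman d) : (ρ_ x).hom =
    eqToHom (congrArg OKauffman.mk (List.append_nil x.word)) := rfl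

theorem eqToHom_tensor (h : x = y) (h' : x' = y') :
    eqToHom h ⊗ₘ eqToHom h' = eqToHom (congrArg₂ (· ⊗ ·) h h') := by
  subst h h'
  exact id_tensor_id _ _

theorem hom_eqToHom {u v u' v' : Word} (hu : u = u') (hv : v = v') (D : Diagram u v)
    (D' : Diagram u' v') (h : ∀ p, Sum.map (Fin.cast (congrArg List.length hu))
      (Fin.cast (congrArg List.length hv)) (D.partner p) =
      D'.partner (Sum.map (Fin.cast (congrArg List.length hu))
      (Fin.cast (congrArg List.length hv)) p)) :
    D.hom d ≫ eqToHom (congrArg OKauffman.mk hv) =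
      eqToHom (congrArg OKauffman.mk hu) ≫ D'.hom d := by
  subst hu hv
  have : D = D' := Diagram.ext_partner fun p => by simpa using h p
  subst this
  simp

noncomputable instance : MonoidalCategory (OKauffman d) :=
  MonoidalCategory.ofTensorHom
    (id_tensorHom_id := id_tensor_id)
    (id_tensorHom := fun _ _ _ _ => rfl)
    (tensorHom_id := fun _ _ => rfl)
    (tensorHom_comp_tensorHom := by
      intro x₁ y₁ z₁ x₂ y₂ z₂ f₁ f₂ g₁ g₂
      induction f₁ using hom_induction with
      | zero => simp only [zero_tensor, Limits.zero_comp]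
      | add f f' h h' => simp only [add_tensor, Preadditive.add_comp, h, h']
      | smul a D₁ =>
      induction f₂ using hom_induction with
      | zero => simp only [tensor_zero, Limits.zero_comp]
      | add f f' h h' => simp only [tensor_add, Preadditive.add_comp, h, h']
      | smul b D₂ =>
      induction g₁ using hom_induction with
      | zero => simp only [zero_tensor, Limits.comp_zero]
      | add f f' h h' => simp only [add_tensor, Preadditive.comp_add, h, h']
      | smul a' E₁ =>
      induction g₂ using hom_induction with
      | zero => simp only [tensor_zero, Limits.comp_zero]
      | add f f' h h' => simp only [tensor_add, Preadditive.comp_add, h, h']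
      | smul b' E₂ =>
      have e : (D₁.hom d ⊗ₘ D₂.hom d) ≫ (E₁.hom d ⊗ₘ E₂.hom d) =
          (D₁.hom d ≫ E₁.hom d) ⊗ₘ (D₂.hom d ≫ E₂.hom d) := by
        rw [hom_tensor_hom, hom_tensor_hom, hom_comp_hom D₁ E₁, hom_comp_hom D₂ E₂]
        rw [smul_tensor, tensor_smul, hom_tensor_hom, smul_smul, ← pow_add]
        refine (hom_comp_hom _ _).trans ?_
        rw [Diagram.tensor_comp, Diagram.tensor_loops]
      simp only [smul_tensor, tensor_smul, Linear.smul_comp, Linear.comp_smul, smul_smul]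
      congr 1
      ring)
    (associator_naturality := by
      intro x₁ x₂ x₃ y₁ y₂ y₃ f₁ f₂ f₃
      induction f₁ using hom_induction with
      | zero => simp only [zero_tensor, Limits.zero_comp, Limits.comp_zero]
      | add f f' h h' => simp only [add_tensor, Preadditive.add_comp, Preadditive.comp_add, h, h']
      | smul a D₁ =>
      induction f₂ using hom_induction with
      | zero => simp only [zero_tensor, tensor_zero, Limits.zero_comp, Limits.comp_zero]
      | add f f' h h' =>
        simp only [add_tensor, tensor_add, Preadditive.add_comp, Preadditive.comp_add, h, h']
      | smul b D₂ =>
      induction f₃ using hom_induction with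
      | zero => simp only [tensor_zero, Limits.zero_comp, Limits.comp_zero]
      | add f f' h h' => simp only [tensor_add, Preadditive.add_comp, Preadditive.comp_add, h, h']
      | smul c D₃ =>
      simp only [smul_tensor, tensor_smul, Linear.smul_comp, Linear.comp_smul]
      congr 3
      rw [hom_tensor_hom D₁ D₂, hom_tensor_hom D₂ D₃]
      exact (congrArg (· ≫ _) (hom_tensor_hom _ _)).trans
        ((hom_eqToHom (List.append_assoc _ _ _) (List.append_assoc _ _ _) _ _
          (Diagram.tensor_assoc D₁ D₂ D₃)).trans
          (congrArg (_ ≫ ·) (hom_tensor_hom _ _).symm)))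
    (leftUnitor_naturality := by
      intro x y f
      induction f using hom_induction with
      | zero => simp only [tensor_zero, Limits.zero_comp, Limits.comp_zero]
      | add f f' h h' => simp only [tensor_add, Preadditive.add_comp, Preadditive.comp_add, h, h']
      | smul a D =>
      simp only [tensor_smul, Linear.smul_comp, Linear.comp_smul]
      congr 1
      exact (congrArg (· ≫ _) (hom_tensor_hom (Diagram.id []) D)).trans
        (hom_eqToHom (List.nil_append _) (List.nil_append _) _ D (Diagram.nil_tensor D)))
    (rightUnitor_naturality := by
      intro x y f
      induction f using hom_induction with
      | zero => simp only [zero_tensor, Limits.zero_comp, Limits.comp_zero]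
      | add f f' h h' => simp only [add_tensor, Preadditive.add_comp, Preadditive.comp_add, h, h']
      | smul a D =>
      simp only [smul_tensor, Linear.smul_comp, Linear.comp_smul]
      congr 1
      exact (congrArg (· ≫ _) (hom_tensor_hom D (Diagram.id []))).trans
        (hom_eqToHom (List.append_nil _) (List.append_nil _) _ D (Diagram.tensor_nil D)))
    (pentagon := by
      intro w x y z
      rw [← eqToHom_refl z rfl, ← eqToHom_refl w rfl]
      simp only [associator_eq, eqToHom_tensor, eqToHom_trans])
    (triangle := by
      intro x y
      rw [← eqToHom_refl x rfl, ← eqToHom_refl y rfl]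
      simp only [associator_eq, leftUnitor_eq, rightUnitor_eq, eqToHom_tensor, eqToHom_trans])

instance : MonoidalPreadditive (OKauffman d) where
  whiskerLeft_zero := tensor_zero _
  zero_whiskerRight := zero_tensor _
  whiskerLeft_add := tensor_add _
  add_whiskerRight f g := add_tensor f g _

instance : MonoidalLinear ℂ (OKauffman d) where
  whiskerLeft_smul _ _ _ r f := tensor_smul r _ f
  smul_whiskerRight r _ _ f _ := smul_tensor r f _

end OrientedKauffman

/-! Uniqueness. The spaces Hom(X ⊗ X*, I), Hom(X* ⊗ X, I) and their mirror images are
one-dimensional, so a compatible *-structure sends `arc X` to `k` times its mirror image and `arc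
Xstar` to `l` times its mirror image, with `k` and `l` nonzero. Applying the star to the relation
"closed loop = d" shows that `k * d` and `l * d` are real, and applying it to a zigzag shows that
`l` is the conjugate of `k`. The product of these two real numbers is |k|²d², whence d² is real and
s = conj d / d is a sign. Every diagram is obtained from identities by putting single arcs on top
and by reflecting, so `k` determines the star (`capLayer_mirror_induction`, `star_ext`,
`exists_starOf_eq`).

Existence. The formula c^♯ s^l D' has to be compatible with composition, in which each closed loop
contributes d before and conj d = s d after conjugation. The exponent ♯ is half the difference of
the word lengths and hence additive (`two_mul_sharp`). Since s is a sign, only the parity of l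
matters, and what is needed is l(D) + l(E) ≡ l(DE) + number of loops (mod 2). For this, l is
replaced by `turn`, the parity of the number of strings that end before they start in the cyclic
order, which treats arcs and through strings alike (`ell_eq_turn`). The resulting identity `TurnAdd`
is checked when one factor is a single arc with vertical strings beside it: such an arc either
closes a loop or joins two strings, and planarity leaves three relative positions in the latter
case. It passes to all pairs because it is stable under reflection and obeys a cocycle rule coming
from associativity (`turnAdd`).

Equivalence. Multiplying morphisms by powers of a positive real number given by the length
difference changes c by a positive factor, and reversing all orientations conjugates c. Conversely,
isomorphic words are equal, so a monoidal self-equivalence fixes or interchanges the two letters.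
Transporting the arc and its mirror image by the functor multiplies them by inverse scalars;
unitarity of the structure isomorphisms turns these scalars into a factor |k|² > 0 between the two
parameters (`exists_pos_of_functor`). -/

namespace OrientedKauffman

/-! ### Transport of gluings along bijections, and reflection of diagrams. -/

section Transfer

variable {α β γ α' β' γ' : Type} {σ : α ⊕ β → α ⊕ β} {τ : β ⊕ γ → β ⊕ γ}
  {σ' : α' ⊕ β' → α' ⊕ β'} {τ' : β' ⊕ γ' → β' ⊕ γ'}

theorem glue_map (e : α ⊕ β ⊕ γ → α' ⊕ β' ⊕ γ')
    (h : ∀ x y, GlueStep σ τ x y → glue σ' τ' (e x) (e y)) {x y : α ⊕ β ⊕ γ}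
    (hxy : glue σ τ x y) : glue σ' τ' (e x) (e y) :=
  glue_le ((glue σ' τ').comap e) (fun p => h _ _ (GlueStep.up p))
    (fun p => h _ _ (GlueStep.down p)) hxy

theorem glue_equiv (e : α ⊕ β ⊕ γ ≃ α' ⊕ β' ⊕ γ')
    (h : ∀ x y, GlueStep σ τ x y → glue σ' τ' (e x) (e y))
    (h' : ∀ x y, GlueStep σ' τ' x y → glue σ τ (e.symm x) (e.symm y)) (x y : α ⊕ β ⊕ γ) :
    glue σ τ x y ↔ glue σ' τ' (e x) (e y) :=
  ⟨glue_map e h, fun hxy => by simpa using glue_map e.symm h' hxy⟩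

/-- A bijection that preserves connectedness matches components, and by `hf` it matches the
components that have ends; closed loops therefore correspond. It serves reflection, where the two
layers trade places, and orientation reversal. -/
theorem loopCount_equiv (e : α ⊕ β ⊕ γ ≃ α' ⊕ β' ⊕ γ')
    (h : ∀ x y, GlueStep σ τ x y → glue σ' τ' (e x) (e y))
    (h' : ∀ x y, GlueStep σ' τ' x y → glue σ τ (e.symm x) (e.symm y))
    (f : α ⊕ γ ≃ α' ⊕ γ') (hf : ∀ p, e (outer p) = outer (f p)) :
    loopCount σ τ = loopCount σ' τ' := by
  refine Nat.card_congr (Equiv.subtypeEquiv (Quotient.congr e (glue_equiv e h h')) fun K => ?_)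
  induction K using Quotient.inductionOn with | _ x
  refine Equiv.forall_congr f fun {p} => ?_
  rw [Quotient.congr_mk, ← hf, ne_eq, ne_eq, Quotient.eq, Quotient.eq, ← glue_equiv e h h']

end Transfer

namespace Diagram

variable {u v w z : Word}

theorem comp_partner_eq (D : Diagram u v) (E : Diagram v w) {p q : Pt u w}
    (h : glue D.partner E.partner (outer p) (outer q)) (hne : q ≠ p) :
    (D.comp E).partner p = q :=
  (((D.glue_outer_iff E p q).1 h).resolve_left hne).symm

theorem mirror_partner (D : Diagram u v) (p : Pt v u) :
    D.mirror.partner p = (D.partner p.swap).swap := rfl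

theorem mirror_mirror (D : Diagram u v) : D.mirror.mirror = D :=
  ext_partner fun p => by simp [mirror_partner]

theorem mirror_injective : Function.Injective (mirror : Diagram u v → Diagram v u) :=
  fun D E h => by rw [← mirror_mirror D, h, mirror_mirror]

theorem mirror_id (u : Word) : (id u).mirror = id u :=
  ext_partner fun p => by rcases p with p | p <;> rfl

/-- Turning a stack of two pictures upside down. -/
def upsideDown (α β γ : Type) : α ⊕ β ⊕ γ ≃ γ ⊕ β ⊕ α where
  toFun := Sum.elim (fun x => Sum.inr (Sum.inr x)) (Sum.elim (fun x => Sum.inr (Sum.inl x)) Sum.inl)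
  invFun := Sum.elim (fun x => Sum.inr (Sum.inr x))
    (Sum.elim (fun x => Sum.inr (Sum.inl x)) Sum.inl)
  left_inv := by rintro (x | x | x) <;> rfl
  right_inv := by rintro (x | x | x) <;> rfl

theorem upsideDown_outer {α β γ : Type} (p : α ⊕ γ) :
    upsideDown α β γ (outer p) = outer p.swap := by
  rcases p with p | p <;> rfl

theorem upsideDown_glue (D : Diagram u v) (E : Diagram v w)
    (x y : Fin u.length ⊕ Fin v.length ⊕ Fin w.length) (h : GlueStep D.partner E.partner x y) :
    glue E.mirror.partner D.mirror.partner (upsideDown _ _ _ x) (upsideDown _ _ _ y) := by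
  have e₁ : ∀ p : Pt u v, upsideDown _ _ (Fin w.length) (Sum.map _root_.id Sum.inl p) =
      Sum.inr p.swap := by rintro (p | p) <;> rfl
  have e₂ : ∀ p : Pt v w, upsideDown (Fin u.length) _ _ (Sum.inr p) =
      Sum.map _root_.id Sum.inl p.swap := by rintro (p | p) <;> rfl
  cases h with
  | up p =>
    rw [e₁, e₁]
    simpa [mirror_partner] using
      glue_down (σ := E.mirror.partner) (τ := D.mirror.partner) p.swap
  | down p =>
    rw [e₂, e₂]
    simpa [mirror_partner] using
      glue_up (σ := E.mirror.partner) (τ := D.mirror.partner) p.swap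

theorem mirror_comp (D : Diagram u v) (E : Diagram v w) :
    (D.comp E).mirror = E.mirror.comp D.mirror := by
  symm
  refine comp_eq _ _ _ fun p => ?_
  have h := glue_map _ (upsideDown_glue D E)
    ((D.glue_outer_iff E p.swap ((D.comp E).partner p.swap)).2 (Or.inr rfl))
  rw [upsideDown_outer, upsideDown_outer, Sum.swap_swap] at h
  exact h

theorem mirror_loops (D : Diagram u v) (E : Diagram v w) :
    E.mirror.loops D.mirror = D.loops E := by
  symm
  refine loopCount_equiv (upsideDown _ _ _) (upsideDown_glue D E) ?_ (Equiv.sumComm _ _)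
    upsideDown_outer
  -- The inverse of `upsideDown` is again an `upsideDown`, so the reverse direction is the same
  -- lemma for the mirror images.
  have h := upsideDown_glue E.mirror D.mirror
  rw [mirror_mirror, mirror_mirror] at h
  exact h

theorem mirror_tensor {u' v' : Word} (D : Diagram u v) (E : Diagram u' v') :
    (D.tensor E).mirror = D.mirror.tensor E.mirror := by
  have e₁ : ∀ (u v u' v' : Word) (x : Pt v u),
      (leftPt v u v' u' x).swap = leftPt u v u' v' x.swap := by
    rintro _ _ _ _ (x | x) <;> rfl
  have e₂ : ∀ (u v u' v' : Word) (x : Pt v' u'),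
      (rightPt v u v' u' x).swap = rightPt u v u' v' x.swap := by
    rintro _ _ _ _ (x | x) <;> rfl
  refine ext_partner fun p => ?_
  rw [mirror_partner]
  rcases exists_pt p with ⟨x, rfl⟩ | ⟨x, rfl⟩
  · rw [e₁, tensor_leftPt, tensor_leftPt, mirror_partner, e₁]
  · rw [e₂, tensor_rightPt, tensor_rightPt, mirror_partner, e₂]

end Diagram

end OrientedKauffman

/-! ### The exponents `sharp` and `ell`: word lengths, and turns modulo 2. -/

namespace OrientedKauffman

/-- The other letter. -/
def Letter.dual : Letter → Letter
  | X => Xstar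
  | Xstar => X

@[simp] theorem Letter.dual_dual (a : Letter) : a.dual.dual = a := by cases a <;> rfl

theorem Letter.sign_dual (a : Letter) : a.dual.sign = -a.sign := by cases a <;> rfl

theorem Letter.eq_of_sign {a b : Letter} (h : a.sign = b.sign) : a = b := by
  cases a <;> cases b <;> first | rfl | (exact absurd h (by decide))

theorem Letter.eq_dual_of_sign {a b : Letter} (h : a.sign = -b.sign) : a = b.dual :=
  Letter.eq_of_sign (by rw [h, Letter.sign_dual])

theorem parity_equiv {ι κ : Type} [Fintype ι] [Fintype κ] (e : ι ≃ κ) (K : κ → Prop) :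
    parity (fun i => K (e i)) = parity K := by
  classical
  exact Fintype.sum_equiv e _ _ fun _ => rfl

open Classical in
-- Bookkeeping for deleting the two ends `l`, `r` of an arc, or of its trace, from the terminal
-- points; `f` embeds the remaining points.
theorem parity_remove {ι κ : Type} [Fintype ι] [Fintype κ] {f : κ → ι}
    (hf : Function.Injective f) {l r : ι} (hlr : l ≠ r) (hl : ∀ x, f x ≠ l) (hr : ∀ x, f x ≠ r)
    (hcov : ∀ p, p = l ∨ p = r ∨ ∃ x, p = f x) (K : ι → Prop) :
    parity K = (if K l then 1 else 0) + (if K r then 1 else 0) + parity fun x => K (f x) := by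
  let e : Bool ⊕ κ → ι := Sum.elim (fun b => if b then l else r) f
  have he : Function.Bijective e := by
    constructor
    · rintro ((_ | _) | x) ((_ | _) | y) h <;> simp [e, hlr, hlr.symm, hl, hr, hf.eq_iff] at h ⊢
      · exact hr _ h.symm
      · exact hl _ h.symm
      · exact h
    · intro p
      rcases hcov p with rfl | rfl | ⟨x, rfl⟩
      · exact ⟨Sum.inl true, rfl⟩
      · exact ⟨Sum.inl false, rfl⟩
      · exact ⟨Sum.inr x, rfl⟩
  rw [← parity_equiv (Equiv.ofBijective e he), parity_sum]
  congr 1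
  rw [parity, Fintype.sum_bool]
  rfl

theorem parity_card {ι : Type} [Fintype ι] (K : ι → Prop) [DecidablePred K] :
    parity K = ((Finset.univ.filter K).card : ZMod 2) := by
  rw [parity, Finset.card_filter, Nat.cast_sum]
  exact Finset.sum_congr rfl fun i _ => by split_ifs <;> simp

namespace Diagram

variable {u v w : Word}

/-- The parity of the number of strings of `D` that end before they start in the cyclic order. -/
noncomputable def turn (D : Diagram u v) : ZMod 2 :=
  parity fun p : Pt u v => orient u v p = 1 ∧ pos (D.partner p) < pos p

end Diagram

/-- The parity of the number of letters `X*`. -/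
noncomputable def starParity (u : Word) : ZMod 2 :=
  parity fun i : Fin u.length => u.get i = Letter.Xstar

theorem zmod_two_add_self (x : ZMod 2) : x + x = 0 := by revert x; decide

theorem zmod_two_neg (x : ZMod 2) : -x = x := by revert x; decide

namespace Diagram

variable {u v w : Word}

/-- The pairing as a permutation of the terminal points. -/
def perm (D : Diagram u v) : Equiv.Perm (Pt u v) := ⟨D.partner, D.partner, D.partner_partner, D.partner_partner⟩

theorem get_partner_inl (D : Diagram u v) {i j : Fin u.length}
    (h : D.partner (Sum.inl i) = Sum.inl j) : u.get j = (u.get i).dual := by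
  have h1 := D.orient_partner (Sum.inl i)
  rw [h] at h1
  exact Letter.eq_dual_of_sign h1

/-- An arc on the upper line can be counted by its right end as well, which carries the dual letter
because orientations at the two ends are opposite. -/
theorem caps_eq_card_right (D : Diagram u v) (a : Letter) : D.caps a =
    (Finset.univ.filter fun i : Fin u.length =>
      u.get i = a.dual ∧ ∃ j, j < i ∧ D.partner (Sum.inl i) = Sum.inl j).card := by
  classical
  rw [caps]
  have key : ∀ i j, D.partner (Sum.inl i) = Sum.inl j → D.partner (Sum.inl j) = Sum.inl i :=
    fun i j h => by rw [← h, D.partner_partner]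
  refine Finset.card_bij'
    -- Both maps go to the other end of the arc; the value `i` for a partner on the lower line is a
    -- default that never occurs on the sets in question.
    (fun i _ => ((D.partner (Sum.inl i)).elim _root_.id fun _ => i))
    (fun i _ => ((D.partner (Sum.inl i)).elim _root_.id fun _ => i)) ?_ ?_ ?_ ?_
  all_goals
    intro i hi
    simp only [Finset.mem_filter, Finset.mem_univ, true_and] at hi ⊢
    obtain ⟨h, j, hij, hj⟩ := hi
    have h2 := key _ _ hj
    have h3 := D.get_partner_inl hj
    rw [h] at h3
    simp only [hj, h2, Sum.elim_inl, id_eq]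
  · exact ⟨h3, i, hij, rfl⟩
  · exact ⟨h3.trans a.dual_dual, i, hij, rfl⟩

theorem mirror_caps (D : Diagram u v) (a : Letter) : D.mirror.caps a = D.cups a := by
  classical
  rw [caps, cups]
  congr 1
  refine Finset.filter_congr fun i _ => and_congr_right fun _ => exists_congr fun j =>
    and_congr_right fun _ => ?_
  rw [mirror_partner, Sum.swap_inl, ← Sum.swap_inr, Sum.swap_leftInverse.injective.eq_iff]

theorem mirror_cups (D : Diagram u v) (a : Letter) : D.mirror.cups a = D.caps a := by
  rw [← mirror_caps, mirror_mirror]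

theorem pos_swap_lt (p q : Pt u v) : pos p.swap < pos q.swap ↔ pos q < pos p := by
  rcases p with p | p <;> rcases q with q | q <;>
    simp only [pos, Sum.elim_inl, Sum.elim_inr, Sum.swap_inl, Sum.swap_inr, Fin.val_rev] <;>
    omega

theorem orient_swap (p : Pt u v) : orient v u p.swap = - orient u v p := by
  rcases p with p | p <;> simp [orient]

/-- Reflection reverses the cyclic order, and it also interchanges the start and the end of each
string; the two effects cancel. The sum is therefore reindexed by the pairing. -/
theorem turn_mirror (D : Diagram u v) : D.mirror.turn = D.turn := by
  rw [turn, turn, ← parity_equiv (Equiv.sumComm _ _), ← parity_equiv D.perm]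
  refine parity_congr fun p => ?_
  change orient v u (D.partner p).swap = 1 ∧ pos (D.partner ((D.partner p).swap).swap).swap <
    pos (D.partner p).swap ↔ _
  rw [Sum.swap_swap, D.partner_partner, orient_swap, pos_swap_lt, D.orient_partner, neg_neg]

theorem parity_xor {ι : Type} [Fintype ι] (K L : ι → Prop) :
    parity (fun i => K i ∧ L i) + parity (fun i => K i ∧ ¬ L i) = parity K := by
  symm
  exact parity_add (fun i => by tauto) (fun i => by tauto)

/-- An arc with left end X* starts at its right end X. A string from an upper point can end earlier
in the cyclic order only on the upper line, since all lower points come later. -/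
theorem caps_parity (D : Diagram u v) : (D.caps Letter.Xstar : ZMod 2) =
    parity fun i : Fin u.length => orient u v (Sum.inl i) = 1 ∧
      pos (D.partner (Sum.inl i)) < pos (Sum.inl i : Pt u v) := by
  classical
  rw [caps_eq_card_right, parity_card]
  congr 2
  refine Finset.filter_congr fun i _ => and_congr ?_ ⟨?_, ?_⟩
  · simp only [orient, Sum.elim_inl]
    cases u.get i <;> simp [Letter.sign, Letter.dual]
  · rintro ⟨j, hj, h⟩
    rw [h]
    exact hj
  · intro h
    rcases hj : D.partner (Sum.inl i) with j | j
    · rw [hj] at h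
      exact ⟨j, h, rfl⟩
    · rw [hj] at h
      simp only [pos, Sum.elim_inl, Sum.elim_inr] at h
      omega

/-- A lower arc with left end X starts at its right end X*. The lower line is read from right to
left, so "later" now means further to the left on the same line, which explains the negation. -/
theorem cups_parity (D : Diagram u v) : (D.cups Letter.X : ZMod 2) =
    parity fun i : Fin v.length => orient u v (Sum.inr i) = 1 ∧
      ¬ (pos (D.partner (Sum.inr i)) < pos (Sum.inr i : Pt u v)) := by
  classical
  rw [← mirror_caps, caps_eq_card_right, parity_card]
  congr 2
  refine Finset.filter_congr fun i _ => and_congr ?_ ⟨?_, ?_⟩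
  · simp only [orient, Sum.elim_inr, Pi.neg_apply]
    cases v.get i <;> simp [Letter.sign, Letter.dual]
  · rintro ⟨j, hj, h⟩
    rw [mirror_partner, Sum.swap_inl, ← Sum.swap_inr, Sum.swap_leftInverse.injective.eq_iff] at h
    rw [h]
    simp only [pos, Sum.elim_inr, Fin.val_rev]
    omega
  · intro h
    rw [mirror_partner, Sum.swap_inl]
    rcases hj : D.partner (Sum.inr i) with j | j
    · rw [hj] at h
      simp only [pos, Sum.elim_inl, Sum.elim_inr] at h
      omega
    · refine ⟨j, ?_, rfl⟩
      have hne : j ≠ i := fun hji => D.partner_ne (Sum.inr i) (hj.trans (congrArg Sum.inr hji))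
      have hne' := Fin.val_ne_of_ne hne
      rw [hj] at h
      simp only [pos, Sum.elim_inr, Fin.val_rev] at h
      rw [Fin.lt_def]
      omega

/-- Strings starting on the lower line enter `ell` when they end later and `turn` when they end
earlier; together these are all the starting points below, namely the letters X* of `v`. Strings
starting on the upper line contribute equally to both. -/
theorem ell_eq_turn (D : Diagram u v) : (D.ell : ZMod 2) = D.turn + starParity v := by
  have h1 : starParity v = parity fun j : Fin v.length => orient u v (Sum.inr j) = 1 := by
    refine parity_congr fun j => ?_
    simp only [orient, Sum.elim_inr, Pi.neg_apply]
    cases v.get j <;> simp [Letter.sign]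
  rw [ell, Int.cast_sub, Int.cast_natCast, Int.cast_natCast, caps_parity, cups_parity, turn,
    parity_sum, h1, ← parity_xor (fun j : Fin v.length => orient u v (Sum.inr j) = 1)
      fun j => pos (D.partner (Sum.inr j)) < pos (Sum.inr j : Pt u v), add_assoc, ← add_assoc
      (parity fun j : Fin v.length => orient u v (Sum.inr j) = 1 ∧
        pos (D.partner (Sum.inr j)) < pos (Sum.inr j : Pt u v)), zmod_two_add_self, zero_add,
    sub_eq_add_neg, zmod_two_neg]

theorem turn_tensor {u' v' : Word} (D : Diagram u v) (E : Diagram u' v') :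
    (D.tensor E).turn = D.turn + E.turn := by
  let e : Pt u v ⊕ Pt u' v' → Pt (u ++ u') (v ++ v') := Sum.elim (leftPt _ _ _ _) (rightPt _ _ _ _)
  have he : Function.Bijective e := by
    constructor
    · refine Function.Injective.sumElim (inLeft_injective.sumMap inLeft_injective)
        (inRight_injective.sumMap inRight_injective) ?_
      rintro (x | x) (y | y) h <;> simp [leftPt, rightPt, inLeft_ne_inRight] at h
    · intro p
      rcases exists_pt p with ⟨x, rfl⟩ | ⟨x, rfl⟩
      · exact ⟨Sum.inl x, rfl⟩
      · exact ⟨Sum.inr x, rfl⟩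
  rw [turn, ← parity_equiv (Equiv.ofBijective e he), parity_sum]
  congr 1
  · refine parity_congr fun x => ?_
    change orient _ _ (leftPt _ _ _ _ x) = 1 ∧ pos ((D.tensor E).partner (leftPt _ _ _ _ x)) <
      pos (leftPt _ _ _ _ x) ↔ _
    rw [orient_leftPt, tensor_leftPt, pos_leftPt_lt]
  · refine parity_congr fun x => ?_
    change orient _ _ (rightPt _ _ _ _ x) = 1 ∧ pos ((D.tensor E).partner (rightPt _ _ _ _ x)) <
      pos (rightPt _ _ _ _ x) ↔ _
    rw [orient_rightPt, tensor_rightPt, pos_rightPt_lt]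

theorem turn_id (u : Word) : (id u).turn = starParity u := by
  have h := (id u).ell_eq_turn
  have h0 : (id u).ell = 0 := by
    simp [ell, caps, cups, id]
  rw [h0, Int.cast_zero] at h
  have := zmod_two_add_self (starParity u)
  linear_combination (-1 : ZMod 2) * h - this

/-- Each upper arc uses two letters of `u`, each lower arc two letters of `v`, and through strings
use one of each. Additivity of `sharp` under composition and tensor products follows without any
look at the arcs; removed loops play no role. -/
theorem two_mul_sharp (D : Diagram u v) : 2 * D.sharp = (u.length : ℤ) - v.length := by
  classical
  have h1 : ∀ (u v : Word) (D : Diagram u v), u.length = 2 * (D.caps Letter.X +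
      D.caps Letter.Xstar) + (Finset.univ.filter fun i : Fin u.length =>
        ∃ j, D.partner (Sum.inl i) = Sum.inr j).card := by
    intro u v D
    -- The first copy of the number of arcs counts left ends, the second one right ends; each letter
    -- of `u` then contributes exactly once.
    rw [two_mul]
    nth_rewrite 3 [D.caps_eq_card_right]
    nth_rewrite 3 [D.caps_eq_card_right]
    rw [caps, caps]
    simp only [Finset.card_filter]
    rw [← Finset.sum_add_distrib, ← Finset.sum_add_distrib, ← Finset.sum_add_distrib,
      ← Finset.sum_add_distrib]
    have e : u.length = ∑ i : Fin u.length, 1 := by simp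
    refine e.trans (Finset.sum_congr rfl fun i _ => ?_)
    rcases hj : D.partner (Sum.inl i) with j | j
    · have hne : j ≠ i := fun hji => D.partner_ne (Sum.inl i) (hj.trans (congrArg Sum.inl hji))
      rcases lt_or_gt_of_ne hne with h | h <;> cases u.get i <;>
        simp [Letter.dual, h, not_lt_of_gt h]
    · simp
  have h2 : (Finset.univ.filter fun i : Fin u.length =>
        ∃ j, D.partner (Sum.inl i) = Sum.inr j).card = (Finset.univ.filter fun i : Fin v.length =>
        ∃ j, D.mirror.partner (Sum.inl i) = Sum.inr j).card := by
    -- `g` is 1 at the upper and -1 at the lower end of a through string and 0 on arcs. It is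
    -- antisymmetric under the pairing, so its sum vanishes and the two counts of through strings
    -- agree.
    let g : Pt u v → ℤ := fun p => (if p.isLeft then 1 else 0) -
      if (D.partner p).isLeft then 1 else 0
    have hg : ∑ p, g p = - ∑ p, g p := by
      rw [← Finset.sum_neg_distrib]
      refine Fintype.sum_equiv D.perm _ _ fun p => ?_
      change g p = - g (D.partner p)
      simp only [g, D.partner_partner]
      ring
    have hg' : ∑ p, g p = 0 := by omega
    rw [Fintype.sum_sum_type] at hg'
    simp only [Finset.card_filter]
    zify
    have e₁ : ∀ i, g (Sum.inl i) = if ∃ j, D.partner (Sum.inl i) = Sum.inr j then 1 else 0 := by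
      intro i
      rcases hj : D.partner (Sum.inl i) with j | j <;> simp [g, hj]
    have e₂ : ∀ i, g (Sum.inr i) =
        - if ∃ j, D.mirror.partner (Sum.inl i) = Sum.inr j then 1 else 0 := by
      intro i
      rcases hj : D.partner (Sum.inr i) with j | j <;> simp [g, hj, mirror_partner]
    simp only [e₁, e₂, Finset.sum_neg_distrib] at hg'
    linarith
  have h3 := h1 _ _ D
  have h4 := h1 _ _ D.mirror
  rw [mirror_caps, mirror_caps] at h4
  rw [sharp]
  omega

theorem sharp_id (u : Word) : (id u).sharp = 0 := by
  have := (id u).two_mul_sharp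
  omega

theorem sharp_mirror (D : Diagram u v) : D.mirror.sharp = -D.sharp := by
  have := D.two_mul_sharp
  have := D.mirror.two_mul_sharp
  omega

theorem sharp_comp (D : Diagram u v) (E : Diagram v w) :
    (D.comp E).sharp = D.sharp + E.sharp := by
  have := D.two_mul_sharp
  have := E.two_mul_sharp
  have := (D.comp E).two_mul_sharp
  omega

theorem sharp_tensor {u' v' : Word} (D : Diagram u v) (E : Diagram u' v') :
    (D.tensor E).sharp = D.sharp + E.sharp := by
  have := D.two_mul_sharp
  have := E.two_mul_sharp
  have h := (D.tensor E).two_mul_sharp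
  rw [List.length_append, List.length_append] at h
  push_cast at h
  omega

end Diagram

end OrientedKauffman

/-! ### Inserting two adjacent letters, and composing with a single arc. -/

namespace OrientedKauffman

section Skip

variable (v₁ : Word) (a b : Letter) (v₂ : Word)

/-- The position of the letter `a` in `v₁ ++ a :: b :: v₂`. -/
def fstPos : Fin (v₁ ++ a :: b :: v₂).length := ⟨v₁.length, by simp⟩

/-- The position of the letter `b` in `v₁ ++ a :: b :: v₂`. -/
def sndPos : Fin (v₁ ++ a :: b :: v₂).length := ⟨v₁.length + 1, by simp⟩

/-- The position in `v₁ ++ a :: b :: v₂` of a letter of `v₁ ++ v₂`. -/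
def skip (i : Fin (v₁ ++ v₂).length) : Fin (v₁ ++ a :: b :: v₂).length :=
  ⟨if (i : ℕ) < v₁.length then i else i + 2, by
    have := i.2
    simp only [List.length_append, List.length_cons] at this ⊢
    split_ifs <;> omega⟩

variable {v₁ a b v₂}

theorem fstPos_ne_sndPos : fstPos v₁ a b v₂ ≠ sndPos v₁ a b v₂ := by
  simp [fstPos, sndPos]

theorem skip_ne_fstPos (i : Fin (v₁ ++ v₂).length) : skip v₁ a b v₂ i ≠ fstPos v₁ a b v₂ := by
  simp only [skip, fstPos, ne_eq, Fin.mk.injEq]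
  split_ifs <;> omega

theorem skip_ne_sndPos (i : Fin (v₁ ++ v₂).length) : skip v₁ a b v₂ i ≠ sndPos v₁ a b v₂ := by
  simp only [skip, sndPos, ne_eq, Fin.mk.injEq]
  split_ifs <;> omega

theorem skip_lt_iff (i j : Fin (v₁ ++ v₂).length) :
    skip v₁ a b v₂ i < skip v₁ a b v₂ j ↔ i < j := by
  simp only [skip, Fin.lt_def]
  split_ifs <;> omega

theorem skip_injective : Function.Injective (skip v₁ a b v₂) := by
  intro i j h
  have h1 := skip_lt_iff (a := a) (b := b) i j
  have h2 := skip_lt_iff (a := a) (b := b) j i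
  rw [h] at h1 h2
  have h3 := h1.not.1 (lt_irrefl _)
  have h4 := h2.not.1 (lt_irrefl _)
  exact le_antisymm (not_lt.1 h4) (not_lt.1 h3)

theorem pos_cases (x : Fin (v₁ ++ a :: b :: v₂).length) :
    x = fstPos v₁ a b v₂ ∨ x = sndPos v₁ a b v₂ ∨ ∃ i, x = skip v₁ a b v₂ i := by
  have hx := x.2
  simp only [List.length_append, List.length_cons] at hx
  rcases lt_trichotomy (x : ℕ) v₁.length with h | h | h
  · refine Or.inr (Or.inr ⟨⟨x, ?_⟩, Fin.ext ?_⟩)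
    · have := List.length_append (as := v₁) (bs := v₂)
      omega
    · simp [skip, h]
  · exact Or.inl (Fin.ext h)
  · rcases Nat.lt_or_ge v₁.length.succ x with h' | h'
    · refine Or.inr (Or.inr ⟨⟨x - 2, ?_⟩, Fin.ext ?_⟩)
      · have := List.length_append (as := v₁) (bs := v₂)
        omega
      · simp only [skip]
        rw [if_neg (by omega)]
        omega
    · exact Or.inr (Or.inl (Fin.ext (le_antisymm h' h)))

theorem get_fstPos : (v₁ ++ a :: b :: v₂).get (fstPos v₁ a b v₂) = a := by
  simp [fstPos]

theorem get_sndPos : (v₁ ++ a :: b :: v₂).get (sndPos v₁ a b v₂) = b := by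
  simp [sndPos]

theorem get_skip (i : Fin (v₁ ++ v₂).length) :
    (v₁ ++ a :: b :: v₂).get (skip v₁ a b v₂ i) = (v₁ ++ v₂).get i := by
  rcases exists_fin i with ⟨x, rfl⟩ | ⟨x, rfl⟩
  · simp [skip, inLeft]
  · simp [skip, inRight, List.getElem_append_right, add_assoc]

theorem starParity_insert :
    starParity (v₁ ++ a :: a.dual :: v₂) = 1 + starParity (v₁ ++ v₂) := by
  rw [starParity, parity_remove skip_injective fstPos_ne_sndPos skip_ne_fstPos skip_ne_sndPos
    pos_cases, get_fstPos, get_sndPos]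
  congr 1
  · cases a <;> simp [Letter.dual]
  · exact parity_congr fun i => by rw [get_skip]

/-- The position in the upper line of a letter of `v₁ ++ v₂`. -/
def skipUp (v₁ : Word) (a b : Letter) (v₂ w : Word) :
    Pt (v₁ ++ v₂) w → Pt (v₁ ++ a :: b :: v₂) w := Sum.map (skip v₁ a b v₂) id

/-- The position in the lower line of a letter of `v₁ ++ v₂`. -/
def skipDown (u v₁ : Word) (a b : Letter) (v₂ : Word) :
    Pt u (v₁ ++ v₂) → Pt u (v₁ ++ a :: b :: v₂) := Sum.map id (skip v₁ a b v₂)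

variable {u w : Word}

theorem skipUp_injective : Function.Injective (skipUp v₁ a b v₂ w) :=
  skip_injective.sumMap Function.injective_id

theorem skipDown_injective : Function.Injective (skipDown u v₁ a b v₂) :=
  Function.injective_id.sumMap skip_injective

theorem skipUp_ne_fstPos (p : Pt (v₁ ++ v₂) w) :
    skipUp v₁ a b v₂ w p ≠ Sum.inl (fstPos v₁ a b v₂) := by
  rcases p with p | p <;> simp [skipUp, skip_ne_fstPos]

theorem skipUp_ne_sndPos (p : Pt (v₁ ++ v₂) w) :
    skipUp v₁ a b v₂ w p ≠ Sum.inl (sndPos v₁ a b v₂) := by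
  rcases p with p | p <;> simp [skipUp, skip_ne_sndPos]

theorem skipDown_ne_fstPos (p : Pt u (v₁ ++ v₂)) :
    skipDown u v₁ a b v₂ p ≠ Sum.inr (fstPos v₁ a b v₂) := by
  rcases p with p | p <;> simp [skipDown, skip_ne_fstPos]

theorem skipDown_ne_sndPos (p : Pt u (v₁ ++ v₂)) :
    skipDown u v₁ a b v₂ p ≠ Sum.inr (sndPos v₁ a b v₂) := by
  rcases p with p | p <;> simp [skipDown, skip_ne_sndPos]

theorem skipUp_cases (p : Pt (v₁ ++ a :: b :: v₂) w) : p = Sum.inl (fstPos v₁ a b v₂) ∨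
    p = Sum.inl (sndPos v₁ a b v₂) ∨ ∃ q, p = skipUp v₁ a b v₂ w q := by
  rcases p with p | p
  · rcases pos_cases p with rfl | rfl | ⟨i, rfl⟩
    · exact Or.inl rfl
    · exact Or.inr (Or.inl rfl)
    · exact Or.inr (Or.inr ⟨Sum.inl i, rfl⟩)
  · exact Or.inr (Or.inr ⟨Sum.inr p, rfl⟩)

theorem skipDown_cases (p : Pt u (v₁ ++ a :: b :: v₂)) : p = Sum.inr (fstPos v₁ a b v₂) ∨
    p = Sum.inr (sndPos v₁ a b v₂) ∨ ∃ q, p = skipDown u v₁ a b v₂ q := by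
  rcases p with p | p
  · exact Or.inr (Or.inr ⟨Sum.inl p, rfl⟩)
  · rcases pos_cases p with rfl | rfl | ⟨i, rfl⟩
    · exact Or.inl rfl
    · exact Or.inr (Or.inl rfl)
    · exact Or.inr (Or.inr ⟨Sum.inr i, rfl⟩)

theorem skipUp_swap (p : Pt (v₁ ++ v₂) w) :
    (skipUp v₁ a b v₂ w p).swap = skipDown w v₁ a b v₂ p.swap := by
  rcases p with p | p <;> rfl

theorem skipDown_swap (p : Pt u (v₁ ++ v₂)) :
    (skipDown u v₁ a b v₂ p).swap = skipUp v₁ a b v₂ u p.swap := by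
  rcases p with p | p <;> rfl

theorem orient_skipDown (p : Pt u (v₁ ++ v₂)) :
    orient u _ (skipDown u v₁ a b v₂ p) = orient u _ p := by
  rcases p with p | p
  · rfl
  · simp only [orient, skipDown, Sum.map_inr, Sum.elim_inr, Pi.neg_apply, get_skip]

theorem orient_skipUp (p : Pt (v₁ ++ v₂) w) :
    orient _ w (skipUp v₁ a b v₂ w p) = orient _ w p := by
  rcases p with p | p
  · simp only [orient, skipUp, Sum.map_inl, Sum.elim_inl, get_skip]
  · rfl

theorem pos_skipUp_lt (p q : Pt (v₁ ++ v₂) w) :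
    pos (skipUp v₁ a b v₂ w p) < pos (skipUp v₁ a b v₂ w q) ↔ pos p < pos q := by
  rcases p with p | p <;> rcases q with q | q
  · exact skip_lt_iff p q
  · have h1 := p.2
    have h2 := (skip v₁ a b v₂ p).2
    simp only [pos, skipUp, Sum.map_inl, Sum.map_inr, Sum.elim_inl, Sum.elim_inr]
    omega
  · have h1 := q.2
    have h2 := (skip v₁ a b v₂ q).2
    simp only [pos, skipUp, Sum.map_inl, Sum.map_inr, Sum.elim_inl, Sum.elim_inr]
    omega
  · simp only [pos, skipUp, Sum.map_inr, Sum.elim_inr, id]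
    omega

theorem pos_skipDown_lt (p q : Pt u (v₁ ++ v₂)) :
    pos (skipDown u v₁ a b v₂ p) < pos (skipDown u v₁ a b v₂ q) ↔ pos p < pos q := by
  rw [← Diagram.pos_swap_lt, skipDown_swap, skipDown_swap, pos_skipUp_lt, Diagram.pos_swap_lt]

/-- On the lower line the cyclic order runs from right to left, so the second of the two adjacent
letters comes immediately before the first. -/
theorem pos_fstPos : pos (Sum.inr (fstPos v₁ a b v₂) : Pt u _) =
    pos (Sum.inr (sndPos v₁ a b v₂) : Pt u (v₁ ++ a :: b :: v₂)) + 1 := by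
  simp only [pos, Sum.elim_inr, Fin.val_rev, fstPos, sndPos, List.length_append, List.length_cons]
  omega

end Skip

namespace Diagram

/-- The arc joining two adjacent points `a`, `a.dual` of the upper line. -/
def arc (a : Letter) : Diagram [a, a.dual] [] where
  partner := Sum.map Fin.rev _root_.id
  partner_partner := by rintro (p | p) <;> simp
  orient_partner := by
    rintro (p | p)
    · fin_cases p <;> simp [orient, Letter.sign_dual]
    · exact p.elim0
  planar := by
    rintro (p | p) (q | q)
    · simp only [pos, Sum.map_inl, Sum.elim_inl, Fin.val_rev]
      omega
    all_goals first | exact p.elim0 | exact q.elim0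

/-- The arc joining two adjacent points `a`, `a.dual` of the upper line, with vertical strings on
both sides. -/
def capLayer (v₁ : Word) (a : Letter) (v₂ : Word) :
    Diagram (v₁ ++ a :: a.dual :: v₂) (v₁ ++ v₂) :=
  (id v₁).tensor ((arc a).tensor (id v₂) : Diagram (a :: a.dual :: v₂) v₂)

variable {v₁ v₂ u w : Word} {a : Letter}

theorem capLayer_fstPos : (capLayer v₁ a v₂).partner (Sum.inl (fstPos v₁ a a.dual v₂)) =
    Sum.inl (sndPos v₁ a a.dual v₂) := by
  have h : (Sum.inl (fstPos v₁ a a.dual v₂) : Pt _ (v₁ ++ v₂)) =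
      rightPt v₁ v₁ _ _ (leftPt [a, a.dual] [] v₂ v₂ (Sum.inl 0)) := rfl
  rw [h, capLayer]
  refine (tensor_rightPt _ _ _).trans ((congrArg _ (tensor_leftPt _ _ _)).trans rfl)

theorem capLayer_sndPos : (capLayer v₁ a v₂).partner (Sum.inl (sndPos v₁ a a.dual v₂)) =
    Sum.inl (fstPos v₁ a a.dual v₂) := by
  rw [← capLayer_fstPos, partner_partner]

theorem capLayer_skip (i : Fin (v₁ ++ v₂).length) :
    (capLayer v₁ a v₂).partner (Sum.inl (skip v₁ a a.dual v₂ i)) = Sum.inr i := by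
  rcases exists_fin i with ⟨x, rfl⟩ | ⟨x, rfl⟩
  · have h : (Sum.inl (skip v₁ a a.dual v₂ (inLeft v₁ v₂ x)) : Pt _ (v₁ ++ v₂)) =
        leftPt v₁ v₁ _ _ (Sum.inl x) := congrArg Sum.inl (Fin.ext (if_pos x.2))
    rw [h, capLayer]
    exact tensor_leftPt _ _ _
  · have h : (Sum.inl (skip v₁ a a.dual v₂ (inRight v₁ v₂ x)) : Pt _ (v₁ ++ v₂)) =
        rightPt v₁ v₁ _ _ (rightPt [a, a.dual] [] v₂ v₂ (Sum.inl x)) := by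
      refine congrArg Sum.inl (Fin.ext ?_)
      refine (if_neg (by simp [inRight])).trans ?_
      change v₁.length + (x : ℕ) + 2 = v₁.length + (2 + x)
      omega
    rw [h, capLayer]
    refine (tensor_rightPt _ _ _).trans ((congrArg _ (tensor_rightPt _ _ _)).trans ?_)
    refine congrArg Sum.inr (Fin.ext ?_)
    simp [inRight]

theorem capLayer_inr (i : Fin (v₁ ++ v₂).length) :
    (capLayer v₁ a v₂).partner (Sum.inr i) = Sum.inl (skip v₁ a a.dual v₂ i) := by
  rw [← capLayer_skip, partner_partner]

section CapAbove

variable (D : Diagram (v₁ ++ v₂) w)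

/-- The vertical strings of the layer merely prolong the strings of `D` to the top. So no loop
arises, and the composite is `D` with one more arc. -/
theorem glue_capLayer_above (p : Pt (v₁ ++ v₂) w) :
    glue (capLayer v₁ a v₂).partner D.partner (outer (skipUp v₁ a a.dual v₂ w p)) (Sum.inr p) := by
  rcases p with p | p
  · have h := glue_up (σ := (capLayer v₁ a v₂).partner) (τ := D.partner)
      (Sum.inl (skip v₁ a a.dual v₂ p))
    rw [capLayer_skip] at h
    exact h
  · exact Setoid.refl' _ _

theorem capLayer_comp_skip (p : Pt (v₁ ++ v₂) w) :
    ((capLayer v₁ a v₂).comp D).partner (skipUp v₁ a a.dual v₂ w p) =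
      skipUp v₁ a a.dual v₂ w (D.partner p) := by
  refine comp_partner_eq _ _ ?_ fun h => D.partner_ne p (skipUp_injective h)
  exact Setoid.trans' _ (glue_capLayer_above D p)
    (Setoid.trans' _ (glue_down p) (Setoid.symm' _ (glue_capLayer_above D _)))

theorem capLayer_comp_fstPos :
    ((capLayer v₁ a v₂).comp D).partner (Sum.inl (fstPos v₁ a a.dual v₂)) =
      Sum.inl (sndPos v₁ a a.dual v₂) := by
  refine comp_partner_eq _ _ ?_ fun h => fstPos_ne_sndPos (Sum.inl_injective h).symm
  have h := glue_up (σ := (capLayer v₁ a v₂).partner) (τ := D.partner)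
    (Sum.inl (fstPos v₁ a a.dual v₂))
  rw [capLayer_fstPos] at h
  exact h

theorem capLayer_loops : (capLayer v₁ a v₂).loops D = 0 :=
  loops_eq_zero _ _ fun x => ⟨_, glue_capLayer_above D (Sum.inl x)⟩

open Classical in
-- The only new string is the arc. It starts at its letter X and so ends before it starts exactly
-- when X is on the right, i.e. for `a = Xstar`; the order of the other points is unchanged.
theorem turn_capLayer_comp : ((capLayer v₁ a v₂).comp D).turn =
    (if a = Letter.Xstar then 1 else 0) + D.turn := by
  have h1 := capLayer_comp_fstPos (a := a) D
  have h2 : ((capLayer v₁ a v₂).comp D).partner (Sum.inl (sndPos v₁ a a.dual v₂)) =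
      Sum.inl (fstPos v₁ a a.dual v₂) := by rw [← h1, partner_partner]
  rw [turn, parity_remove skipUp_injective (Sum.inl_injective.ne fstPos_ne_sndPos) skipUp_ne_fstPos
    skipUp_ne_sndPos skipUp_cases, h1, h2]
  congr 1
  · have e : pos (Sum.inl (sndPos v₁ a a.dual v₂) : Pt _ w) =
        pos (Sum.inl (fstPos v₁ a a.dual v₂) : Pt (v₁ ++ a :: a.dual :: v₂) w) + 1 := rfl
    have e' : orient _ w (Sum.inl (sndPos v₁ a a.dual v₂)) = a.dual.sign :=
      congrArg Letter.sign get_sndPos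
    rw [e, e']
    cases a <;> simp [Letter.sign, Letter.dual]
  · refine parity_congr fun p => ?_
    rw [capLayer_comp_skip, orient_skipUp, pos_skipUp_lt]

theorem turn_capLayer : (capLayer v₁ a v₂).turn =
    (if a = Letter.Xstar then 1 else 0) + starParity (v₁ ++ v₂) := by
  rw [← comp_id (capLayer v₁ a v₂), turn_capLayer_comp, turn_id]

end CapAbove

section CapBelow

variable (D : Diagram u (v₁ ++ a :: a.dual :: v₂))

theorem glue_capLayer_below (p : Pt u (v₁ ++ v₂)) :
    glue D.partner (capLayer v₁ a v₂).partner (outer p)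
      (Sum.map _root_.id Sum.inl (skipDown u v₁ a a.dual v₂ p)) := by
  rcases p with p | p
  · exact Setoid.refl' _ _
  · have h := glue_down (σ := D.partner) (τ := (capLayer v₁ a v₂).partner) (Sum.inr p)
    rw [capLayer_inr] at h
    exact h

theorem glue_capLayer_arc : glue D.partner (capLayer v₁ a v₂).partner
    (Sum.inr (Sum.inl (fstPos v₁ a a.dual v₂))) (Sum.inr (Sum.inl (sndPos v₁ a a.dual v₂))) := by
  have h := glue_down (σ := D.partner) (τ := (capLayer v₁ a v₂).partner)
    (Sum.inl (fstPos v₁ a a.dual v₂))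
  rw [capLayer_fstPos] at h
  exact h

variable {D}

theorem comp_capLayer_skip {p q : Pt u (v₁ ++ v₂)}
    (h : D.partner (skipDown u v₁ a a.dual v₂ p) = skipDown u v₁ a a.dual v₂ q) :
    (D.comp (capLayer v₁ a v₂)).partner p = q := by
  refine comp_partner_eq _ _ ?_ fun hpq => D.partner_ne _ (hpq ▸ h)
  have h' := glue_up (σ := D.partner) (τ := (capLayer v₁ a v₂).partner)
    (skipDown u v₁ a a.dual v₂ p)
  rw [h] at h'
  exact Setoid.trans' _ (glue_capLayer_below D p)
    (Setoid.trans' _ h' (Setoid.symm' _ (glue_capLayer_below D q)))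

/-- The two strings of `D` that reach the arc become one: from `p` to the first letter, along the
arc to the second letter, and on to `q`. -/
theorem comp_capLayer_join {p q : Pt u (v₁ ++ v₂)}
    (hp : D.partner (Sum.inr (fstPos v₁ a a.dual v₂)) = skipDown u v₁ a a.dual v₂ p)
    (hq : D.partner (Sum.inr (sndPos v₁ a a.dual v₂)) = skipDown u v₁ a a.dual v₂ q) :
    (D.comp (capLayer v₁ a v₂)).partner p = q := by
  refine comp_partner_eq _ _ ?_ fun hpq => ?_
  · have h₁ := glue_up (σ := D.partner) (τ := (capLayer v₁ a v₂).partner)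
      (Sum.inr (fstPos v₁ a a.dual v₂))
    have h₂ := glue_up (σ := D.partner) (τ := (capLayer v₁ a v₂).partner)
      (Sum.inr (sndPos v₁ a a.dual v₂))
    rw [hp] at h₁
    rw [hq] at h₂
    exact Setoid.trans' _ (glue_capLayer_below D p) (Setoid.trans' _ (Setoid.symm' _ h₁)
      (Setoid.trans' _ (glue_capLayer_arc D) (Setoid.trans' _ h₂
      (Setoid.symm' _ (glue_capLayer_below D q)))))
  · rw [hpq, ← hp] at hq
    have := congrArg D.partner hq
    rw [partner_partner, partner_partner] at this
    exact fstPos_ne_sndPos (Sum.inr_injective this).symm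

/-- The letters off the arc are connected to the bottom by vertical strings. If `D` does not join
the two ends of the arc, the string of `D` at the first of them leads to a point connected to the
boundary, and the second is reached along the arc. -/
theorem comp_capLayer_loops_zero (h : D.partner (Sum.inr (fstPos v₁ a a.dual v₂)) ≠
    Sum.inr (sndPos v₁ a a.dual v₂)) : D.loops (capLayer v₁ a v₂) = 0 := by
  have key : ∃ p, glue D.partner (capLayer v₁ a v₂).partner (outer p)
      (Sum.inr (Sum.inl (fstPos v₁ a a.dual v₂))) := by
    rcases skipDown_cases (D.partner (Sum.inr (fstPos v₁ a a.dual v₂))) with h' | h' | ⟨q, h'⟩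
    · exact absurd h' (D.partner_ne _)
    · exact absurd h' h
    · have h₁ := glue_up (σ := D.partner) (τ := (capLayer v₁ a v₂).partner)
        (Sum.inr (fstPos v₁ a a.dual v₂))
      rw [h'] at h₁
      exact ⟨q, Setoid.trans' _ (glue_capLayer_below D q) (Setoid.symm' _ h₁)⟩
  obtain ⟨p, hp⟩ := key
  refine loops_eq_zero _ _ fun x => ?_
  rcases pos_cases x with rfl | rfl | ⟨i, rfl⟩
  · exact ⟨p, hp⟩
  · exact ⟨p, Setoid.trans' _ hp (glue_capLayer_arc D)⟩
  · exact ⟨Sum.inr i, glue_capLayer_below D (Sum.inr i)⟩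

theorem comp_capLayer_loops_one (h : D.partner (Sum.inr (fstPos v₁ a a.dual v₂)) =
    Sum.inr (sndPos v₁ a a.dual v₂)) : D.loops (capLayer v₁ a v₂) = 1 := by
  have h' : D.partner (Sum.inr (sndPos v₁ a a.dual v₂)) =
    Sum.inr (fstPos v₁ a a.dual v₂) := by rw [← h, partner_partner]
  let L : Fin u.length ⊕ Fin (v₁ ++ a :: a.dual :: v₂).length ⊕ Fin (v₁ ++ v₂).length → Prop :=
    fun x => x = Sum.inr (Sum.inl (fstPos v₁ a a.dual v₂)) ∨
      x = Sum.inr (Sum.inl (sndPos v₁ a a.dual v₂))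
  -- the loop is not connected to anything else
  have hL : ∀ x y, glue D.partner (capLayer v₁ a v₂).partner x y → (L x ↔ L y) := by
    intro x y hxy
    refine glue_le (r := ⟨fun x y => (L x ↔ L y), fun _ => Iff.rfl, Iff.symm, Iff.trans⟩)
      (fun p => ?_) (fun p => ?_) hxy
    · have aux : ∀ q : Pt u (v₁ ++ v₂), ¬ L (Sum.map _root_.id Sum.inl
          (skipDown u v₁ a a.dual v₂ q)) := by
        rintro (q | q) <;> simp [L, skipDown, skip_ne_fstPos, skip_ne_sndPos]
      rcases skipDown_cases p with rfl | rfl | ⟨q, rfl⟩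
      · rw [h]; simp [L]
      · rw [h']; simp [L]
      · rcases skipDown_cases (D.partner (skipDown u v₁ a a.dual v₂ q)) with e | e | ⟨q', e⟩
        · have := congrArg D.partner e
          rw [partner_partner, h] at this
          exact absurd this (skipDown_ne_sndPos _)
        · have := congrArg D.partner e
          rw [partner_partner, h'] at this
          exact absurd this (skipDown_ne_fstPos _)
        · rw [e]
          exact iff_of_false (aux _) (aux _)
    · rcases p with p | p
      · rcases pos_cases p with rfl | rfl | ⟨i, rfl⟩
        · rw [capLayer_fstPos]; simp [L]
        · rw [capLayer_sndPos]; simp [L]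
        · rw [capLayer_skip]; simp [L, skip_ne_fstPos, skip_ne_sndPos]
      · rw [capLayer_inr]; simp [L, skip_ne_fstPos, skip_ne_sndPos]
  rw [loops, loopCount, Nat.card_eq_one_iff_unique]
  constructor
  -- Every middle point other than the ends of the arc is connected to the lower line, so the arc
  -- carries the only possible loop.
  · have key : ∀ K : {K : Quotient (glue D.partner (capLayer v₁ a v₂).partner) //
        ∀ p, Quotient.mk _ (outer p) ≠ K},
        K.1 = Quotient.mk _ (Sum.inr (Sum.inl (fstPos v₁ a a.dual v₂))) := by
      rintro ⟨K, hK⟩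
      induction K using Quotient.inductionOn with | _ x
      rcases x with x | x | x
      · exact absurd rfl (hK (Sum.inl x))
      · rcases pos_cases x with rfl | rfl | ⟨i, rfl⟩
        · rfl
        · exact Quotient.sound (Setoid.symm' _ (glue_capLayer_arc D))
        · exact absurd (Quotient.sound (glue_capLayer_below D (Sum.inr i))) (hK (Sum.inr i))
      · exact absurd rfl (hK (Sum.inr x))
    exact ⟨fun K K' => Subtype.ext ((key K).trans (key K').symm)⟩
  · refine ⟨⟨Quotient.mk _ (Sum.inr (Sum.inl (fstPos v₁ a a.dual v₂))), fun p hp => ?_⟩⟩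
    have := (hL _ _ (Quotient.exact hp)).2 (Or.inl rfl)
    rcases p with p | p <;> simp [L, outer] at this

end CapBelow

end Diagram
end OrientedKauffman

/-! ### Turns and loops under composition with a single arc. -/

namespace OrientedKauffman

open Classical in
-- Used with `p`, `q` the free ends of the two strings joined by an arc: at all other points the old
-- and the new diagram agree. Differences are written as sums since the coefficients are modulo 2.
theorem parity_congr_off_two {ι : Type} [Fintype ι] {K L : ι → Prop} {p q : ι} (hpq : p ≠ q)
    (h : ∀ x, x ≠ p → x ≠ q → (K x ↔ L x)) :
    parity K = ((if K p then 1 else 0) + (if K q then 1 else 0)) +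
      ((if L p then 1 else 0) + (if L q then 1 else 0)) + parity L := by
  have key := fun M : ι → Prop => parity_remove (f := (Subtype.val : {x // x ≠ p ∧ x ≠ q} → ι))
    Subtype.val_injective hpq (fun x => x.2.1) (fun x => x.2.2)
    (fun x => by
      by_cases h1 : x = p
      · exact Or.inl h1
      · by_cases h2 : x = q
        · exact Or.inr (Or.inl h2)
        · exact Or.inr (Or.inr ⟨⟨x, h1, h2⟩, rfl⟩)) M
  rw [key K, key L, parity_congr (K := fun x : {x // x ≠ p ∧ x ≠ q} => K x)
    fun x => h x x.2.1 x.2.2]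
  linear_combination -zmod_two_add_self ((if L p then (1 : ZMod 2) else 0) +
    (if L q then 1 else 0))

open Classical in
-- Here `S + 1` and `S` are the places of the first and second letter of the arc, and `P` and `Q`
-- those of their partners. The hypothesis lists the non-crossing positions: nested strings with
-- both free ends before or both after the arc, or one free end on either side. The first four terms
-- belong to the two old strings, the last two to the joined one.
theorem turn_join_arith (a : Letter) {P Q S : ℕ}
    (h : (Q < S ∧ P < Q) ∨ (S + 1 < P ∧ P < Q) ∨ (Q < S ∧ S + 1 < P)) :
    ((((if -a.sign = 1 ∧ P < S + 1 then 1 else 0) + (if a.sign = 1 ∧ Q < S then 1 else 0) +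
      ((if a.sign = 1 ∧ S + 1 < P then 1 else 0) + (if -a.sign = 1 ∧ S < Q then 1 else 0))) +
      ((if a.sign = 1 ∧ Q < P then 1 else 0) + (if -a.sign = 1 ∧ P < Q then 1 else 0)) :
      ZMod 2)) = if a = Letter.X then 1 else 0 := by
  have two : (1 : ZMod 2) + 1 = 0 := by decide
  rcases h with ⟨h₁, h₂⟩ | ⟨h₁, h₂⟩ | ⟨h₁, h₂⟩
  · have e : P < S + 1 ∧ ¬ S + 1 < P ∧ ¬ S < Q ∧ ¬ Q < P := by omega
    cases a <;> simp [Letter.sign, e, h₁, h₂, two]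
  · have e : ¬ Q < S ∧ ¬ P < S + 1 ∧ S < Q ∧ ¬ Q < P := by omega
    cases a <;> simp [Letter.sign, e, h₁, h₂, two]
  · have e : ¬ P < S + 1 ∧ ¬ S < Q ∧ ¬ P < Q ∧ Q < P := by omega
    cases a <;> simp [Letter.sign, e, h₁, h₂, two]

namespace Diagram

variable {v₁ v₂ u v w : Word} {a : Letter} {D : Diagram u (v₁ ++ a :: a.dual :: v₂)}

open Classical in
-- Only the lower arc of `D` disappears. It starts at its letter X*, which is later in the cyclic
-- order precisely when it is the left letter.
theorem turn_comp_capLayer_loop (h : D.partner (Sum.inr (fstPos v₁ a a.dual v₂)) =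
    Sum.inr (sndPos v₁ a a.dual v₂)) :
    D.turn = (if a = Letter.Xstar then 1 else 0) + (D.comp (capLayer v₁ a v₂)).turn := by
  have h' : D.partner (Sum.inr (sndPos v₁ a a.dual v₂)) =
    Sum.inr (fstPos v₁ a a.dual v₂) := by rw [← h, partner_partner]
  rw [turn, parity_remove skipDown_injective (Sum.inr_injective.ne fstPos_ne_sndPos)
    skipDown_ne_fstPos skipDown_ne_sndPos skipDown_cases, h, h', pos_fstPos]
  congr 1
  · have e' : orient u _ (Sum.inr (fstPos v₁ a a.dual v₂)) = -a.sign :=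
      congrArg (fun x => -Letter.sign x) get_fstPos
    rw [e']
    cases a <;> simp [Letter.sign]
  · refine parity_congr fun p => ?_
    rcases skipDown_cases (D.partner (skipDown u v₁ a a.dual v₂ p)) with e | e | ⟨q, e⟩
    · have := congrArg D.partner e
      rw [partner_partner, h] at this
      exact absurd this (skipDown_ne_sndPos _)
    · have := congrArg D.partner e
      rw [partner_partner, h'] at this
      exact absurd this (skipDown_ne_fstPos _)
    · rw [comp_capLayer_skip e, e, orient_skipDown, pos_skipDown_lt]

open Classical in
theorem turn_comp_capLayer_join (h : D.partner (Sum.inr (fstPos v₁ a a.dual v₂)) ≠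
    Sum.inr (sndPos v₁ a a.dual v₂)) :
    D.turn = (if a = Letter.X then 1 else 0) + (D.comp (capLayer v₁ a v₂)).turn := by
  obtain ⟨p, hp⟩ : ∃ p, D.partner (Sum.inr (fstPos v₁ a a.dual v₂)) =
      skipDown u v₁ a a.dual v₂ p := by
    rcases skipDown_cases (D.partner (Sum.inr (fstPos v₁ a a.dual v₂))) with e | e | e
    · exact absurd e (D.partner_ne _)
    · exact absurd e h
    · exact e
  obtain ⟨q, hq⟩ : ∃ q, D.partner (Sum.inr (sndPos v₁ a a.dual v₂)) =
      skipDown u v₁ a a.dual v₂ q := by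
    rcases skipDown_cases (D.partner (Sum.inr (sndPos v₁ a a.dual v₂))) with e | e | e
    · refine absurd ?_ h
      rw [← e, partner_partner]
    · exact absurd e (D.partner_ne _)
    · exact e
  have hp' : D.partner (skipDown u v₁ a a.dual v₂ p) = Sum.inr (fstPos v₁ a a.dual v₂) := by
    rw [← hp, partner_partner]
  have hq' : D.partner (skipDown u v₁ a a.dual v₂ q) = Sum.inr (sndPos v₁ a a.dual v₂) := by
    rw [← hq, partner_partner]
  have hpq : p ≠ q := by
    rintro rfl
    exact fstPos_ne_sndPos (Sum.inr_injective (hp'.symm.trans hq'))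
  have ep := comp_capLayer_join hp hq
  have eq : (D.comp (capLayer v₁ a v₂)).partner q = p := by rw [← ep, partner_partner]
  rw [turn, parity_remove skipDown_injective (Sum.inr_injective.ne fstPos_ne_sndPos)
    skipDown_ne_fstPos skipDown_ne_sndPos skipDown_cases, hp, hq,
    parity_congr_off_two hpq (L := fun x => orient u _ x = 1 ∧
      pos ((D.comp (capLayer v₁ a v₂)).partner x) < pos x), turn, hp', hq', ep, eq, ← add_assoc,
      orient_skipDown, orient_skipDown, ← pos_skipDown_lt (a := a) (b := a.dual) p q,
      ← pos_skipDown_lt (a := a) (b := a.dual) q p]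
  · congr 1
    have o₁ : orient u _ (Sum.inr (fstPos v₁ a a.dual v₂)) = -a.sign :=
      congrArg (fun x => -Letter.sign x) get_fstPos
    have o₂ : orient u _ (Sum.inr (sndPos v₁ a a.dual v₂)) = a.sign := by
      refine (congrArg (fun x => -Letter.sign x) get_sndPos).trans ?_
      rw [Letter.sign_dual, neg_neg]
    have o₃ : orient u _ p = a.sign := by
      rw [← orient_skipDown (a := a) (b := a.dual), ← hp, orient_partner, o₁, neg_neg]
    have o₄ : orient u _ q = -a.sign := by
      rw [← orient_skipDown (a := a) (b := a.dual), ← hq, orient_partner, o₂]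
    rw [o₁, o₂, o₃, o₄]
    have hF := pos_fstPos (u := u) (v₁ := v₁) (a := a) (b := a.dual) (v₂ := v₂)
    -- These three instances of planarity exclude exactly the crossing orders of the four ends,
    -- which leaves the cases of `turn_join_arith`.
    have n₁ := D.planar (Sum.inr (sndPos v₁ a a.dual v₂)) (Sum.inr (fstPos v₁ a a.dual v₂))
    have n₂ := D.planar (skipDown u v₁ a a.dual v₂ p) (Sum.inr (sndPos v₁ a a.dual v₂))
    have n₃ := D.planar (skipDown u v₁ a a.dual v₂ q) (skipDown u v₁ a a.dual v₂ p)
    rw [hp, hq] at n₁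
    rw [hp', hq] at n₂
    rw [hp', hq'] at n₃
    have m₁ := pos_injective.ne (skipDown_ne_fstPos (a := a) (b := a.dual) p)
    have m₂ := pos_injective.ne (skipDown_ne_sndPos (a := a) (b := a.dual) p)
    have m₃ := pos_injective.ne (skipDown_ne_fstPos (a := a) (b := a.dual) q)
    have m₄ := pos_injective.ne (skipDown_ne_sndPos (a := a) (b := a.dual) q)
    have m₅ := pos_injective.ne ((skipDown_injective (a := a) (b := a.dual)).ne hpq)
    generalize pos (skipDown u v₁ a a.dual v₂ p) = P at *
    generalize pos (skipDown u v₁ a a.dual v₂ q) = Q at *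
    generalize pos (Sum.inr (fstPos v₁ a a.dual v₂) : Pt u _) = F at *
    generalize pos (Sum.inr (sndPos v₁ a a.dual v₂) : Pt u _) = S at *
    clear hp hq hp' hq' ep eq o₁ o₂ o₃ o₄
    subst hF
    rw [← add_assoc]
    convert turn_join_arith a (P := P) (Q := Q) (S := S) (by omega)
  · intro x hxp hxq
    rcases skipDown_cases (D.partner (skipDown u v₁ a a.dual v₂ x)) with e | e | ⟨y, e⟩
    · rw [← hp'] at e
      have := congrArg D.partner e
      rw [partner_partner, partner_partner] at this
      exact absurd (skipDown_injective this) hxp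
    · rw [← hq'] at e
      have := congrArg D.partner e
      rw [partner_partner, partner_partner] at this
      exact absurd (skipDown_injective this) hxq
    · rw [comp_capLayer_skip e, e, orient_skipDown, pos_skipDown_lt]

/-- The parity of the number of loops in a concatenation is determined by the turns. -/
def TurnAdd (D : Diagram u v) (E : Diagram v w) : Prop :=
  D.turn + E.turn + starParity v = (D.comp E).turn + D.loops E

/-- The layer itself contributes a turn for `a = Xstar`, and the inserted pair adds one letter X* to
the middle word. When a loop is closed, the arc of `D` has the same turn as the layer and the letter
X* accounts for the loop; when strings are joined, the turn changes exactly for `a = X`, so the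
contributions cancel. -/
theorem turnAdd_comp_capLayer (D : Diagram u (v₁ ++ a :: a.dual :: v₂)) :
    TurnAdd D (capLayer v₁ a v₂) := by
  have t := zmod_two_add_self (starParity (v₁ ++ v₂))
  rw [TurnAdd, turn_capLayer, starParity_insert]
  by_cases h : D.partner (Sum.inr (fstPos v₁ a a.dual v₂)) = Sum.inr (sndPos v₁ a a.dual v₂)
  · rw [comp_capLayer_loops_one h, turn_comp_capLayer_loop h, Nat.cast_one]
    have t' := zmod_two_add_self (if a = Letter.Xstar then (1 : ZMod 2) else 0)
    linear_combination t + t'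
  · rw [comp_capLayer_loops_zero h, turn_comp_capLayer_join h, Nat.cast_zero]
    have t' := zmod_two_add_self 1
    cases a <;> simp <;> linear_combination t + t'

theorem turnAdd_capLayer_comp (D : Diagram (v₁ ++ v₂) w) : TurnAdd (capLayer v₁ a v₂) D := by
  have t := zmod_two_add_self (starParity (v₁ ++ v₂))
  rw [TurnAdd, turn_capLayer, turn_capLayer_comp, capLayer_loops, Nat.cast_zero]
  linear_combination t

theorem TurnAdd.mirror {D : Diagram u v} {E : Diagram v w} (h : TurnAdd D E) :
    TurnAdd E.mirror D.mirror := by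
  rw [TurnAdd, ← mirror_comp, mirror_loops, turn_mirror, turn_mirror, turn_mirror,
    add_comm E.turn]
  exact h

/-- By `loops_assoc` the number of loops is a 2-cocycle, and the turn side of the identity is a
coboundary up to the parities of the middle words. Hence among the four pairs occurring in a triple
product, three instances of `TurnAdd` imply the fourth. -/
theorem TurnAdd.assoc_right {z : Word} {D : Diagram u v} {E : Diagram v w} {F : Diagram w z}
    (h₁ : TurnAdd D E) (h₂ : TurnAdd (D.comp E) F) (h₃ : TurnAdd E F) : TurnAdd D (E.comp F) := by
  have h := congrArg (Nat.cast : ℕ → ZMod 2) (loops_assoc D E F)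
  rw [Nat.cast_add, Nat.cast_add] at h
  rw [TurnAdd] at *
  rw [comp_assoc] at h₂
  linear_combination h₁ + h₂ - h₃ + h

theorem TurnAdd.assoc_left {z : Word} {D : Diagram u v} {E : Diagram v w} {F : Diagram w z}
    (h₁ : TurnAdd D E) (h₂ : TurnAdd E F) (h₃ : TurnAdd D (E.comp F)) : TurnAdd (D.comp E) F := by
  have h := congrArg (Nat.cast : ℕ → ZMod 2) (loops_assoc D E F)
  rw [Nat.cast_add, Nat.cast_add] at h
  rw [TurnAdd] at *
  rw [comp_assoc]
  linear_combination h₂ + h₃ - h₁ - h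

end Diagram
end OrientedKauffman

/-! ### Planar diagrams are generated by single arcs. -/

namespace OrientedKauffman

theorem le_of_strictMono_fin {m n : ℕ} {f : Fin m → Fin n} (hf : StrictMono f) (i : Fin m) :
    (i : ℕ) ≤ f i := by
  obtain ⟨i, hi⟩ := i
  induction i with
  | zero => exact Nat.zero_le _
  | succ i ih =>
    have h1 := ih (by omega)
    have h2 : f ⟨i, by omega⟩ < f ⟨i + 1, hi⟩ := hf (Fin.mk_lt_mk.2 (Nat.lt_succ_self i))
    exact lt_of_le_of_lt h1 h2

/-- A strictly increasing map lies above the identity; conjugating by the reversal gives the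
opposite inequality. -/
theorem eq_of_strictMono_fin {m n : ℕ} {f : Fin m → Fin n} (hf : StrictMono f) (h : n = m)
    (i : Fin m) : (f i : ℕ) = i := by
  have h1 := le_of_strictMono_fin hf i
  have hg : StrictMono fun i : Fin m => (f i.rev).rev := fun i j hij =>
    Fin.rev_lt_rev.2 (hf (Fin.rev_lt_rev.2 hij))
  have h2 := le_of_strictMono_fin hg i.rev
  simp only [Fin.rev_rev, Fin.val_rev] at h2
  omega

namespace Diagram

variable {u v w v₁ v₂ : Word} {a : Letter}

/-- Through strings cannot cross. Consequently, if all strings are vertical, orientations force the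
two words to agree and the diagram is the identity. -/
theorem strictMono_through (D : Diagram u v) {f : Fin u.length → Fin v.length}
    (hf : ∀ i, D.partner (Sum.inl i) = Sum.inr (f i)) : StrictMono f := by
  intro i j hij
  have h := D.planar (Sum.inl i) (Sum.inl j)
  rw [hf, hf] at h
  have hne : f i ≠ f j := fun e => hij.ne (Sum.inl_injective (by
    rw [← D.partner_partner (Sum.inl i), ← D.partner_partner (Sum.inl j), hf, hf, e]))
  have hne' := Fin.val_ne_of_ne hne
  simp only [pos, Sum.elim_inl, Sum.elim_inr, Fin.val_rev] at h
  rw [Fin.lt_def] at hij ⊢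
  omega

theorem length_le_of_through (D : Diagram u v)
    (h : ∀ i, ∃ j, D.partner (Sum.inl i) = Sum.inr j) : u.length ≤ v.length := by
  choose f hf using h
  simpa using Fintype.card_le_of_injective f (D.strictMono_through hf).injective

theorem eq_of_through (D : Diagram u v) (h : ∀ i, ∃ j, D.partner (Sum.inl i) = Sum.inr j)
    (hl : v.length = u.length) : u = v := by
  choose f hf using h
  have hv := eq_of_strictMono_fin (D.strictMono_through hf) hl
  refine List.ext_get hl.symm fun i h₁ h₂ => ?_
  have ho := D.orient_partner (Sum.inl ⟨i, h₁⟩)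
  rw [hf] at ho
  have e : f ⟨i, h₁⟩ = ⟨i, h₂⟩ := Fin.ext (hv _)
  rw [e] at ho
  simp only [orient, Sum.elim_inl, Sum.elim_inr, Pi.neg_apply, neg_inj] at ho
  exact (Letter.eq_of_sign ho).symm

theorem eq_id_of_through (D : Diagram u u) (h : ∀ i, ∃ j, D.partner (Sum.inl i) = Sum.inr j) :
    D = id u := by
  choose f hf using h
  have hv : ∀ i, f i = i := fun i => Fin.ext (eq_of_strictMono_fin (D.strictMono_through hf) rfl i)
  refine ext_partner ?_
  rintro (p | p)
  · rw [hf, hv]; rfl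
  · have := hf p
    rw [hv] at this
    nth_rewrite 1 [← this]
    rw [D.partner_partner]; rfl

/-- An innermost arc joins two adjacent points. -/
theorem exists_adjacent_arc (D : Diagram u v) (i j : Fin u.length) (hij : i < j)
    (h : D.partner (Sum.inl i) = Sum.inl j) :
    ∃ i j : Fin u.length, (j : ℕ) = i + 1 ∧ D.partner (Sum.inl i) = Sum.inl j := by
  obtain ⟨n, hn⟩ : ∃ n : ℕ, (j : ℕ) - i ≤ n := ⟨_, le_rfl⟩
  induction n generalizing i j with
  | zero => rw [Fin.lt_def] at hij; omega
  | succ n ih =>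
    by_cases hj : (j : ℕ) = i + 1
    · exact ⟨i, j, hj, h⟩
    rw [Fin.lt_def] at hij
    -- The string from the neighbour of `i` is trapped under the arc from `i` to `j`, so it is a
    -- strictly shorter arc.
    let k : Fin u.length := ⟨i + 1, by omega⟩
    have hk : (k : ℕ) = i + 1 := rfl
    have h1 := D.planar (Sum.inl i) (Sum.inl k)
    have h2 := D.planar (D.partner (Sum.inl k)) (Sum.inl i)
    rw [D.partner_partner] at h2
    have ne1 : D.partner (Sum.inl k) ≠ Sum.inl i := fun e => by
      have := congrArg D.partner e
      rw [D.partner_partner, h] at this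
      have := Fin.val_eq_of_eq (Sum.inl_injective this)
      omega
    have ne2 : D.partner (Sum.inl k) ≠ Sum.inl j := fun e => by
      rw [← h] at e
      have := congrArg D.partner e
      rw [D.partner_partner, D.partner_partner] at this
      have := Fin.val_eq_of_eq (Sum.inl_injective this)
      omega
    have ne3 := D.partner_ne (Sum.inl k)
    rw [h] at h1 h2
    rcases hl : D.partner (Sum.inl k) with l | l
    · rw [hl] at h1 h2 ne1 ne2 ne3
      have ne1' : (l : ℕ) ≠ i := fun e => ne1 (congrArg Sum.inl (Fin.ext e))
      have ne2' : (l : ℕ) ≠ j := fun e => ne2 (congrArg Sum.inl (Fin.ext e))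
      have ne3' : (l : ℕ) ≠ k := fun e => ne3 (congrArg Sum.inl (Fin.ext e))
      simp only [pos, Sum.elim_inl] at h1 h2
      refine ih k l ?_ hl ?_
      · rw [Fin.lt_def]; omega
      · omega
    · rw [hl] at h1
      simp only [pos, Sum.elim_inl, Sum.elim_inr] at h1
      omega

theorem mirror_capLayer_comp_skip (D : Diagram (v₁ ++ a :: a.dual :: v₂) w)
    {p q : Pt (v₁ ++ v₂) w}
    (h : D.partner (skipUp v₁ a a.dual v₂ w p) = skipUp v₁ a a.dual v₂ w q) :
    ((capLayer v₁ a v₂).mirror.comp D).partner p = q := by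
  have h' : (D.mirror.comp (capLayer v₁ a v₂)).partner p.swap = q.swap := by
    refine comp_capLayer_skip ?_
    rw [mirror_partner, skipDown_swap, Sum.swap_swap, h, skipUp_swap]
  rw [← mirror_mirror D, ← mirror_comp, mirror_partner, h', Sum.swap_swap]

/-- The reflected layer closes the arc of `D` to a loop, which `comp` discards, and the layer puts
the arc back. This yields the factorization of `D` through a diagram with two fewer letters on top.
-/
theorem capLayer_comp_mirror_comp (D : Diagram (v₁ ++ a :: a.dual :: v₂) w)
    (h : D.partner (Sum.inl (fstPos v₁ a a.dual v₂)) = Sum.inl (sndPos v₁ a a.dual v₂)) :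
    (capLayer v₁ a v₂).comp ((capLayer v₁ a v₂).mirror.comp D) = D := by
  have h' : D.partner (Sum.inl (sndPos v₁ a a.dual v₂)) = Sum.inl (fstPos v₁ a a.dual v₂) := by
    rw [← h, D.partner_partner]
  refine ext_partner fun p => ?_
  rcases skipUp_cases p with rfl | rfl | ⟨p, rfl⟩
  · rw [capLayer_comp_fstPos, h]
  · rw [h', ← capLayer_comp_fstPos, partner_partner]
  · rw [capLayer_comp_skip]
    rcases skipUp_cases (D.partner (skipUp v₁ a a.dual v₂ w p)) with e | e | ⟨q, e⟩
    · rw [← h'] at e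
      have := congrArg D.partner e
      rw [D.partner_partner, D.partner_partner] at this
      exact absurd this (skipUp_ne_sndPos _)
    · rw [← h] at e
      have := congrArg D.partner e
      rw [D.partner_partner, D.partner_partner] at this
      exact absurd this (skipUp_ne_fstPos _)
    · rw [mirror_capLayer_comp_skip D e, e]

theorem exists_split {i j : Fin u.length} (hij : (j : ℕ) = i + 1) :
    ∃ v₁ a b v₂, u = v₁ ++ a :: b :: v₂ ∧ (i : ℕ) = v₁.length := by
  have hj := j.2
  refine ⟨u.take i, u[(i : ℕ)], u[(i : ℕ) + 1], u.drop (i + 2), ?_, ?_⟩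
  · rw [← List.drop_eq_getElem_cons, ← List.drop_eq_getElem_cons, List.take_append_drop]
  · rw [List.length_take]; omega

/-- A diagram with an upper arc factors through an innermost one. -/
theorem exists_eq_capLayer_comp (D : Diagram u w) (h : ∃ i j, D.partner (Sum.inl i) = Sum.inl j) :
    ∃ v₁ a v₂, ∃ hu : v₁ ++ a :: a.dual :: v₂ = u, ∃ E : Diagram (v₁ ++ v₂) w,
      D = hu ▸ (capLayer v₁ a v₂).comp E := by
  obtain ⟨i, j, h⟩ := h
  have h0 : ∃ i j, i < j ∧ D.partner (Sum.inl i) = Sum.inl j := by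
    rcases lt_trichotomy i j with hij | rfl | hij
    · exact ⟨i, j, hij, h⟩
    · exact absurd h (D.partner_ne _)
    · exact ⟨j, i, hij, by rw [← h, D.partner_partner]⟩
  obtain ⟨i, j, hij, h⟩ := h0
  obtain ⟨i, j, hij, h⟩ := D.exists_adjacent_arc i j hij h
  obtain ⟨v₁, a, b, v₂, rfl, hi⟩ := exists_split hij
  obtain rfl : i = fstPos v₁ a b v₂ := Fin.ext hi
  obtain rfl : j = sndPos v₁ a b v₂ := Fin.ext hij
  have hb := D.get_partner_inl h
  rw [get_fstPos, get_sndPos] at hb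
  subst hb
  exact ⟨v₁, a, v₂, rfl, _, (capLayer_comp_mirror_comp D h).symm⟩

/-- Induction on the total number of letters. An upper arc can be taken innermost and split off,
which removes two letters; a lower arc becomes an upper one after reflection; without arcs the
diagram is an identity. -/
theorem capLayer_mirror_induction {P : ∀ {u v : Word}, Diagram u v → Prop}
    (id : ∀ u, P (id u))
    (cap : ∀ (v₁ : Word) (a : Letter) (v₂ w : Word) (D : Diagram (v₁ ++ v₂) w), P D →
      P ((capLayer v₁ a v₂).comp D))
    (mirror : ∀ (u v : Word) (D : Diagram u v), P D → P D.mirror)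
    {u v : Word} (D : Diagram u v) : P D := by
  obtain ⟨n, hn⟩ : ∃ n, u.length + v.length ≤ n := ⟨_, le_rfl⟩
  induction n using Nat.strong_induction_on generalizing u v with | _ n ih
  have key : ∀ (u v : Word) (D : Diagram u v), u.length + v.length ≤ n →
      (∃ i j, D.partner (Sum.inl i) = Sum.inl j) → P D := by
    intro u v D hn h
    obtain ⟨v₁, a, v₂, rfl, E, rfl⟩ := D.exists_eq_capLayer_comp h
    simp only [List.length_append, List.length_cons] at hn
    refine cap _ _ _ _ _ (ih (n - 1) (by omega) E ?_)
    rw [List.length_append]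
    omega
  by_cases h₁ : ∃ i j, D.partner (Sum.inl i) = Sum.inl j
  · exact key _ _ D hn h₁
  by_cases h₂ : ∃ i j, D.mirror.partner (Sum.inl i) = Sum.inl j
  · rw [← mirror_mirror D]
    exact mirror _ _ _ (key _ _ D.mirror (by omega) h₂)
  have through : ∀ (u v : Word) (D : Diagram u v), (¬ ∃ i j, D.partner (Sum.inl i) = Sum.inl j) →
      ∀ i, ∃ j, D.partner (Sum.inl i) = Sum.inr j := by
    intro u v D h i
    rcases hj : D.partner (Sum.inl i) with j | j
    · exact absurd ⟨i, j, hj⟩ h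
    · exact ⟨j, rfl⟩
  have t₁ := through _ _ D h₁
  have t₂ := through _ _ D.mirror h₂
  obtain rfl := D.eq_of_through t₁ (le_antisymm (D.mirror.length_le_of_through t₂)
    (D.length_le_of_through t₁))
  rw [D.eq_id_of_through t₁]
  exact id u

/-- The parity identity behind the compatibility of the star with composition, obtained from single
arcs by the cocycle rule and reflection. -/
theorem turnAdd (D : Diagram u v) (E : Diagram v w) : TurnAdd D E := by
  have hid : ∀ {u v : Word} (D : Diagram u v), TurnAdd D (id v) := by
    intro u v D
    have t := zmod_two_add_self (starParity v)
    rw [TurnAdd, comp_id, loops_id, turn_id, Nat.cast_zero]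
    linear_combination t
  -- Reflection exchanges the upper and the lower factor, so the induction over `E` must carry both
  -- one-sided statements.
  suffices h : (∀ (u : Word) (D : Diagram u v), TurnAdd D E) ∧
      ∀ (z : Word) (F : Diagram w z), TurnAdd E F from h.1 u D
  clear D
  induction E using capLayer_mirror_induction with
  | id w =>
    refine ⟨fun u D => hid D, fun z F => ?_⟩
    rw [← mirror_mirror F, ← mirror_id]
    exact (hid F.mirror).mirror
  | cap v₁ a v₂ w E ih =>
    refine ⟨fun u D => ?_, fun z F => ?_⟩
    · exact (turnAdd_comp_capLayer D).assoc_right (ih.1 _ _) (turnAdd_capLayer_comp E)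
    · exact (turnAdd_capLayer_comp E).assoc_left (ih.2 _ F) (turnAdd_capLayer_comp _)
  | mirror v w E ih =>
    refine ⟨fun u D => ?_, fun z F => ?_⟩
    · rw [← mirror_mirror D]
      exact (ih.2 _ D.mirror).mirror
    · rw [← mirror_mirror F]
      exact (ih.1 _ F.mirror).mirror

end Diagram
end OrientedKauffman

/-! ### Existence: the *-structure with parameter `c`. -/

namespace OrientedKauffman

theorem zpow_eq_of_cast_eq {s : ℂ} (hs : s * s = 1) {m n : ℤ} (h : (m : ZMod 2) = n) :
    s ^ m = s ^ n := by
  have hs0 : s ≠ 0 := left_ne_zero_of_mul (hs ▸ one_ne_zero)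
  obtain ⟨k, hk⟩ := ((ZMod.intCast_eq_intCast_iff m n 2).1 h).dvd
  push_cast at hk
  obtain rfl : n = m + 2 * k := by omega
  rw [zpow_add₀ hs0, zpow_mul, zpow_ofNat, pow_two, hs, one_zpow, mul_one]

theorem conj_eq_div_mul {d : ℂ} (hd : d ≠ 0) : starRingEnd ℂ d = starRingEnd ℂ d / d * d :=
  (div_mul_cancel₀ _ hd).symm

theorem conj_div_mul_self {d : ℂ} (hd : d ≠ 0)
    (h : d = starRingEnd ℂ d ∨ d = -starRingEnd ℂ d) :
    (starRingEnd ℂ d / d) * (starRingEnd ℂ d / d) = 1 := by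
  have h' : starRingEnd ℂ d * starRingEnd ℂ d = d * d := by
    rcases h with h | h
    · rw [← h]
    · have : starRingEnd ℂ d = -d := by linear_combination h
      rw [this]; ring
  rw [div_mul_div_comm, h', div_self (mul_ne_zero hd hd)]

theorem conj_conj_div {d : ℂ} (hd : d ≠ 0)
    (h : d = starRingEnd ℂ d ∨ d = -starRingEnd ℂ d) :
    starRingEnd ℂ (starRingEnd ℂ d / d) = starRingEnd ℂ d / d := by
  have h1 := conj_div_mul_self hd h
  have h2 : starRingEnd ℂ d ≠ 0 := (map_ne_zero _).2 hd
  rw [map_div₀, Complex.conj_conj]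
  field_simp at h1 ⊢
  linear_combination -h1

/-- Since conj d / d is its own inverse, reality of `c * d` is the same as this conjugation rule for
`c`, the form used in all computations with coefficients. -/
theorem conj_eq_of_conj_mul {c d : ℂ} (hd : d ≠ 0)
    (h : d = starRingEnd ℂ d ∨ d = -starRingEnd ℂ d) (hc : starRingEnd ℂ (c * d) = c * d) :
    starRingEnd ℂ c = starRingEnd ℂ d / d * c := by
  have h1 := conj_div_mul_self hd h
  have h2 : starRingEnd ℂ d ≠ 0 := (map_ne_zero _).2 hd
  rw [map_mul] at hc
  field_simp at h1 ⊢
  refine mul_right_cancel₀ h2 ?_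
  linear_combination d * hc - c * h1

theorem ne_zero_of_conj {d : ℂ} (hd : d ≠ 0) : starRingEnd ℂ d / d ≠ 0 :=
  div_ne_zero ((map_ne_zero _).2 hd) hd

namespace Diagram

variable {u v w z : Word}

/-- The coefficient of the mirror image in the adjoint of a diagram. -/
noncomputable def coeff (c d : ℂ) (D : Diagram u v) : ℂ :=
  c ^ D.sharp * (starRingEnd ℂ d / d) ^ D.ell

theorem ell_comp_cast (D : Diagram u v) (E : Diagram v w) :
    ((D.ell + E.ell : ℤ) : ZMod 2) = (((D.comp E).ell + D.loops E : ℤ) : ZMod 2) := by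
  have h := turnAdd D E
  rw [TurnAdd] at h
  push_cast
  rw [ell_eq_turn, ell_eq_turn, ell_eq_turn]
  linear_combination h

theorem starParity_append (u v : Word) :
    starParity (u ++ v) = starParity u + starParity v := by
  rw [← turn_id, ← turn_id, ← turn_id, ← id_tensor_id, turn_tensor]

theorem ell_tensor_cast {u' v' : Word} (D : Diagram u v) (E : Diagram u' v') :
    ((D.tensor E).ell : ZMod 2) = ((D.ell + E.ell : ℤ) : ZMod 2) := by
  push_cast
  rw [ell_eq_turn, ell_eq_turn, ell_eq_turn, turn_tensor, starParity_append]
  ring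

theorem ell_mirror (D : Diagram u v) : D.mirror.ell = D.ell - D.sharp := by
  rw [ell, ell, sharp, mirror_caps, mirror_cups]
  push_cast
  ring

theorem ell_id (u : Word) : (id u).ell = 0 := by
  simp [ell, caps, cups, id]

theorem coeff_ne_zero {c d : ℂ} (hc : c ≠ 0) (hd : d ≠ 0) (D : Diagram u v) :
    D.coeff c d ≠ 0 :=
  mul_ne_zero (zpow_ne_zero _ hc) (zpow_ne_zero _ (ne_zero_of_conj hd))

theorem coeff_id (c d : ℂ) (u : Word) : (id u).coeff c d = 1 := by
  rw [coeff, sharp_id, ell_id, zpow_zero, zpow_zero, one_mul]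

/-- Conjugation turns each loop factor d into (conj d / d) d. The additional signs are exactly the
discrepancy of `ell` modulo 2 under concatenation. -/
theorem coeff_comp {c d : ℂ} (hc : c ≠ 0) (hd : d ≠ 0)
    (h : d = starRingEnd ℂ d ∨ d = -starRingEnd ℂ d) (D : Diagram u v) (E : Diagram v w) :
    starRingEnd ℂ d ^ D.loops E * (D.comp E).coeff c d =
      d ^ D.loops E * (D.coeff c d * E.coeff c d) := by
  have hs := ne_zero_of_conj hd
  have e := zpow_eq_of_cast_eq (conj_div_mul_self hd h) (ell_comp_cast D E)
  rw [zpow_add₀ hs, zpow_add₀ hs, zpow_natCast] at e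
  nth_rewrite 1 [conj_eq_div_mul hd]
  rw [coeff, coeff, coeff, sharp_comp, zpow_add₀ hc, mul_pow]
  linear_combination (-d ^ D.loops E * c ^ D.sharp * c ^ E.sharp) * e

theorem coeff_tensor {c d : ℂ} (hc : c ≠ 0) (hd : d ≠ 0)
    (h : d = starRingEnd ℂ d ∨ d = -starRingEnd ℂ d) {u' v' : Word} (D : Diagram u v)
    (E : Diagram u' v') : (D.tensor E).coeff c d = D.coeff c d * E.coeff c d := by
  have hs := ne_zero_of_conj hd
  rw [coeff, coeff, coeff, sharp_tensor,
    zpow_eq_of_cast_eq (conj_div_mul_self hd h) (ell_tensor_cast D E), zpow_add₀ hc, zpow_add₀ hs]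
  ring

theorem conj_coeff {c d : ℂ} (hd : d ≠ 0)
    (h : d = starRingEnd ℂ d ∨ d = -starRingEnd ℂ d) (hcd : starRingEnd ℂ (c * d) = c * d)
    (D : Diagram u v) : starRingEnd ℂ (D.coeff c d) =
      c ^ D.sharp * (starRingEnd ℂ d / d) ^ D.mirror.ell := by
  have hs := conj_div_mul_self hd h
  have e : (starRingEnd ℂ d / d) ^ (D.sharp + D.ell) = (starRingEnd ℂ d / d) ^ (D.mirror.ell) := by
    refine zpow_eq_of_cast_eq hs ?_
    rw [ell_mirror, sub_eq_add_neg, add_comm, Int.cast_add, Int.cast_add, Int.cast_neg,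
      zmod_two_neg]
  rw [coeff, map_mul, map_zpow₀, map_zpow₀, conj_conj_div hd h, conj_eq_of_conj_mul hd h hcd,
    mul_zpow, ← e, zpow_add₀ (ne_zero_of_conj hd)]
  ring

/-- This is involutivity of the star on diagrams. Conjugating c^♯ produces a sign to the power
`sharp`, which compensates the change of `ell` by `sharp` under reflection; here reality of `c * d`
enters. -/
theorem conj_coeff_mul_mirror {c d : ℂ} (hc : c ≠ 0) (hd : d ≠ 0)
    (h : d = starRingEnd ℂ d ∨ d = -starRingEnd ℂ d) (hcd : starRingEnd ℂ (c * d) = c * d)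
    (D : Diagram u v) : starRingEnd ℂ (D.coeff c d) * D.mirror.coeff c d = 1 := by
  have hs := conj_div_mul_self hd h
  rw [conj_coeff hd h hcd, coeff, sharp_mirror, zpow_neg, mul_mul_mul_comm,
    mul_inv_cancel₀ (zpow_ne_zero _ hc), ← mul_zpow, hs, one_zpow, one_mul]

end Diagram

variable {d : ℂ}

/-- The conjugate linear extension of `D ↦ D.coeff c d • D.mirror`. -/
noncomputable def adjHom (c d : ℂ) (u v : Word) : (Diagram u v →₀ ℂ) →+ (Diagram v u →₀ ℂ) :=
  Finsupp.liftAddHom fun D => (Finsupp.singleAddHom D.mirror).comp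
    ((AddMonoidHom.mulRight (D.coeff c d)).comp (starRingEnd ℂ).toAddMonoidHom)

theorem adjHom_single (c : ℂ) {u v : Word} (D : Diagram u v) (a : ℂ) :
    adjHom c d u v (Finsupp.single D a) =
      Finsupp.single D.mirror (starRingEnd ℂ a * D.coeff c d) := by
  simp [adjHom]

/-- The operation `*` with parameter `c` on morphisms. -/
noncomputable def adjMap (c : ℂ) {x y : OKauffman d} (f : x ⟶ y) : y ⟶ x :=
  adjHom c d x.word y.word f

theorem adjMap_smul_hom (c : ℂ) {u v : Word} (a : ℂ) (D : Diagram u v) :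
    adjMap c (a • D.hom d) = (starRingEnd ℂ a * D.coeff c d) • D.mirror.hom d := by
  change adjHom c d u v (a • Finsupp.single D 1) = (starRingEnd ℂ a * D.coeff c d) •
    (Finsupp.single D.mirror 1 : Diagram v u →₀ ℂ)
  rw [Finsupp.smul_single, Finsupp.smul_single, adjHom_single, smul_eq_mul, smul_eq_mul, mul_one,
    mul_one]

theorem adjMap_hom (c : ℂ) {u v : Word} (D : Diagram u v) :
    adjMap c (D.hom d) = D.coeff c d • D.mirror.hom d := by
  have := adjMap_smul_hom (d := d) c 1 D
  rwa [one_smul, map_one, one_mul] at this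

theorem adjMap_zero (c : ℂ) (x y : OKauffman d) : adjMap c (0 : x ⟶ y) = 0 :=
  map_zero (adjHom c d x.word y.word)

theorem adjMap_add (c : ℂ) {x y : OKauffman d} (f g : x ⟶ y) :
    adjMap c (f + g) = adjMap c f + adjMap c g :=
  map_add (adjHom c d x.word y.word) f g

theorem adjMap_smul (c : ℂ) {x y : OKauffman d} (a : ℂ) (f : x ⟶ y) :
    adjMap c (a • f) = starRingEnd ℂ a • adjMap c f := by
  induction f using hom_induction with
  | zero => rw [smul_zero, adjMap_zero, smul_zero]
  | add f g hf hg => rw [smul_add, adjMap_add, hf, hg, adjMap_add, smul_add]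
  | smul b D =>
    rw [smul_smul, adjMap_smul_hom, adjMap_smul_hom, smul_smul, map_mul, mul_assoc]

theorem adjMap_eqToHom (c : ℂ) {x y : OKauffman d} (h : x = y) :
    adjMap c (eqToHom h) = eqToHom h.symm := by
  subst h
  rw [eqToHom_refl, id_eq_hom]
  refine (adjMap_hom c (Diagram.id x.word)).trans ?_
  rw [Diagram.coeff_id, one_smul, Diagram.mirror_id]

theorem adjMap_comp {c : ℂ} (hc : c ≠ 0) (hd : d ≠ 0)
    (h : d = starRingEnd ℂ d ∨ d = -starRingEnd ℂ d) {x y z : OKauffman d} (f : x ⟶ y)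
    (g : y ⟶ z) : adjMap c (f ≫ g) = adjMap c g ≫ adjMap c f := by
  induction f using hom_induction with
  | zero => simp only [Limits.zero_comp, adjMap_zero, Limits.comp_zero]
  | add f f' hf hf' => rw [Preadditive.add_comp, adjMap_add, adjMap_add, Preadditive.comp_add, hf, hf']
  | smul a D =>
  induction g using hom_induction with
  | zero => simp only [Limits.zero_comp, adjMap_zero, Limits.comp_zero]
  | add f f' hf hf' => rw [Preadditive.comp_add, adjMap_add, adjMap_add, Preadditive.add_comp, hf, hf']
  | smul b E =>
  simp only [Linear.smul_comp, Linear.comp_smul, adjMap_smul]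
  rw [smul_comm]
  congr 2
  have e₁ : D.hom d ≫ E.hom d = d ^ D.loops E • (D.comp E).hom d := hom_comp_hom D E
  have e₂ : adjMap c (E.hom d) ≫ adjMap c (D.hom d) = (E.coeff c d * D.coeff c d) •
      d ^ D.loops E • (D.comp E).mirror.hom d := by
    rw [adjMap_hom, adjMap_hom]
    refine (Linear.smul_comp ..).trans ?_
    rw [Linear.comp_smul, smul_smul, hom_comp_hom, Diagram.mirror_loops, Diagram.mirror_comp]
  refine (congrArg (adjMap c) e₁).trans (Eq.trans ?_ e₂.symm)
  rw [adjMap_smul, adjMap_hom, smul_smul, smul_smul, map_pow, Diagram.coeff_comp hc hd h]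
  congr 1
  ring

theorem adjMap_tensor {c : ℂ} (hc : c ≠ 0) (hd : d ≠ 0)
    (h : d = starRingEnd ℂ d ∨ d = -starRingEnd ℂ d) {x y x' y' : OKauffman d} (f : x ⟶ y)
    (g : x' ⟶ y') : adjMap c (f ⊗ₘ g) = adjMap c f ⊗ₘ adjMap c g := by
  induction f using hom_induction with
  | zero => simp only [zero_tensor, adjMap_zero]
  | add f f' hf hf' => rw [add_tensor, adjMap_add, adjMap_add, add_tensor, hf, hf']
  | smul a D =>
  induction g using hom_induction with
  | zero => simp only [tensor_zero, adjMap_zero]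
  | add f f' hf hf' => rw [tensor_add, adjMap_add, adjMap_add, tensor_add, hf, hf']
  | smul b E =>
  simp only [smul_tensor, tensor_smul, adjMap_smul]
  congr 2
  refine (congrArg (adjMap c) (hom_tensor_hom D E)).trans ?_
  refine (adjMap_hom c (D.tensor E)).trans ?_
  have e₁ : adjMap c (D.hom d) ⊗ₘ adjMap c (E.hom d) = (D.coeff c d * E.coeff c d) •
      (D.mirror.tensor E.mirror).hom d := by
    rw [adjMap_hom, adjMap_hom, smul_tensor, tensor_smul, hom_tensor_hom, smul_smul]
  refine Eq.trans ?_ e₁.symm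
  rw [Diagram.coeff_tensor hc hd h, Diagram.mirror_tensor]

theorem adjMap_adjMap {c : ℂ} (hc : c ≠ 0) (hd : d ≠ 0)
    (h : d = starRingEnd ℂ d ∨ d = -starRingEnd ℂ d) (hcd : starRingEnd ℂ (c * d) = c * d)
    {x y : OKauffman d} (f : x ⟶ y) : adjMap c (adjMap c f) = f := by
  induction f using hom_induction with
  | zero => rw [adjMap_zero, adjMap_zero]
  | add f f' hf hf' => rw [adjMap_add, adjMap_add, hf, hf']
  | smul a D =>
  rw [adjMap_smul, adjMap_smul, Complex.conj_conj]
  congr 1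
  have e : adjMap c (adjMap c (D.hom d)) = D.hom d := by
    rw [adjMap_hom, adjMap_smul, adjMap_hom, smul_smul,
      Diagram.conj_coeff_mul_mirror hc hd h hcd, one_smul, Diagram.mirror_mirror]
  exact e

/-- The compatible *-structure with parameter `c`. -/
noncomputable def starOf (c : ℂ) (hc : c ≠ 0) (hd : d ≠ 0)
    (h : d = starRingEnd ℂ d ∨ d = -starRingEnd ℂ d) (hcd : starRingEnd ℂ (c * d) = c * d) :
    CompatibleStar (OKauffman d) where
  adj f := adjMap c f
  adj_add := adjMap_add c
  adj_smul := adjMap_smul c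
  adj_comp := adjMap_comp hc hd h
  adj_adj := adjMap_adjMap hc hd h hcd
  adj_tensor := adjMap_tensor hc hd h
  adj_associator x y z := adjMap_eqToHom c (congrArg OKauffman.mk (List.append_assoc x.word y.word z.word))
  adj_leftUnitor x := adjMap_eqToHom c (congrArg OKauffman.mk (List.nil_append x.word))
  adj_rightUnitor x := adjMap_eqToHom c (congrArg OKauffman.mk (List.append_nil x.word))

end OrientedKauffman

/-! ### Uniqueness: a *-structure is determined by its value on one arc. -/

namespace CompatibleStar

variable {C : Type u} [Category.{v} C] [Preadditive C] [Linear ℂ C] [MonoidalCategory C]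
  (S : CompatibleStar C)

theorem adj_zero (x y : C) : S.adj (0 : x ⟶ y) = 0 := by
  have := S.adj_smul (0 : ℂ) (0 : x ⟶ y)
  rwa [zero_smul, map_zero, zero_smul] at this

theorem adj_id (x : C) : S.adj (𝟙 x) = 𝟙 x := by
  have h := S.adj_comp (S.adj (𝟙 x)) (𝟙 x)
  rw [Category.comp_id, S.adj_adj, Category.comp_id] at h
  exact h.symm

theorem adj_eqToHom {x y : C} (h : x = y) : S.adj (eqToHom h) = eqToHom h.symm := by
  subst h
  exact S.adj_id x

end CompatibleStar

namespace OrientedKauffman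

variable {d : ℂ} {u v w : Word}

theorem smul_hom_injective (D : Diagram u v) {a b : ℂ} (h : a • D.hom d = b • D.hom d) :
    a = b := by
  have e : ∀ a : ℂ, a • D.hom d = (Finsupp.single D a : Diagram u v →₀ ℂ) := by
    intro a
    change a • (Finsupp.single D 1 : Diagram u v →₀ ℂ) = _
    rw [Finsupp.smul_single, smul_eq_mul, mul_one]
  rw [e, e] at h
  exact Finsupp.single_injective D h

/-- With a single diagram of the given type, the morphism space is one-dimensional. This holds for
arcs, their reflections, single letters and the empty word. -/
theorem exists_eq_smul_hom [Subsingleton (Diagram u v)] (D : Diagram u v)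
    (f : (OKauffman.mk u : OKauffman d) ⟶ OKauffman.mk v) : ∃ a : ℂ, f = a • D.hom d := by
  induction f using hom_induction with
  | zero => exact ⟨0, (zero_smul _ _).symm⟩
  | add f g hf hg =>
    obtain ⟨a, rfl⟩ := hf
    obtain ⟨b, rfl⟩ := hg
    exact ⟨a + b, (add_smul _ _ _).symm⟩
  | smul a E => exact ⟨a, by rw [Subsingleton.elim D E]⟩

namespace Diagram

instance (a : Letter) : Subsingleton (Diagram [a, a.dual] []) := by
  have key : ∀ D : Diagram [a, a.dual] [], D = arc a := by
    intro D
    refine ext_partner ?_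
    rintro (p | p)
    · rcases hq : D.partner (Sum.inl p) with q | q
      · have hne : q ≠ p := fun e => D.partner_ne _ (hq.trans (congrArg Sum.inl e))
        refine congrArg Sum.inl (Fin.ext ?_)
        have h1 : (p : ℕ) < 2 := p.2
        have h2 : (q : ℕ) < 2 := q.2
        have h3 := Fin.val_ne_of_ne hne
        change (q : ℕ) = 2 - (p + 1)
        omega
      · exact q.elim0
    · exact p.elim0
  exact ⟨fun D E => (key D).trans (key E).symm⟩

instance [Subsingleton (Diagram u v)] : Subsingleton (Diagram v u) :=
  ⟨fun _ _ => mirror_injective (Subsingleton.elim _ _)⟩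

instance (a : Letter) : Subsingleton (Diagram [a] [a]) := by
  have key : ∀ D : Diagram [a] [a], D = id [a] := by
    intro D
    refine D.eq_id_of_through fun i => ?_
    rcases hq : D.partner (Sum.inl i) with q | q
    · refine absurd hq ?_
      have : q = i := Fin.ext (by have h1 : (q : ℕ) < 1 := q.2; have h2 : (i : ℕ) < 1 := i.2; omega)
      rw [this]
      exact D.partner_ne _
    · exact ⟨q, rfl⟩
  exact ⟨fun D E => (key D).trans (key E).symm⟩

instance : Subsingleton (Diagram [] []) :=
  ⟨fun _ _ => ext_partner (by rintro (p | p) <;> exact p.elim0)⟩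

theorem sharp_arc (a : Letter) : (arc a).sharp = 1 := by
  have := (arc a).two_mul_sharp
  simp only [List.length_cons, List.length_nil] at this
  omega

theorem ell_arc_X : (arc Letter.X).ell = 0 := by decide

theorem ell_arc_Xstar : (arc Letter.Xstar).ell = 1 := by decide

theorem coeff_arc_X (c d : ℂ) : (arc Letter.X).coeff c d = c := by
  rw [coeff, sharp_arc, ell_arc_X, zpow_one, zpow_zero, mul_one]

theorem coeff_arc_Xstar (c d : ℂ) :
    (arc Letter.Xstar).coeff c d = c * (starRingEnd ℂ d / d) := by
  rw [coeff, sharp_arc, ell_arc_Xstar, zpow_one, zpow_one]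

end Diagram

open Diagram

theorem arc_loop (a : Letter) : (arc a).mirror.hom d ≫ (arc a).hom d = d • (Diagram.id []).hom d := by
  have h : (arc a).mirror.loops (arc a) = 1 := by
    -- An arc is a layer without vertical strings, so the loop count for layers applies.
    have e : arc a = capLayer [] a [] := Subsingleton.elim _ _
    have h := comp_capLayer_loops_one (v₁ := []) (a := a) (v₂ := []) (D := (arc a).mirror) rfl
    rw [← e] at h
    exact h
  rw [hom_comp_hom, h, pow_one, Subsingleton.elim ((arc a).mirror.comp (arc a)) (Diagram.id [])]

theorem capLayer_hom (v₁ : Word) (a : Letter) (v₂ : Word) : (capLayer v₁ a v₂).hom d =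
    (𝟙 (OKauffman.mk v₁ : OKauffman d) ⊗ₘ ((arc a).hom d ⊗ₘ 𝟙 (OKauffman.mk v₂ : OKauffman d)) :
      (OKauffman.mk v₁ : OKauffman d) ⊗ (OKauffman.mk [a, a.dual] ⊗ OKauffman.mk v₂) ⟶
      OKauffman.mk v₁ ⊗ (OKauffman.mk [] ⊗ OKauffman.mk v₂)) := by
  rw [id_eq_hom, id_eq_hom, hom_tensor_hom]
  exact (hom_tensor_hom _ _).symm

theorem capLayer_mirror_hom (v₁ : Word) (a : Letter) (v₂ : Word) : (capLayer v₁ a v₂).mirror.hom d =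
    (𝟙 (OKauffman.mk v₁ : OKauffman d) ⊗ₘ
      ((arc a).mirror.hom d ⊗ₘ 𝟙 (OKauffman.mk v₂ : OKauffman d)) :
      (OKauffman.mk v₁ : OKauffman d) ⊗ (OKauffman.mk [] ⊗ OKauffman.mk v₂) ⟶
      OKauffman.mk v₁ ⊗ (OKauffman.mk [a, a.dual] ⊗ OKauffman.mk v₂)) := by
  rw [id_eq_hom, id_eq_hom, hom_tensor_hom]
  refine Eq.trans ?_ (hom_tensor_hom _ _).symm
  have e : (capLayer v₁ a v₂).mirror = (Diagram.id v₁).tensor ((arc a).mirror.tensor (Diagram.id v₂)) := by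
    refine (mirror_tensor _ _).trans ?_
    rw [mirror_id]
    exact congrArg _ ((mirror_tensor _ _).trans (by rw [mirror_id]))
  exact congrArg (fun D => Diagram.hom d D) e

variable (S : CompatibleStar (OKauffman d))

theorem adj_capLayer {a : Letter} {k : ℂ} (h : S.adj ((arc a).hom d) = k • (arc a).mirror.hom d)
    (v₁ v₂ : Word) :
    S.adj ((capLayer v₁ a v₂).hom d) = k • (capLayer v₁ a v₂).mirror.hom d := by
  rw [capLayer_mirror_hom, capLayer_hom]
  refine (S.adj_tensor _ _).trans ?_
  rw [S.adj_tensor, S.adj_id, S.adj_id, h, smul_tensor, tensor_smul]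

theorem adj_mirror {D : Diagram u v} {k : ℂ} (hk : k ≠ 0)
    (h : S.adj (D.hom d) = k • D.mirror.hom d) :
    S.adj (D.mirror.hom d) = (starRingEnd ℂ k)⁻¹ • D.hom d := by
  have h' := congrArg S.adj h
  rw [S.adj_adj, S.adj_smul] at h'
  rw [h', smul_smul, inv_mul_cancel₀ ((map_ne_zero _).2 hk), one_smul]

/-- Agreement spreads from arcs to layers by the tensor rule, through compositions, and to
reflections. For the last point `hT` is needed: the star of `D.mirror` can be recovered from that of
`D` by involutivity when the latter is a nonzero multiple of `D.mirror`. -/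
theorem star_ext (S T : CompatibleStar (OKauffman d))
    (hT : ∀ (u v : Word) (D : Diagram u v), ∃ k : ℂ, k ≠ 0 ∧ T.adj (D.hom d) = k • D.mirror.hom d)
    (h : ∀ a, S.adj ((arc a).hom d) = T.adj ((arc a).hom d)) : S = T := by
  have key : ∀ {u v : Word} (D : Diagram u v), S.adj (D.hom d) = T.adj (D.hom d) := by
    intro u v D
    induction D using capLayer_mirror_induction with
    | id u => exact (S.adj_id (OKauffman.mk u)).trans (T.adj_id _).symm
    | cap v₁ a v₂ w D ih =>
      have e : (capLayer v₁ a v₂).hom d ≫ D.hom d = ((capLayer v₁ a v₂).comp D).hom d := by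
        rw [hom_comp_hom, capLayer_loops, pow_zero, one_smul]
      obtain ⟨k, -, hk⟩ := hT _ _ (arc a)
      rw [← e, S.adj_comp, T.adj_comp, ih, adj_capLayer T hk, adj_capLayer S ((h a).trans hk)]
    | mirror u v D ih =>
      obtain ⟨k, hk0, hk⟩ := hT _ _ D
      rw [adj_mirror T hk0 hk, adj_mirror S hk0 (ih.trans hk)]
  ext x y f
  induction f using hom_induction with
  | zero => rw [S.adj_zero, T.adj_zero]
  | add f g hf hg => rw [S.adj_add, T.adj_add, hf, hg]
  | smul a D =>
    rw [S.adj_smul, T.adj_smul]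
    congr 1
    exact key D

/-- The number `k` with `S.adj ε = k • δ` for the arc `ε` with left end `a`. -/
theorem exists_adj_arc (a : Letter) :
    ∃ k : ℂ, k ≠ 0 ∧ S.adj ((arc a).hom d) = k • (arc a).mirror.hom d ∧
      k * d = starRingEnd ℂ (k * d) := by
  obtain ⟨k, hk⟩ := exists_eq_smul_hom (d := d) (arc a).mirror (S.adj ((arc a).hom d))
  -- Were the scalar zero, involutivity would make the arc itself zero.
  have hk0 : k ≠ 0 := by
    rintro rfl
    rw [zero_smul] at hk
    have h := congrArg S.adj hk
    rw [S.adj_adj, S.adj_zero] at h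
    refine zero_ne_one (smul_hom_injective (d := d) (arc a) ?_)
    rw [h, smul_zero, smul_zero]
  refine ⟨k, hk0, hk, ?_⟩
  -- The star of the loop relation: the left side acquires the factor k / conj k, the right side
  -- becomes conj d.
  have h := congrArg S.adj (arc_loop (d := d) a)
  have hid : S.adj ((Diagram.id []).hom d) = (Diagram.id []).hom d := S.adj_id (OKauffman.mk [])
  rw [S.adj_comp, hk, adj_mirror S hk0 hk, S.adj_smul, hid, Linear.smul_comp, Linear.comp_smul,
    arc_loop, smul_smul, smul_smul] at h
  have h' := smul_hom_injective _ h
  have hk1 : starRingEnd ℂ k ≠ 0 := (map_ne_zero _).2 hk0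
  rw [map_mul, ← h']
  field_simp

/-- The upper half of a zigzag. -/
def zigzagUpper : Diagram [Letter.X] [Letter.X, Letter.Xstar, Letter.X] :=
  (arc Letter.X).mirror.tensor (Diagram.id [Letter.X])

/-- The lower half of a zigzag. -/
def zigzagLower : Diagram [Letter.X, Letter.Xstar, Letter.X] [Letter.X] :=
  capLayer [Letter.X] Letter.Xstar []

theorem zigzag_loops : zigzagUpper.loops zigzagLower = 0 :=
  comp_capLayer_loops_zero (v₁ := [Letter.X]) (a := Letter.Xstar) (v₂ := []) (D := zigzagUpper)
    (by decide)

theorem zigzag : zigzagUpper.hom d ≫ zigzagLower.hom d = (Diagram.id [Letter.X]).hom d := by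
  rw [hom_comp_hom, zigzag_loops, pow_zero, one_smul,
    -- Straightening the zigzag needs no tracing of strings, as there is only one diagram from X to
    -- X.
    Subsingleton.elim (zigzagUpper.comp zigzagLower) (Diagram.id [Letter.X])]

theorem zigzag_mirror : zigzagLower.mirror.hom d ≫ zigzagUpper.mirror.hom d =
    (Diagram.id [Letter.X]).hom d := by
  rw [hom_comp_hom, mirror_loops, zigzag_loops, pow_zero, one_smul, Subsingleton.elim
    (zigzagLower.mirror.comp zigzagUpper.mirror) (Diagram.id [Letter.X])]

theorem adj_tensor_id {D : Diagram u v} {k : ℂ} (h : S.adj (D.hom d) = k • D.mirror.hom d)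
    (w : Word) : S.adj ((D.tensor (Diagram.id w)).hom d) =
      k • (D.tensor (Diagram.id w)).mirror.hom d := by
  have hid : S.adj ((Diagram.id w).hom d) = (Diagram.id w).hom d := S.adj_id (OKauffman.mk w)
  rw [mirror_tensor, mirror_id, ← hom_tensor_hom, ← hom_tensor_hom]
  refine (S.adj_tensor _ _).trans ?_
  rw [h, hid, smul_tensor]

/-- The zigzag uses one reflected arc of the first kind and one arc of the second kind. Under the
star they contribute (conj k)⁻¹ and l, while the zigzag and its reflection are both the identity. -/
theorem adj_arc_Xstar {k l : ℂ} (hk0 : k ≠ 0)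
    (hk : S.adj ((arc Letter.X).hom d) = k • (arc Letter.X).mirror.hom d)
    (hl : S.adj ((arc Letter.Xstar).hom d) = l • (arc Letter.Xstar).mirror.hom d) :
    l = starRingEnd ℂ k := by
  have hk1 : starRingEnd ℂ k ≠ 0 := (map_ne_zero _).2 hk0
  have h := congrArg S.adj (zigzag (d := d))
  have hid : S.adj ((Diagram.id [Letter.X]).hom d) = (Diagram.id [Letter.X]).hom d :=
    S.adj_id (OKauffman.mk [Letter.X])
  have h1 : S.adj (zigzagUpper.hom d) = (starRingEnd ℂ k)⁻¹ • zigzagUpper.mirror.hom d := by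
    refine adj_tensor_id S ?_ [Letter.X]
    rw [mirror_mirror, adj_mirror S hk0 hk]
  have h2 : S.adj (zigzagLower.hom d) = l • zigzagLower.mirror.hom d :=
    adj_capLayer S hl [Letter.X] []
  have h3 : S.adj (zigzagUpper.hom d ≫ zigzagLower.hom d) =
      (l * (starRingEnd ℂ k)⁻¹) • (Diagram.id [Letter.X]).hom d := by
    rw [S.adj_comp, h2, h1, Linear.smul_comp, Linear.comp_smul, smul_smul, zigzag_mirror]
  have h4 : (l * (starRingEnd ℂ k)⁻¹) • (Diagram.id [Letter.X]).hom d =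
      (1 : ℂ) • (Diagram.id [Letter.X]).hom d := by
    rw [one_smul, ← h3]
    exact h.trans hid
  have h5 := smul_hom_injective _ h4
  rwa [mul_inv_eq_one₀ hk1] at h5

/-- Both k d and (conj k) d are real; so is their product |k|² d², and |k|² can be cancelled. -/
theorem eq_conj_of_star (S : CompatibleStar (OKauffman d)) : d = starRingEnd ℂ d ∨ d = -starRingEnd ℂ d := by
  obtain ⟨k, hk0, hk, hkd⟩ := exists_adj_arc S Letter.X
  obtain ⟨l, hl0, hl, hld⟩ := exists_adj_arc S Letter.Xstar
  obtain rfl := adj_arc_Xstar S hk0 hk hl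
  rw [map_mul] at hkd hld
  rw [Complex.conj_conj] at hld
  have hk1 : starRingEnd ℂ k ≠ 0 := (map_ne_zero _).2 hk0
  have h : d * d = starRingEnd ℂ d * starRingEnd ℂ d := by
    refine mul_left_cancel₀ (mul_ne_zero hk0 hk1) ?_
    linear_combination (starRingEnd ℂ k * d) * hkd + (starRingEnd ℂ k * starRingEnd ℂ d) * hld
  exact mul_self_eq_mul_self_iff.1 h

theorem exists_starOf_eq (hd : d ≠ 0) (h : d = starRingEnd ℂ d ∨ d = -starRingEnd ℂ d) :
    ∃ c hc hcd, starOf c hc hd h hcd = S := by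
  obtain ⟨c, hc, hk, hcd⟩ := exists_adj_arc S Letter.X
  obtain ⟨l, -, hl, -⟩ := exists_adj_arc S Letter.Xstar
  obtain rfl := adj_arc_Xstar S hc hk hl
  refine ⟨c, hc, hcd.symm, (star_ext _ _ (fun u v D => ⟨_, coeff_ne_zero hc hd D, adjMap_hom c D⟩)
    fun a => ?_).symm⟩
  refine Eq.trans ?_ (adjMap_hom c (arc a)).symm
  cases a
  · rw [coeff_arc_X, hk]
  · rw [coeff_arc_Xstar, hl, conj_eq_of_conj_mul hd h hcd.symm, mul_comm]

theorem starOf_injective {c c' : ℂ} (hd : d ≠ 0) (h : d = starRingEnd ℂ d ∨ d = -starRingEnd ℂ d)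
    {hc hcd hc' hcd'} (e : starOf c hc hd h hcd = starOf c' hc' hd h hcd') : c = c' := by
  have h1 : adjMap c ((arc Letter.X).hom d) = adjMap c' ((arc Letter.X).hom d) :=
    congrArg (fun S : CompatibleStar (OKauffman d) => S.adj ((arc Letter.X).hom d)) e
  rw [adjMap_hom, adjMap_hom] at h1
  have := smul_hom_injective _ h1
  rwa [coeff_arc_X, coeff_arc_X] at this

end OrientedKauffman

/-! ### Equivalences by scaling. -/

theorem CompatibleStar.Equivalent.trans {C : Type u} [Category.{v} C] [Preadditive C] [Linear ℂ C]
    [MonoidalCategory C] {S T U : CompatibleStar C} (h₁ : S.Equivalent T) (h₂ : T.Equivalent U) :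
    S.Equivalent U := by
  obtain ⟨F, hFa, hFl, hFm, hFe, hF, hFε, hFμ⟩ := h₁
  obtain ⟨G, hGa, hGl, hGm, hGe, hG, hGε, hGμ⟩ := h₂
  refine ⟨F ⋙ G, inferInstance, inferInstance, inferInstance, inferInstance, fun f => ?_, ?_,
    fun x y => ?_⟩
  · rw [Functor.comp_map, hF, hG, Functor.comp_map]
  · rw [Functor.LaxMonoidal.comp_ε, Functor.OplaxMonoidal.comp_η, U.adj_comp, ← hG, hFε, hGε]
  · rw [Functor.LaxMonoidal.comp_μ, Functor.OplaxMonoidal.comp_δ, U.adj_comp, ← hG, hFμ, hGμ]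

namespace OrientedKauffman

variable {d : ℂ} {u v w : Word}

section Scaling

/-- The difference of the lengths of source and target. -/
def lengthDiff (x y : OKauffman d) : ℤ := x.word.length - y.word.length

theorem lengthDiff_self (x : OKauffman d) : lengthDiff x x = 0 := sub_self _

theorem lengthDiff_add (x y z : OKauffman d) :
    lengthDiff x y + lengthDiff y z = lengthDiff x z := by
  simp only [lengthDiff]
  ring

theorem lengthDiff_tensor (x y x' y' : OKauffman d) :
    lengthDiff (x ⊗ x') (y ⊗ y') = lengthDiff x y + lengthDiff x' y' := by
  change ((x.word ++ x'.word).length : ℤ) - ((y.word ++ y'.word).length : ℤ) = _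
  rw [List.length_append, List.length_append, lengthDiff, lengthDiff]
  push_cast
  ring

/-- The functor that multiplies each morphism by a power of `b`, the exponent being the difference
of the lengths of source and target. -/
noncomputable def scaling (d : ℂ) (b : ℂ) (hb : b ≠ 0) : OKauffman d ⥤ OKauffman d where
  obj x := x
  map {x y} f := b ^ lengthDiff x y • f
  map_id x := by rw [lengthDiff_self, zpow_zero, one_smul]
  map_comp {x y z} f g := by
    rw [Linear.smul_comp, Linear.comp_smul, smul_smul, ← zpow_add₀ hb, lengthDiff_add]

variable (b : ℂ) (hb : b ≠ 0)

theorem scaling_map {x y : OKauffman d} (f : x ⟶ y) :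
    (scaling d b hb).map f = b ^ lengthDiff x y • f := rfl

/-- Associators and unitors join equal words and are therefore not rescaled, so identities can serve
as the structure isomorphisms of the scaling functor. -/
theorem scaling_map_of_eq {x y : OKauffman d} (h : x = y) (f : x ⟶ y) :
    (scaling d b hb).map f = f := by
  subst h
  rw [scaling_map, lengthDiff_self, zpow_zero, one_smul]

instance : (scaling d b hb).Additive where
  map_add := smul_add _ _ _

instance : (scaling d b hb).Linear ℂ where
  map_smul f r := smul_comm _ r f

instance : (scaling d b hb).Faithful where
  map_injective {x y _ _} h :=
    smul_right_injective (x ⟶ y) (zpow_ne_zero (lengthDiff x y) hb) h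

instance : (scaling d b hb).Full where
  map_surjective {x y} f := ⟨(b ^ lengthDiff x y)⁻¹ • f, by
    change b ^ lengthDiff x y • ((b ^ lengthDiff x y)⁻¹ • f) = f
    rw [smul_smul, mul_inv_cancel₀ (zpow_ne_zero _ hb), one_smul]⟩

instance : (scaling d b hb).EssSurj where
  mem_essImage y := ⟨y, ⟨Iso.refl y⟩⟩

instance : (scaling d b hb).IsEquivalence where

/-- The scaling functor is strict monoidal. -/
noncomputable def scalingCore : (scaling d b hb).CoreMonoidal where
  εIso := Iso.refl _
  μIso _ _ := Iso.refl _
  μIso_hom_natural_left {x y} f z := by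
    refine (Category.comp_id _).trans (Eq.trans ?_ (Category.id_comp _).symm)
    rw [scaling_map, scaling_map, lengthDiff_tensor, lengthDiff_self, add_zero]
    exact MonoidalLinear.smul_whiskerRight _ _ _
  μIso_hom_natural_right {x y} z f := by
    refine (Category.comp_id _).trans (Eq.trans ?_ (Category.id_comp _).symm)
    rw [scaling_map, scaling_map, lengthDiff_tensor, lengthDiff_self, zero_add]
    exact MonoidalLinear.whiskerLeft_smul _ _ _
  associativity x y z := by
    change (𝟙 (x ⊗ y)) ▷ z ≫ 𝟙 ((x ⊗ y) ⊗ z) ≫ (scaling d b hb).map (α_ x y z).hom =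
      (α_ x y z).hom ≫ x ◁ 𝟙 (y ⊗ z) ≫ 𝟙 (x ⊗ (y ⊗ z))
    rw [scaling_map_of_eq b hb (congrArg OKauffman.mk (List.append_assoc _ _ _)),
      MonoidalCategory.id_whiskerRight, MonoidalCategory.whiskerLeft_id, Category.id_comp]
    exact (Category.id_comp _).trans ((Category.comp_id _).symm.trans
      (congrArg (_ ≫ ·) (Category.comp_id _).symm))
  left_unitality x := by
    change (λ_ x).hom = (𝟙 (𝟙_ (OKauffman d))) ▷ x ≫ 𝟙 (𝟙_ (OKauffman d) ⊗ x) ≫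
      (scaling d b hb).map (λ_ x).hom
    rw [scaling_map_of_eq b hb (congrArg OKauffman.mk (List.nil_append _)),
      MonoidalCategory.id_whiskerRight, Category.id_comp]
    exact (Category.id_comp _).symm
  right_unitality x := by
    change (ρ_ x).hom = x ◁ 𝟙 (𝟙_ (OKauffman d)) ≫ 𝟙 (x ⊗ 𝟙_ (OKauffman d)) ≫
      (scaling d b hb).map (ρ_ x).hom
    rw [scaling_map_of_eq b hb (congrArg OKauffman.mk (List.append_nil _)),
      MonoidalCategory.whiskerLeft_id, Category.id_comp]
    exact (Category.id_comp _).symm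

theorem lengthDiff_eq_sharp (D : Diagram u v) :
    lengthDiff (OKauffman.mk u : OKauffman d) (OKauffman.mk v) = 2 * D.sharp :=
  D.two_mul_sharp.symm

/-- A diagram is scaled by b^(2♯) and its reflection by b^(-2♯). Intertwining the two stars thus
requires c^♯ = b^(4♯) c'^♯; that `b` is real ensures that conjugation does not affect the scaling.
-/
theorem scaling_adjMap {b : ℝ} (hb : (b : ℂ) ≠ 0) {c c' : ℂ} (h : c = (b : ℂ) ^ 4 * c')
    {x y : OKauffman d} (f : x ⟶ y) : (scaling d b hb).map (adjMap c f) =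
      adjMap c' ((scaling d b hb).map f) := by
  induction f using hom_induction with
  | zero => rw [adjMap_zero, Functor.map_zero, Functor.map_zero, adjMap_zero]
  | add f g hf hg => rw [adjMap_add, Functor.map_add, Functor.map_add, adjMap_add, hf, hg]
  | smul a D =>
    rw [adjMap_smul, Functor.map_smul, Functor.map_smul, adjMap_smul]
    congr 1
    have e : (b : ℂ) ^ (2 * -D.sharp) • adjMap c (D.hom d) =
        adjMap c' ((b : ℂ) ^ (2 * D.sharp) • D.hom d) := by
      rw [adjMap_hom, adjMap_smul, adjMap_hom, smul_smul, smul_smul, map_zpow₀,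
        Complex.conj_ofReal, Diagram.coeff, Diagram.coeff, h, mul_zpow]
      congr 1
      have e₁ : ((b : ℂ) ^ 4) ^ D.sharp * (b : ℂ) ^ (2 * -D.sharp) = (b : ℂ) ^ (2 * D.sharp) := by
        rw [← zpow_natCast, ← zpow_mul, ← zpow_add₀ hb]
        congr 1
        push_cast
        ring
      linear_combination (c' ^ D.sharp * (starRingEnd ℂ d / d) ^ D.ell) * e₁
    rw [← D.sharp_mirror, ← lengthDiff_eq_sharp D.mirror, ← lengthDiff_eq_sharp D] at e
    exact e

theorem equivalent_of_scaling {c c' : ℂ} (hd : d ≠ 0)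
    (h : d = starRingEnd ℂ d ∨ d = -starRingEnd ℂ d) {hc hcd hc' hcd'} {l : ℝ} (hl : 0 < l)
    (e : c = l * c') : (starOf c hc hd h hcd).Equivalent (starOf c' hc' hd h hcd') := by
  -- A fourth root of the given positive factor, as `scaling_adjMap` demands.
  let b := √√l
  have hb : (b : ℂ) ≠ 0 :=
    Complex.ofReal_ne_zero.2 (Real.sqrt_pos.2 (Real.sqrt_pos.2 hl)).ne'
  have hb4 : b ^ 4 = l := by
    have : b ^ 4 = (b ^ 2) ^ 2 := by ring
    rw [this, Real.sq_sqrt (Real.sqrt_nonneg _), Real.sq_sqrt hl.le]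
  have h' : c = (b : ℂ) ^ 4 * c' := by rw [e, ← hb4]; push_cast; rfl
  refine ⟨scaling d b hb, inferInstance, inferInstance, (scalingCore b hb).toMonoidal,
    inferInstance, fun f => scaling_adjMap hb h' f, ?_, fun x y => ?_⟩
  · exact (starOf c' hc' hd h hcd').adj_id _
  · exact (starOf c' hc' hd h hcd').adj_id _

end Scaling
end OrientedKauffman

/-! ### Equivalence by reversal of orientations. -/

namespace OrientedKauffman

variable {d : ℂ} {u v w : Word}

/-- The word with the two letters interchanged. -/
abbrev Word.dual (u : Word) : Word := u.map Letter.dual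

theorem Word.dual_dual (u : Word) : Word.dual (Word.dual u) = u := by
  simp [Word.dual, Function.comp_def]

/-- The letters of `u.dual` and of `u` are in the same places. -/
def finDual (u : Word) : Fin (Word.dual u).length ≃ Fin u.length := finCongr (List.length_map _)

/-- The terminal points of a diagram and of its orientation reversal. -/
def ptDual (u v : Word) : Pt (Word.dual u) (Word.dual v) ≃ Pt u v :=
  Equiv.sumCongr (finDual u) (finDual v)

theorem get_dual (u : Word) (i : Fin (Word.dual u).length) :
    (Word.dual u).get i = (u.get (finDual u i)).dual := by
  simp [finDual]

theorem orient_ptDual (p : Pt (Word.dual u) (Word.dual v)) :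
    orient u v (ptDual u v p) = - orient (Word.dual u) (Word.dual v) p := by
  rcases p with p | p
  · change (u.get (finDual u p)).sign = -((Word.dual u).get p).sign
    rw [get_dual, Letter.sign_dual, neg_neg]
  · change -(v.get (finDual v p)).sign = - -((Word.dual v).get p).sign
    rw [get_dual, Letter.sign_dual, neg_neg]

theorem pos_ptDual (p : Pt (Word.dual u) (Word.dual v)) : pos (ptDual u v p) = pos p := by
  rcases p with p | p
  · rfl
  · have h₁ := List.length_map (as := u) Letter.dual
    have h₂ := List.length_map (as := v) Letter.dual
    have key : ∀ k : ℕ, u.length + (v.length - (k + 1)) =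
        (Word.dual u).length + ((Word.dual v).length - (k + 1)) := fun k => by rw [h₁, h₂]
    change u.length + ((finDual v p).rev : ℕ) = (Word.dual u).length + (p.rev : ℕ)
    rw [Fin.val_rev, Fin.val_rev]
    exact key p

namespace Diagram

/-- The diagram with all orientations reversed. -/
def flip (D : Diagram u v) : Diagram (Word.dual u) (Word.dual v) where
  partner p := (ptDual u v).symm (D.partner (ptDual u v p))
  partner_partner p := by simp [D.partner_partner]
  orient_partner p := by
    have h := D.orient_partner (ptDual u v p)
    rw [← Equiv.apply_symm_apply (ptDual u v) (D.partner _), orient_ptDual, orient_ptDual] at h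
    omega
  planar p q := by
    have h := D.planar (ptDual u v p) (ptDual u v q)
    rw [← Equiv.apply_symm_apply (ptDual u v) (D.partner (ptDual u v p)),
      ← Equiv.apply_symm_apply (ptDual u v) (D.partner (ptDual u v q))] at h
    simpa only [pos_ptDual] using h

theorem flip_partner (D : Diagram u v) (p : Pt u v) :
    D.flip.partner ((ptDual u v).symm p) = (ptDual u v).symm (D.partner p) := by
  change (ptDual u v).symm (D.partner (ptDual u v _)) = _
  rw [Equiv.apply_symm_apply]

/-- The inverse of `Diagram.flip`. -/
def unflip (D : Diagram (Word.dual u) (Word.dual v)) : Diagram u v where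
  partner p := ptDual u v (D.partner ((ptDual u v).symm p))
  partner_partner p := by simp [D.partner_partner]
  orient_partner p := by
    have h := D.orient_partner ((ptDual u v).symm p)
    have h' := orient_ptDual ((ptDual u v).symm p)
    rw [Equiv.apply_symm_apply] at h'
    rw [orient_ptDual, h, h']
  planar p q := by
    have h := D.planar ((ptDual u v).symm p) ((ptDual u v).symm q)
    rw [← pos_ptDual, ← pos_ptDual, ← pos_ptDual (D.partner _), ← pos_ptDual (D.partner _),
      Equiv.apply_symm_apply, Equiv.apply_symm_apply] at h
    exact h

theorem flip_bijective : Function.Bijective (flip : Diagram u v → _) := by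
  refine Function.bijective_iff_has_inverse.2 ⟨unflip, fun D => ?_, fun D => ?_⟩
  · exact ext_partner fun p => by
      change ptDual u v ((ptDual u v).symm (D.partner (ptDual u v ((ptDual u v).symm p)))) = _
      rw [Equiv.apply_symm_apply, Equiv.apply_symm_apply]
  · exact ext_partner fun p => by
      change (ptDual u v).symm (ptDual u v (D.partner ((ptDual u v).symm (ptDual u v p)))) = _
      rw [Equiv.symm_apply_apply, Equiv.symm_apply_apply]

theorem flip_id (u : Word) : (id u).flip = id (Word.dual u) :=
  ext_partner (by rintro (p | p) <;> rfl)

theorem flip_mirror (D : Diagram u v) : D.flip.mirror = D.mirror.flip := by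
  refine ext_partner fun p => ?_
  obtain ⟨p, rfl⟩ := (ptDual v u).symm.surjective p
  have e : ∀ (u v : Word) (p : Pt u v), ((ptDual u v).symm p).swap = (ptDual v u).symm p.swap := by
    rintro u v (p | p) <;> rfl
  rw [flip_partner, mirror_partner, e, flip_partner, e, mirror_partner]

theorem flip_caps (D : Diagram u v) (a : Letter) : D.flip.caps a = D.caps a.dual := by
  refine Finset.card_equiv (finDual u) fun i => ?_
  simp only [Finset.mem_filter, Finset.mem_univ, true_and, get_dual]
  refine and_congr ⟨fun h => by rw [← h, Letter.dual_dual], fun h => by rw [h, Letter.dual_dual]⟩ ?_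
  refine (finDual u).exists_congr fun {j} => and_congr Iff.rfl ?_
  have e : ∀ i, (Sum.inl i : Pt (Word.dual u) (Word.dual v)) =
    (ptDual u v).symm (Sum.inl (finDual u i)) := fun _ => rfl
  rw [e, e, flip_partner, (ptDual u v).symm.injective.eq_iff]

theorem flip_cups (D : Diagram u v) (a : Letter) : D.flip.cups a = D.cups a.dual := by
  rw [← mirror_caps, flip_mirror, flip_caps, mirror_caps]

theorem ell_flip (D : Diagram u v) : D.flip.ell = D.sharp - D.ell := by
  rw [ell, sharp, ell, flip_caps, flip_cups]
  simp only [Letter.dual]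
  push_cast
  ring

theorem sharp_flip (D : Diagram u v) : D.flip.sharp = D.sharp := by
  rw [sharp, sharp, flip_caps, flip_cups, flip_caps, flip_cups]
  simp only [Letter.dual]
  push_cast
  ring

/-- Reversal keeps `sharp` and replaces `ell` by `sharp - ell`. The resulting sign to the power
`sharp` is just what conjugating `c` produces. -/
theorem coeff_flip {c d : ℂ} (hd : d ≠ 0) (h : d = starRingEnd ℂ d ∨ d = -starRingEnd ℂ d)
    (hcd : starRingEnd ℂ (c * d) = c * d) (D : Diagram u v) :
    D.flip.coeff (starRingEnd ℂ c) d = D.coeff c d := by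
  have hs := ne_zero_of_conj hd
  have e : (starRingEnd ℂ d / d) ^ (D.sharp + D.flip.ell) = (starRingEnd ℂ d / d) ^ D.ell := by
    refine zpow_eq_of_cast_eq (conj_div_mul_self hd h) ?_
    rw [ell_flip]
    push_cast
    linear_combination zmod_two_add_self (D.sharp : ZMod 2) -
      zmod_two_add_self (D.ell : ZMod 2)
  rw [coeff, coeff, sharp_flip, conj_eq_of_conj_mul hd h hcd, mul_zpow, ← e, zpow_add₀ hs]
  ring

/-- The points of a stack of two pictures and of its orientation reversal. -/
def stackDual (u v w : Word) : Fin u.length ⊕ Fin v.length ⊕ Fin w.length ≃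
    Fin (Word.dual u).length ⊕ Fin (Word.dual v).length ⊕ Fin (Word.dual w).length :=
  (Equiv.sumCongr (finDual u) (Equiv.sumCongr (finDual v) (finDual w))).symm

theorem stackDual_outer (p : Pt u w) :
    stackDual u v w (outer p) = outer ((ptDual u w).symm p) := by
  rcases p with p | p <;> rfl

theorem stackDual_up (p : Pt u v) : stackDual u v w (Sum.map _root_.id Sum.inl p) =
    Sum.map _root_.id Sum.inl ((ptDual u v).symm p) := by
  rcases p with p | p <;> rfl

theorem stackDual_down (p : Pt v w) : stackDual u v w (Sum.inr p) =
    Sum.inr ((ptDual v w).symm p) := rfl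

theorem glue_stackDual (D : Diagram u v) (E : Diagram v w)
    (x y : Fin u.length ⊕ Fin v.length ⊕ Fin w.length) (h : GlueStep D.partner E.partner x y) :
    glue D.flip.partner E.flip.partner (stackDual u v w x) (stackDual u v w y) := by
  cases h with
  | up p =>
    rw [stackDual_up, stackDual_up, ← flip_partner]
    exact glue_up _
  | down p =>
    rw [stackDual_down, stackDual_down, ← flip_partner]
    exact glue_down _

theorem glue_stackDual_symm (D : Diagram u v) (E : Diagram v w)
    (x y : Fin (Word.dual u).length ⊕ Fin (Word.dual v).length ⊕ Fin (Word.dual w).length)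
    (h : GlueStep D.flip.partner E.flip.partner x y) :
    glue D.partner E.partner ((stackDual u v w).symm x) ((stackDual u v w).symm y) := by
  cases h with
  | up p =>
    obtain ⟨p, rfl⟩ := (ptDual u v).symm.surjective p
    rw [flip_partner, ← stackDual_up, ← stackDual_up, Equiv.symm_apply_apply,
      Equiv.symm_apply_apply]
    exact glue_up _
  | down p =>
    obtain ⟨p, rfl⟩ := (ptDual v w).symm.surjective p
    rw [flip_partner, ← stackDual_down, ← stackDual_down, Equiv.symm_apply_apply,
      Equiv.symm_apply_apply]
    exact glue_down _

theorem flip_loops (D : Diagram u v) (E : Diagram v w) : D.flip.loops E.flip = D.loops E :=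
  (loopCount_equiv (stackDual u v w) (glue_stackDual D E) (glue_stackDual_symm D E)
    (ptDual u w).symm stackDual_outer).symm

theorem flip_comp (D : Diagram u v) (E : Diagram v w) :
    (D.comp E).flip = D.flip.comp E.flip := by
  symm
  refine comp_eq _ _ _ fun p => ?_
  obtain ⟨p, rfl⟩ := (ptDual u w).symm.surjective p
  rw [flip_partner, ← stackDual_outer, ← stackDual_outer]
  exact glue_map _ (glue_stackDual D E) ((D.glue_outer_iff E p _).2 (Or.inr rfl))

/-- Dualizing a concatenation and concatenating duals give equal but differently presented words,
hence the casts; they become the monoidal structure isomorphisms of the reversal functor. -/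
theorem flip_tensor {u' v' : Word} (D : Diagram u v) (E : Diagram u' v')
    (p : Pt (Word.dual u ++ Word.dual u') (Word.dual v ++ Word.dual v')) :
    Sum.map (Fin.cast (congrArg List.length (List.map_append (f := Letter.dual)).symm))
      (Fin.cast (congrArg List.length (List.map_append (f := Letter.dual)).symm))
      ((D.flip.tensor E.flip).partner p) =
    (D.tensor E).flip.partner
      (Sum.map (Fin.cast (congrArg List.length (List.map_append (f := Letter.dual)).symm))
      (Fin.cast (congrArg List.length (List.map_append (f := Letter.dual)).symm)) p) := by
  have e₁ : ∀ x : Pt u v,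
      Sum.map (Fin.cast (congrArg List.length (List.map_append (f := Letter.dual)).symm))
      (Fin.cast (congrArg List.length (List.map_append (f := Letter.dual)).symm))
      (leftPt _ _ (Word.dual u') (Word.dual v') ((ptDual u v).symm x)) =
      (ptDual (u ++ u') (v ++ v')).symm (leftPt u v u' v' x) := by
    rintro (x | x) <;> rfl
  have e₂ : ∀ x : Pt u' v',
      Sum.map (Fin.cast (congrArg List.length (List.map_append (f := Letter.dual)).symm))
      (Fin.cast (congrArg List.length (List.map_append (f := Letter.dual)).symm))
      (rightPt (Word.dual u) (Word.dual v) _ _ ((ptDual u' v').symm x)) =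
      (ptDual (u ++ u') (v ++ v')).symm (rightPt u v u' v' x) := by
    rintro (x | x)
    · refine congrArg Sum.inl (Fin.ext ?_)
      change (Word.dual u).length + (x : ℕ) = u.length + x
      rw [List.length_map]
    · refine congrArg Sum.inr (Fin.ext ?_)
      change (Word.dual v).length + (x : ℕ) = v.length + x
      rw [List.length_map]
  rcases exists_pt p with ⟨x, rfl⟩ | ⟨x, rfl⟩
  · obtain ⟨x, rfl⟩ := (ptDual u v).symm.surjective x
    rw [tensor_leftPt, flip_partner, e₁, e₁, flip_partner, tensor_leftPt]
  · obtain ⟨x, rfl⟩ := (ptDual u' v').symm.surjective x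
    rw [tensor_rightPt, flip_partner, e₂, e₂, flip_partner, tensor_rightPt]

end Diagram

/-- Reversing the orientations of all diagrams in a morphism. -/
noncomputable def flipHom {x y : OKauffman d} (f : x ⟶ y) :
    (OKauffman.mk (Word.dual x.word) : OKauffman d) ⟶ OKauffman.mk (Word.dual y.word) :=
  Finsupp.lmapDomain ℂ ℂ (Diagram.flip : Diagram x.word y.word → _) f

theorem flipHom_zero (x y : OKauffman d) : flipHom (0 : x ⟶ y) = 0 :=
  map_zero (Finsupp.lmapDomain ℂ ℂ (Diagram.flip : Diagram x.word y.word → _))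

theorem flipHom_add {x y : OKauffman d} (f g : x ⟶ y) :
    flipHom (f + g) = flipHom f + flipHom g :=
  map_add (Finsupp.lmapDomain ℂ ℂ (Diagram.flip : Diagram x.word y.word → _)) f g

theorem flipHom_smul {x y : OKauffman d} (a : ℂ) (f : x ⟶ y) :
    flipHom (a • f) = a • flipHom f :=
  map_smul (Finsupp.lmapDomain ℂ ℂ (Diagram.flip : Diagram x.word y.word → _)) a f

theorem flipHom_hom (D : Diagram u v) : flipHom (D.hom d) = D.flip.hom d :=
  Finsupp.mapDomain_single

theorem flipHom_bijective (x y : OKauffman d) : Function.Bijective (flipHom : (x ⟶ y) → _) :=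
  ⟨Finsupp.mapDomain_injective Diagram.flip_bijective.1,
    Finsupp.mapDomain_surjective Diagram.flip_bijective.2⟩

theorem flipHom_comp {x y z : OKauffman d} (f : x ⟶ y) (g : y ⟶ z) :
    flipHom (f ≫ g) = flipHom f ≫ flipHom g := by
  induction f using hom_induction with
  | zero => simp only [Limits.zero_comp, flipHom_zero]
  | add f f' hf hf' => simp only [Preadditive.add_comp, flipHom_add, hf, hf']
  | smul a D =>
  induction g using hom_induction with
  | zero => simp only [Limits.comp_zero, flipHom_zero]
  | add f f' hf hf' => simp only [Preadditive.comp_add, flipHom_add, hf, hf']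
  | smul b E =>
  simp only [Linear.smul_comp, Linear.comp_smul, flipHom_smul]
  congr 2
  refine (congrArg flipHom (hom_comp_hom D E)).trans ?_
  rw [flipHom_smul, flipHom_hom, Diagram.flip_comp, ← Diagram.flip_loops]
  refine (hom_comp_hom _ _).symm.trans ?_
  rw [← flipHom_hom, ← flipHom_hom]

/-- The functor that reverses all orientations. -/
noncomputable def flipFunctor (d : ℂ) : OKauffman d ⥤ OKauffman d where
  obj x := ⟨Word.dual x.word⟩
  map f := flipHom f
  map_id x := by
    rw [id_eq_hom]
    refine (flipHom_hom _).trans ?_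
    rw [Diagram.flip_id]
    rfl
  map_comp f g := flipHom_comp f g

instance : (flipFunctor d).Additive where
  map_add := flipHom_add _ _

instance : (flipFunctor d).Linear ℂ where
  map_smul f r := flipHom_smul r f

instance : (flipFunctor d).Faithful where
  map_injective h := (flipHom_bijective _ _).1 h

instance : (flipFunctor d).Full where
  map_surjective f := (flipHom_bijective _ _).2 f

instance : (flipFunctor d).EssSurj where
  mem_essImage y := ⟨OKauffman.mk (Word.dual y.word),
    ⟨eqToIso (congrArg OKauffman.mk (Word.dual_dual y.word))⟩⟩

instance : (flipFunctor d).IsEquivalence where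

theorem dual_append (x y : OKauffman d) :
    (OKauffman.mk (Word.dual x.word ++ Word.dual y.word) : OKauffman d) =
      OKauffman.mk (Word.dual (x.word ++ y.word)) :=
  congrArg OKauffman.mk List.map_append.symm

theorem flipHom_tensor {x y x' y' : OKauffman d} (f : x ⟶ y) (g : x' ⟶ y') :
    (flipHom f ⊗ₘ flipHom g) ≫ eqToHom (dual_append y y') =
      eqToHom (dual_append x x') ≫ flipHom (f ⊗ₘ g) := by
  induction f using hom_induction with
  | zero => simp only [flipHom_zero, zero_tensor, Limits.zero_comp, Limits.comp_zero]
  | add f f' h h' =>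
    simp only [add_tensor, flipHom_add, Preadditive.add_comp, Preadditive.comp_add, h, h']
  | smul a D =>
  induction g using hom_induction with
  | zero => simp only [flipHom_zero, tensor_zero, Limits.zero_comp, Limits.comp_zero]
  | add f f' h h' =>
    simp only [tensor_add, flipHom_add, Preadditive.add_comp, Preadditive.comp_add, h, h']
  | smul b E =>
  simp only [smul_tensor, tensor_smul, flipHom_smul, Linear.smul_comp, Linear.comp_smul]
  congr 2
  have e₁ : flipHom (D.hom d) ⊗ₘ flipHom (E.hom d) = (D.flip.tensor E.flip).hom d := by
    rw [flipHom_hom, flipHom_hom, hom_tensor_hom]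
  have e₂ : flipHom (D.hom d ⊗ₘ E.hom d) = (D.tensor E).flip.hom d := by
    rw [hom_tensor_hom]
    exact flipHom_hom _
  exact (congrArg (· ≫ _) e₁).trans ((hom_eqToHom List.map_append.symm List.map_append.symm _ _
    (Diagram.flip_tensor D E)).trans (congrArg (_ ≫ ·) e₂.symm))

theorem flipHom_eqToHom {x y : OKauffman d} (h : x = y) : flipHom (eqToHom h) =
    eqToHom (congrArg (fun z : OKauffman d => OKauffman.mk (Word.dual z.word)) h) := by
  subst h
  exact (flipFunctor d).map_id x

/-- A morphism is the identity up to an equality of words. -/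
def IsEqToHom {x y : OKauffman d} (f : x ⟶ y) : Prop := ∃ h : x = y, f = eqToHom h

theorem IsEqToHom.comp {x y z : OKauffman d} {f : x ⟶ y} {g : y ⟶ z} (hf : IsEqToHom f)
    (hg : IsEqToHom g) : IsEqToHom (f ≫ g) := by
  obtain ⟨h, rfl⟩ := hf
  obtain ⟨h', rfl⟩ := hg
  exact ⟨h.trans h', eqToHom_trans _ _⟩

theorem IsEqToHom.whiskerRight {x y : OKauffman d} {f : x ⟶ y} (hf : IsEqToHom f)
    (z : OKauffman d) : IsEqToHom (f ▷ z) := by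
  obtain ⟨h, rfl⟩ := hf
  exact ⟨_, eqToHom_whiskerRight h z⟩

theorem IsEqToHom.whiskerLeft {x y : OKauffman d} (z : OKauffman d) {f : x ⟶ y}
    (hf : IsEqToHom f) : IsEqToHom (z ◁ f) := by
  obtain ⟨h, rfl⟩ := hf
  exact ⟨_, whiskerLeft_eqToHom z h⟩

/-- This settles the coherence diagrams of the reversal functor without computation: all their
arrows are identities up to equalities of words, and parallel morphisms of this kind coincide. -/
theorem IsEqToHom.unique {x y : OKauffman d} {f g : x ⟶ y} (hf : IsEqToHom f)
    (hg : IsEqToHom g) : f = g := by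
  obtain ⟨h, rfl⟩ := hf
  obtain ⟨h', rfl⟩ := hg
  rfl

/-- The functor that reverses all orientations is monoidal. -/
noncomputable def flipCore (d : ℂ) : (flipFunctor d).CoreMonoidal where
  εIso := Iso.refl _
  μIso x y := eqToIso (dual_append x y)
  μIso_hom_natural_left f z := by
    refine Eq.trans ?_ (flipHom_tensor f (𝟙 z))
    exact congrArg (fun g => (_ ⊗ₘ g) ≫ _) ((flipFunctor d).map_id z).symm
  μIso_hom_natural_right z f := by
    refine Eq.trans ?_ (flipHom_tensor (𝟙 z) f)
    exact congrArg (fun g => (g ⊗ₘ _) ≫ _) ((flipFunctor d).map_id z).symm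
  associativity x y z := by
    refine IsEqToHom.unique (.comp (.whiskerRight ⟨dual_append x y, rfl⟩ _)
      (.comp ⟨dual_append (x ⊗ y) z, rfl⟩ ?_)) (.comp ⟨_, associator_eq _ _ _⟩
      (.comp (.whiskerLeft _ ⟨dual_append y z, rfl⟩) ⟨dual_append x (y ⊗ z), rfl⟩))
    exact ⟨_, (congrArg flipHom (associator_eq x y z)).trans (flipHom_eqToHom _)⟩
  left_unitality x := by
    refine IsEqToHom.unique ⟨_, leftUnitor_eq _⟩ (.comp (.whiskerRight ⟨rfl, rfl⟩ _)
      (.comp ⟨dual_append _ x, rfl⟩ ?_))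
    exact ⟨_, (congrArg flipHom (leftUnitor_eq x)).trans (flipHom_eqToHom _)⟩
  right_unitality x := by
    refine IsEqToHom.unique ⟨_, rightUnitor_eq _⟩ (.comp (.whiskerLeft _ ⟨rfl, rfl⟩)
      (.comp ⟨dual_append x _, rfl⟩ ?_))
    exact ⟨_, (congrArg flipHom (rightUnitor_eq x)).trans (flipHom_eqToHom _)⟩

theorem flipHom_adjMap {c : ℂ} (hd : d ≠ 0) (h : d = starRingEnd ℂ d ∨ d = -starRingEnd ℂ d)
    (hcd : starRingEnd ℂ (c * d) = c * d) {x y : OKauffman d} (f : x ⟶ y) :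
    flipHom (adjMap c f) = adjMap (starRingEnd ℂ c) (flipHom f) := by
  induction f using hom_induction with
  | zero => simp only [adjMap_zero, flipHom_zero]
  | add f g hf hg => simp only [adjMap_add, flipHom_add, hf, hg]
  | smul a D =>
    rw [adjMap_smul, flipHom_smul, flipHom_smul, adjMap_smul]
    congr 1
    have e : flipHom (adjMap c (D.hom d)) = adjMap (starRingEnd ℂ c) (flipHom (D.hom d)) := by
      rw [adjMap_hom, flipHom_smul, flipHom_hom, flipHom_hom, adjMap_hom, Diagram.flip_mirror,
        Diagram.coeff_flip hd h hcd]
    exact e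

theorem equivalent_of_flip {c : ℂ} (hd : d ≠ 0)
    (h : d = starRingEnd ℂ d ∨ d = -starRingEnd ℂ d) {hc hcd hc' hcd'} :
    (starOf c hc hd h hcd).Equivalent (starOf (starRingEnd ℂ c) hc' hd h hcd') := by
  refine ⟨flipFunctor d, inferInstance, inferInstance, (flipCore d).toMonoidal,
    inferInstance, fun f => flipHom_adjMap hd h hcd f, ?_, fun x y => ?_⟩
  · exact (starOf _ hc' hd h hcd').adj_id _
  · exact (starOf _ hc' hd h hcd').adj_eqToHom (dual_append x y)

end OrientedKauffman

/-! ### Monoidal self-equivalences, and invariance of the parameter. -/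

namespace OrientedKauffman

variable {d : ℂ} {u v w : Word}

namespace Diagram

/-- A diagram that has a left inverse up to scalars has only vertical strings at the top. -/
theorem through_of_comp_eq_id {D : Diagram u v} {E : Diagram v u} (h : D.comp E = id u)
    (i : Fin u.length) : ∃ j, D.partner (Sum.inl i) = Sum.inr j := by
  rcases hj : D.partner (Sum.inl i) with j | j
  · have hg := glue_up (σ := D.partner) (τ := E.partner) (Sum.inl i)
    rw [hj] at hg
    have hne : (Sum.inl j : Pt u u) ≠ Sum.inl i := fun e =>
      D.partner_ne (Sum.inl i) (hj.trans (congrArg Sum.inl (Sum.inl_injective e)))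
    have := comp_partner_eq D E (p := Sum.inl i) (q := Sum.inl j) hg hne
    rw [h] at this
    exact absurd this (by simp [id])
  · exact ⟨j, rfl⟩

end Diagram

/-- Otherwise no pair of diagrams could contribute to the coefficient of the identity diagram in the
composite, which would then be 0 and not 1. -/
theorem exists_comp_eq_id (f : Diagram u v →₀ ℂ) (g : Diagram v u →₀ ℂ)
    (h : compL d u v u f g = Finsupp.single (Diagram.id u) 1) :
    ∃ (D : Diagram u v) (E : Diagram v u), D.comp E = Diagram.id u := by
  by_contra! hne
  have key : ∀ (f : Diagram u v →₀ ℂ) (g : Diagram v u →₀ ℂ),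
      compL d u v u f g (Diagram.id u) = 0 := by
    intro f g
    induction f using Finsupp.induction_linear with
    | zero => rw [map_zero, LinearMap.zero_apply, Finsupp.zero_apply]
    | add f f' hf hf' => rw [map_add, LinearMap.add_apply, Finsupp.add_apply, hf, hf', add_zero]
    | single D a =>
    induction g using Finsupp.induction_linear with
    | zero => rw [map_zero, Finsupp.zero_apply]
    | add f f' hf hf' => rw [map_add, Finsupp.add_apply, hf, hf', add_zero]
    | single E b => rw [compL_single, Finsupp.single_eq_of_ne (hne D E).symm]
  have := key f g
  rw [h, Finsupp.single_eq_same] at this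
  exact one_ne_zero this

/-- Isomorphic objects are equal. -/
theorem eq_of_iso {x y : OKauffman d} (e : x ≅ y) : x = y := by
  obtain ⟨D, E, h⟩ := exists_comp_eq_id e.hom e.inv e.hom_inv_id
  obtain ⟨D', E', h'⟩ := exists_comp_eq_id e.inv e.hom e.inv_hom_id
  have t := Diagram.through_of_comp_eq_id h
  have t' := Diagram.through_of_comp_eq_id h'
  exact OKauffman.ext (D.eq_of_through t (le_antisymm (D'.length_le_of_through t')
    (D.length_le_of_through t)))

section Monoidal

variable (F : OKauffman d ⥤ OKauffman d) [F.Monoidal]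

/-- Since isomorphic words are equal, a monoidal functor acts on objects as a strict homomorphism of
the free monoid of words. -/
theorem obj_eq_flatMap (w : Word) :
    (F.obj (OKauffman.mk w)).word = w.flatMap fun a => (F.obj (OKauffman.mk [a])).word := by
  induction w with
  | nil => exact (congrArg OKauffman.word (eq_of_iso (Functor.Monoidal.εIso F))).symm
  | cons a w ih =>
    have h := congrArg OKauffman.word
      (eq_of_iso (Functor.Monoidal.μIso F (OKauffman.mk [a]) (OKauffman.mk w)))
    rw [List.flatMap_cons, ← ih]
    exact h.symm

/-- The one-letter word is the image of some word, hence a concatenation of images of letters; the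
block containing the letter has to be the whole word. -/
theorem exists_obj_eq [F.EssSurj] (a : Letter) :
    ∃ b, F.obj (OKauffman.mk [b]) = OKauffman.mk [a] := by
  have h := congrArg OKauffman.word (eq_of_iso (F.objObjPreimageIso (OKauffman.mk [a])))
  have h' := obj_eq_flatMap F (F.objPreimage (OKauffman.mk [a])).word
  rw [show OKauffman.mk (F.objPreimage (OKauffman.mk [a])).word =
    F.objPreimage (OKauffman.mk [a]) from rfl, h] at h'
  have ha : a ∈ (F.objPreimage (OKauffman.mk [a])).word.flatMap
      fun a => (F.obj (OKauffman.mk [a])).word := by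
    rw [← h']; exact List.mem_singleton_self a
  obtain ⟨b, hb, hab⟩ := List.mem_flatMap.1 ha
  refine ⟨b, OKauffman.ext ?_⟩
  -- The block is a sublist of a concatenation that has only one letter.
  have hl : (F.obj (OKauffman.mk [b])).word.length ≤ 1 := by
    have := (List.sublist_flatten_of_mem (List.mem_map_of_mem hb
      (f := fun a => (F.obj (OKauffman.mk [a])).word))).length_le
    rw [← List.flatMap_def, ← h'] at this
    exact this
  generalize (F.obj (OKauffman.mk [b])).word = l at hab hl ⊢
  rcases l with _ | ⟨c, _ | ⟨c', l⟩⟩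
  · exact absurd hab (List.not_mem_nil)
  · exact congrArg (fun a => [a]) (List.mem_singleton.1 hab).symm
  · simp at hl

end Monoidal

/-- By one-dimensionality `e` and `n` are k and m times the standard arc and its reflection. The
loop value gives m k = 1, and the star relation gives (conj k) · `coeff` = c m, so that c = |k|² ·
`coeff`. The objects are variables so that equalities of objects can be eliminated. -/
theorem exists_pos_of_arc {c c' : ℂ} (hd : d ≠ 0) (a : Letter) (x y : OKauffman d)
    (hx : x = OKauffman.mk [a]) (hy : y = OKauffman.mk [a.dual]) (e : x ⊗ y ⟶ 𝟙_ (OKauffman d))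
    (n : 𝟙_ (OKauffman d) ⟶ x ⊗ y) (he : adjMap c' e = c • n)
    (hne : n ≫ e = d • 𝟙 (𝟙_ (OKauffman d))) :
    ∃ l : ℝ, 0 < l ∧ c = l * (Diagram.arc a).coeff c' d := by
  subst hx hy
  obtain ⟨k, rfl⟩ : ∃ k : ℂ, e = k • (Diagram.arc a).hom d :=
    exists_eq_smul_hom (Diagram.arc a) e
  obtain ⟨m, rfl⟩ : ∃ m : ℂ, n = m • (Diagram.arc a).mirror.hom d :=
    exists_eq_smul_hom (Diagram.arc a).mirror n
  have h₁ : (starRingEnd ℂ k * (Diagram.arc a).coeff c' d) • (Diagram.arc a).mirror.hom d =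
      (c * m) • (Diagram.arc a).mirror.hom d :=
    (adjMap_smul_hom c' k (Diagram.arc a)).symm.trans (he.trans (smul_smul _ _ _))
  have h₂ : (m • (Diagram.arc a).mirror.hom d) ≫ (k • (Diagram.arc a).hom d) =
      d • (Diagram.id []).hom d := hne
  rw [Linear.smul_comp, Linear.comp_smul, arc_loop, smul_smul, smul_smul] at h₂
  have h₁' := smul_hom_injective _ h₁
  have hmk : m * k = 1 := mul_right_cancel₀ hd (by rw [one_mul]; exact smul_hom_injective _ h₂)
  refine ⟨Complex.normSq k, Complex.normSq_pos.2 (right_ne_zero_of_mul (hmk ▸ one_ne_zero)), ?_⟩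
  rw [← Complex.mul_conj]
  linear_combination -c * hmk - k * h₁'

/-- Applied to the arc on X and its reflection, `F` yields a pair with the same loop value `d` and,
because the structure isomorphisms are unitary, with the same scalar `c` relating the star of one to
the other. -/
theorem exists_pos_of_functor {c c' : ℂ} (hd : d ≠ 0)
    (h : d = starRingEnd ℂ d ∨ d = -starRingEnd ℂ d) {hc hcd hc' hcd'}
    (F : OKauffman d ⥤ OKauffman d) [F.Additive] [F.Linear ℂ] [F.Monoidal]
    (hF : ∀ {x y : OKauffman d} (f : x ⟶ y), F.map ((starOf c hc hd h hcd).adj f) =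
      (starOf c' hc' hd h hcd').adj (F.map f))
    (hε : (starOf c' hc' hd h hcd').adj (Functor.LaxMonoidal.ε F) = Functor.OplaxMonoidal.η F)
    (hμ : ∀ x y, (starOf c' hc' hd h hcd').adj (Functor.LaxMonoidal.μ F x y) =
      Functor.OplaxMonoidal.δ F x y) (a : Letter)
    (hX : F.obj (OKauffman.mk [Letter.X]) = OKauffman.mk [a])
    (hX' : F.obj (OKauffman.mk [Letter.Xstar]) = OKauffman.mk [a.dual]) :
    ∃ l : ℝ, 0 < l ∧ c = l * (Diagram.arc a).coeff c' d := by
  let x : OKauffman d := OKauffman.mk [Letter.X]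
  let y : OKauffman d := OKauffman.mk [Letter.Xstar]
  let e : x ⊗ y ⟶ 𝟙_ (OKauffman d) := (Diagram.arc Letter.X).hom d
  let n : 𝟙_ (OKauffman d) ⟶ x ⊗ y := (Diagram.arc Letter.X).mirror.hom d
  have hen : (starOf c hc hd h hcd).adj e = c • n := by
    refine (adjMap_hom c (Diagram.arc Letter.X)).trans ?_
    rw [Diagram.coeff_arc_X]
    rfl
  have hne : n ≫ e = d • 𝟙 (𝟙_ (OKauffman d)) := arc_loop Letter.X
  refine exists_pos_of_arc hd a _ _ hX hX'
    -- The images of the arc and its reflection, conjugated by the structure isomorphisms so as to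
    -- live between F(X) ⊗ F(X*) and the unit.
    (Functor.LaxMonoidal.μ F x y ≫ F.map e ≫ Functor.OplaxMonoidal.η F)
    (Functor.LaxMonoidal.ε F ≫ F.map n ≫ Functor.OplaxMonoidal.δ F x y) ?_ ?_
  · change (starOf c' hc' hd h hcd').adj _ = _
    rw [CompatibleStar.adj_comp, CompatibleStar.adj_comp, hμ, ← hF, hen, ← hε,
      CompatibleStar.adj_adj, Functor.map_smul, Linear.comp_smul, Linear.smul_comp,
      Category.assoc]
  · rw [Category.assoc, Category.assoc, Functor.Monoidal.δ_μ_assoc, ← Functor.map_comp_assoc, hne,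
      Functor.map_smul, CategoryTheory.Functor.map_id, Linear.smul_comp, Category.id_comp, Linear.comp_smul,
      Functor.Monoidal.ε_η]

theorem exists_pos_of_equivalent {c c' : ℂ} (hd : d ≠ 0)
    (h : d = starRingEnd ℂ d ∨ d = -starRingEnd ℂ d) {hc hcd hc' hcd'}
    (e : (starOf c hc hd h hcd).Equivalent (starOf c' hc' hd h hcd')) :
    (∃ l : ℝ, 0 < l ∧ c = l * c') ∨ ∃ l : ℝ, 0 < l ∧ starRingEnd ℂ c = l * c' := by
  obtain ⟨F, _, _, _, _, hF, hε, hμ⟩ := e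
  have key := exists_pos_of_functor hd h F hF hε hμ
  obtain ⟨a, ha⟩ := exists_obj_eq F Letter.X
  obtain ⟨b, hb⟩ := exists_obj_eq F Letter.Xstar
  have hne : (OKauffman.mk [Letter.X] : OKauffman d) ≠ OKauffman.mk [Letter.Xstar] := fun e =>
    absurd (congrArg OKauffman.word e) (show [Letter.X] ≠ [Letter.Xstar] by decide)
  -- `F` sends `[a]` to X and `[b]` to X*. Equal letters would identify X with X*; the other two
  -- cases are fixing and interchanging the letters.
  cases a <;> cases b
  · exact absurd (ha.symm.trans hb) hne
  · obtain ⟨l, hl, hlc⟩ := key Letter.X ha hb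
    exact Or.inl ⟨l, hl, by rwa [Diagram.coeff_arc_X] at hlc⟩
  · obtain ⟨l, hl, hlc⟩ := key Letter.Xstar hb ha
    rw [Diagram.coeff_arc_Xstar] at hlc
    refine Or.inr ⟨l, hl, ?_⟩
    -- The sign in the coefficient of the other arc cancels against the sign between c and its
    -- conjugate.
    rw [conj_eq_of_conj_mul hd h hcd, hlc]
    linear_combination (l * c' : ℂ) * conj_div_mul_self hd h
  · exact absurd (ha.symm.trans hb) hne

theorem starOf_equivalent_iff {c c' : ℂ} (hd : d ≠ 0)
    (h : d = starRingEnd ℂ d ∨ d = -starRingEnd ℂ d)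
    (hc : c ≠ 0) (hcd : starRingEnd ℂ (c * d) = c * d)
    (hc' : c' ≠ 0) (hcd' : starRingEnd ℂ (c' * d) = c' * d) :
    (starOf c hc hd h hcd).Equivalent (starOf c' hc' hd h hcd') ↔
      (∃ l : ℝ, 0 < l ∧ c = l * c') ∨ ∃ l : ℝ, 0 < l ∧ starRingEnd ℂ c = l * c' := by
  refine ⟨exists_pos_of_equivalent hd h, ?_⟩
  rintro (⟨l, hl, e⟩ | ⟨l, hl, e⟩)
  · exact equivalent_of_scaling hd h hl e
  · have hconj : starRingEnd ℂ (starRingEnd ℂ c * d) = starRingEnd ℂ c * d := by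
      rw [conj_eq_of_conj_mul hd h hcd, mul_assoc, map_mul, conj_conj_div hd h, hcd]
    exact (equivalent_of_flip hd h (hc' := (map_ne_zero _).2 hc) (hcd' := hconj)).trans
      (equivalent_of_scaling hd h hl e)

theorem exists_sq_eq_iff : (∃ r : ℝ, d ^ 2 = (r : ℂ)) ↔
    d = starRingEnd ℂ d ∨ d = -starRingEnd ℂ d := by
  rw [← mul_self_eq_mul_self_iff, ← map_mul, ← sq, eq_comm, Complex.conj_eq_iff_real]

end OrientedKauffman

/-! ### The main theorem. -/

open OrientedKauffman

theorem proposition4p1 (d : ℂ) (hd : d ≠ 0) :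
    (Nonempty (CompatibleStar (OrientedKauffman.OKauffman d)) ↔ ∃ r : ℝ, d ^ 2 = (r : ℂ)) ∧
    ((∃ r : ℝ, d ^ 2 = (r : ℂ)) ↔ d = starRingEnd ℂ d ∨ d = -starRingEnd ℂ d) ∧
    ((∃ r : ℝ, d ^ 2 = (r : ℂ)) →
      ∃ Φ : {c : ℂ // c ≠ 0 ∧ starRingEnd ℂ (c * d) = c * d} ≃
          CompatibleStar (OrientedKauffman.OKauffman d),
        (∀ (c : {c : ℂ // c ≠ 0 ∧ starRingEnd ℂ (c * d) = c * d})
            (u v : OrientedKauffman.Word) (D : OrientedKauffman.Diagram u v),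
          (Φ c).adj (D.hom d) =
            ((c : ℂ) ^ D.sharp * (starRingEnd ℂ d / d) ^ D.ell) • D.mirror.hom d) ∧
        ∀ c c' : {c : ℂ // c ≠ 0 ∧ starRingEnd ℂ (c * d) = c * d},
          (Φ c).Equivalent (Φ c') ↔
            (∃ l : ℝ, 0 < l ∧ (c : ℂ) = l * (c' : ℂ)) ∨
              ∃ l : ℝ, 0 < l ∧ starRingEnd ℂ (c : ℂ) = l * (c' : ℂ)) := by
  refine ⟨?_, exists_sq_eq_iff, fun h => ?_⟩
  · rw [exists_sq_eq_iff]
    -- The parameter c = d⁻¹ is always admissible, because then c d = 1.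
    exact ⟨fun ⟨S⟩ => eq_conj_of_star S, fun h => ⟨starOf d⁻¹ (inv_ne_zero hd) hd h
      (by rw [inv_mul_cancel₀ hd, map_one])⟩⟩
  rw [exists_sq_eq_iff] at h
  refine ⟨Equiv.ofBijective (fun c => starOf c.1 c.2.1 hd h c.2.2)
    ⟨fun c c' e => Subtype.ext (starOf_injective hd h e), fun S => ?_⟩,
    fun c u v D => adjMap_hom c.1 D,
    fun c c' => starOf_equivalent_iff hd h c.2.1 c.2.2 c'.2.1 c'.2.2⟩
  obtain ⟨c, hc, hcd, e⟩ := exists_starOf_eq S hd h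
  exact ⟨⟨c, hc, hcd⟩, e⟩
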